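/- All polytopes are convex polytopes in Euclidean space; a polytope is simplicial if all its proper faces are simplices. The facet hypergraph $\mathcal F(P)$ of a polytope $P$ has the vertices of $P$ as vertices and, for every facet of $P$, the set of vertices of that facet as a hyperedge; the facet hypergraph $\mathcal F(K)$ of a simplicial complex $K$ has the vertices of $K$ as vertices and the inclusion-maximal faces (facets) of $K$ as hyperedges. The boundary complex of a simplicial polytope $P$ is the simplicial complex whose facets are the hyperedges of $\mathcal F(P)$. The transversal number $\tau(\mathcal H)$ of a hypergraph $\mathcal H$ is the minimum size of a set of vertices that meets every hyperedge; its transversal ratio is $\tau(\mathcal H)$ divided by the number of vertices of $\mathcal H$. If $K_1,K_2$ are simplicial $d$-spheres and $\psi:f_1\to f_2$ is a bijection from a facet of $K_1$ to a facet of $K_2$, the connected sum $K_1\#_\psi K_2$ is obtained from the disjoint union of $K_1\setminus\{f_1\}$ and $K_2\setminus\{f_2\}$ by identifying each proper subface $g$ of $f_1$ with $\psi(g)$. For $d\ge 2$ let $S^d$ be the boundary complex of the simplex on $d+2$ vertices and $C^d$ the boundary complex of the $(d+1)$-dimensional cross-polytope. Let $C^d_+=C^d\#_\psi S^d$ for a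 bijection $\psi$ from a facet $p$ of $C^d$ to a facet $q$ of $S^d$; its apex vertex is the vertex of $S^d$ not in $q$, and its base facet is the facet of $C^d$ antipodal to $p$. Let $X^d_1=S^d$, with an arbitrary vertex as apex vertex. For $k\ge 1$ let $X^d_{k+1}=X^d_k\#_{\psi}C^d_+$, where $\psi$ is an arbitrary bijection from an arbitrary facet of $X^d_k$ containing the apex vertex to the base facet of $C^d_+$; the apex vertex of $X^d_{k+1}$ is that of $C^d_+$. **Theorem.** Let $d\ge 2$. 1. There is an infinite sequence $P_1,P_2,\dots$ of $(d+1)$-dimensional simplicial polytopes in $\mathbb R^{d+1}$ whose boundary complexes are pairwise non-isomorphic, such that the transversal ratio of $\mathcal F(P_k)$ is exactly $\frac{2}{d+2}$ and the boundary complex of $P_k$ is isomorphic to a complex $X^d_k$, for every $k\ge1$. 2. For every $k\ge 1$ and all choices made in the construction of $X^d_k$, the complex $X^d_k$ has exactly $k(d+2)$ vertices, $\tau(\mathcal F(X^d_k))=2k$, and $X^d_k$ is isomorphic to the boundary complex of a $(d+1)$-dimensional simplicial polytope in $\mathbb R^{d+1}$. Moreover, for $d=2$ the value is the largest possible: the maximum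 of the transversal ratio of $\mathcal F(P)$ over all $3$-dimensional simplicial polytopes $P$ in $\mathbb R^3$ exists and equals $\frac12$. -/

import Mathlib

namespace FacetTransversal

/-! ### Hypergraphs: transversals -/

/-- A transversal of `H`: a set of vertices meeting every hyperedge. -/
def IsTransversal {α : Type*} (H : Hypergraph α) (T : Finset α) : Prop :=
  (T : Set α) ⊆ H.vertexSet ∧ ∀ e ∈ H.edgeSet, ∃ v ∈ T, v ∈ e

/-- The transversal number `τ(H)`: the minimum size of a transversal. -/
noncomputable def transversalNumber {α : Type*} (H : Hypergraph α) : ℕ :=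
  sInf {n : ℕ | ∃ T : Finset α, IsTransversal H T ∧ T.card = n}

/-- The transversal ratio: the transversal number divided by the number of vertices. -/
noncomputable def transversalRatio {α : Type*} (H : Hypergraph α) : ℚ :=
  (transversalNumber H : ℚ) / (H.vertexSet.ncard : ℚ)

/-! ### Simplicial complexes

Mathlib's abstract simplicial complexes are used; by convention the empty face is not listed. -/

/-- The vertices of a simplicial complex. -/
def vertices {V : Type*} (K : PreAbstractSimplicialComplex V) : Set V :=
  {v | ({v} : Finset V) ∈ K.faces}

/-- A facet of a simplicial complex: a face that is maximal under inclusion. -/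
def IsFacet {V : Type*} (K : PreAbstractSimplicialComplex V) (f : Finset V) : Prop :=
  Maximal (fun s => s ∈ K.faces) f

/-- The facet hypergraph `F(K)` of a simplicial complex. -/
def facetHypergraph {V : Type*} (K : PreAbstractSimplicialComplex V) : Hypergraph V where
  vertexSet := vertices K
  edgeSet := {e | ∃ f : Finset V, IsFacet K f ∧ e = (f : Set V)}
  subset_vertexSet_of_mem_edgeSet' := by
    rintro e ⟨f, hf, rfl⟩ v hv
    exact (K.isRelLowerSet_faces hf.1).2 (Finset.singleton_subset_iff.2 hv)
      (Finset.singleton_nonempty v)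

/-- The simplicial complex `K(H)` of all (nonempty, finite) subsets of hyperedges of `H`. -/
def complexOf {V : Type*} (H : Hypergraph V) : PreAbstractSimplicialComplex V where
  faces := {s | s.Nonempty ∧ ∃ e ∈ H.edgeSet, (s : Set V) ⊆ e}
  isRelLowerSet_faces := by
    rintro s ⟨hs, e, he, hse⟩
    exact ⟨hs, fun t hts ht => ⟨ht, e, he, fun x hx => hse (hts hx)⟩⟩

open Classical in
/-- Two simplicial complexes are isomorphic if a map that is injective on vertices carries the
faces of one exactly onto the faces of the other. -/
def Isomorphic {V W : Type*} (K : PreAbstractSimplicialComplex V)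
    (L : PreAbstractSimplicialComplex W) : Prop :=
  ∃ φ : V → W, Set.InjOn φ (vertices K) ∧ K.map φ = L

/-- The boundary complex `S^d` of the abstract `(d+1)`-simplex on the vertex set `Fin (d + 2)`. -/
def simplexBoundary (d : ℕ) : PreAbstractSimplicialComplex (Fin (d + 2)) where
  faces := {s | s.Nonempty ∧ s ≠ Finset.univ}
  isRelLowerSet_faces := by
    rintro s ⟨hs, hsu⟩
    refine ⟨hs, fun t hts ht => ⟨ht, fun htu => hsu ?_⟩⟩
    rw [htu] at hts
    exact Finset.univ_subset_iff.1 hts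

/-- The boundary complex `C^d` of the `(d+1)`-dimensional cross polytope, i.e. the `(d+1)`-fold
join of `S^0`. The vertices come in `d + 1` antipodal pairs `(i, true), (i, false)`, and the faces
are the nonempty sets of vertices that contain no antipodal pair. -/
def crossPolytopeBoundary (d : ℕ) : PreAbstractSimplicialComplex (Fin (d + 1) × Bool) where
  faces := {s | s.Nonempty ∧ ∀ i, ¬ ((i, true) ∈ s ∧ (i, false) ∈ s)}
  isRelLowerSet_faces := by
    rintro s ⟨hs, h⟩
    exact ⟨hs, fun t hts ht => ⟨ht, fun i hi => h i ⟨hts hi.1, hts hi.2⟩⟩⟩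

/-- The image of a set of vertices of `C^d` under the antipodal action. -/
def antipode {d : ℕ} (s : Finset (Fin (d + 1) × Bool)) : Finset (Fin (d + 1) × Bool) :=
  s.image fun x => (x.1, !x.2)

/-! ### Connected sums -/

/-- `K` with the faces containing `f` removed. If `f` is a facet, this is `K \ {f}`
(see `removeFacet_faces`). -/
def removeFacet {V : Type*} (K : PreAbstractSimplicialComplex V) (f : Finset V) :
    PreAbstractSimplicialComplex V where
  faces := {s | s ∈ K.faces ∧ ¬ f ⊆ s}
  isRelLowerSet_faces := by
    rintro s ⟨hs, hfs⟩
    exact ⟨(K.isRelLowerSet_faces hs).1, fun t hts ht =>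
      ⟨(K.isRelLowerSet_faces hs).2 hts ht, fun hft => hfs (hft.trans hts)⟩⟩

theorem removeFacet_faces {V : Type*} {K : PreAbstractSimplicialComplex V} {f : Finset V}
    (hf : IsFacet K f) : (removeFacet K f).faces = K.faces \ {f} := by
  ext s
  constructor
  · rintro ⟨hs, hfs⟩
    exact ⟨hs, fun h => hfs (by rw [Set.mem_singleton_iff.1 h])⟩
  · rintro ⟨hs, hne⟩
    exact ⟨hs, fun hfs => hne (le_antisymm (hf.2 hs hfs) hfs)⟩

open Classical in
/-- The vertex map of the second summand into a connected sum along `ψ : f ≃ g`: the vertices of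
`g` are identified with those of `f` through `ψ`, the other ones are kept. -/
noncomputable def glue {V W : Type*} (f : Finset V) (g : Finset W) (ψ : f ≃ g) (w : W) :
    V ⊕ {w : W // w ∉ g} :=
  if h : w ∈ g then Sum.inl (ψ.symm ⟨w, h⟩ : V) else Sum.inr ⟨w, h⟩

open Classical in
/-- The connected sum `K #_ψ L` along a bijection `ψ` from a facet `f` of `K` to a facet `g` of
`L`: the disjoint union of `K \ {f}` and `L \ {g}`, with the proper subfaces of `f` and `g`
identified through `ψ`. The quotient of the disjoint union of the vertex sets is represented by
`V ⊕ {w // w ∉ g}`. -/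
noncomputable def connectedSum {V W : Type*} (K : PreAbstractSimplicialComplex V)
    (L : PreAbstractSimplicialComplex W) (f : Finset V) (g : Finset W) (ψ : f ≃ g) :
    PreAbstractSimplicialComplex (V ⊕ {w : W // w ∉ g}) :=
  (removeFacet K f).map Sum.inl ⊔ (removeFacet L g).map (glue f g ψ)

/-- The complex `C^d_+`: the connected sum of `C^d` and `S^d` along a bijection between a facet
`p` of `C^d` and a facet `q` of `S^d`. -/
noncomputable def crossPlus (d : ℕ) (p : Finset (Fin (d + 1) × Bool)) (q : Finset (Fin (d + 2)))
    (ψ : p ≃ q) :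
    PreAbstractSimplicialComplex ((Fin (d + 1) × Bool) ⊕ {w : Fin (d + 2) // w ∉ q}) :=
  connectedSum (crossPolytopeBoundary d) (simplexBoundary d) p q ψ

/-- The base facet of `C^d_+`: the facet of `C^d` antipodal to the facet `p` glued to `S^d`. -/
def baseFacet (d : ℕ) (p : Finset (Fin (d + 1) × Bool)) (q : Finset (Fin (d + 2))) :
    Finset ((Fin (d + 1) × Bool) ⊕ {w : Fin (d + 2) // w ∉ q}) :=
  (antipode p).map Function.Embedding.inl

theorem apex_notMem_baseFacet (d : ℕ) (p : Finset (Fin (d + 1) × Bool))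
    (q : Finset (Fin (d + 2))) (w : {w : Fin (d + 2) // w ∉ q}) :
    (Sum.inr w : (Fin (d + 1) × Bool) ⊕ {w : Fin (d + 2) // w ∉ q}) ∉ baseFacet d p q := by
  simp [baseFacet]

/-- `IsX d k V X a` says that the complex `X` on the vertex type `V` is one of the complexes
`X^d_k` and that `a` is its apex vertex, for some choices in the inductive construction:
* `X^d_1 = S^d`, with an arbitrary vertex as apex vertex;
* `X^d_{k+1}` is the connected sum of `X^d_k` and `C^d_+` along an arbitrary bijection from an
  arbitrary facet `f` of `X^d_k` containing the apex vertex to the base facet of `C^d_+`; its apex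
  vertex is the apex vertex of `C^d_+`, i.e. the vertex `w` of `S^d` opposite to the facet `q`
  that was glued to `C^d`. -/
inductive IsX (d : ℕ) :
    ℕ → (V : Type) → PreAbstractSimplicialComplex V → V → Prop
  | one (a : Fin (d + 2)) : IsX d 1 (Fin (d + 2)) (simplexBoundary d) a
  | succ {k : ℕ} {V : Type} {X : PreAbstractSimplicialComplex V} {a : V}
      (hX : IsX d k V X a)
      (f : Finset V) (hf : IsFacet X f) (haf : a ∈ f)
      (p : Finset (Fin (d + 1) × Bool)) (hp : IsFacet (crossPolytopeBoundary d) p)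
      (q : Finset (Fin (d + 2))) (hq : IsFacet (simplexBoundary d) q)
      (ψS : p ≃ q) (ψ : f ≃ baseFacet d p q) (w : {w : Fin (d + 2) // w ∉ q}) :
      IsX d (k + 1)
        (V ⊕ {x : (Fin (d + 1) × Bool) ⊕ {w : Fin (d + 2) // w ∉ q} // x ∉ baseFacet d p q})
        (connectedSum X (crossPlus d p q ψS) f (baseFacet d p q) ψ)
        (Sum.inr ⟨Sum.inr w, apex_notMem_baseFacet d p q w⟩)

/-! ### Polytopes -/

section Polytopes

variable {E : Type*} [NormedAddCommGroup E] [NormedSpace ℝ E]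

/-- A geometric simplex (possibly empty): the convex hull of finitely many affinely independent
points. -/
def IsGeometricSimplex (F : Set E) : Prop :=
  ∃ s : Finset E, AffineIndependent ℝ (fun x : s => (x : E)) ∧ F = convexHull ℝ (s : Set E)

/-- An `n`-dimensional simplicial polytope: the convex hull of a finite nonempty set of points, of
affine dimension `n`, all of whose proper faces are simplices. -/
structure IsSimplicialPolytope (n : ℕ) (P : Set E) : Prop where
  nonempty : P.Nonempty
  exists_convexHull : ∃ s : Finset E, P = convexHull ℝ (s : Set E)
  dim_eq : Module.finrank ℝ (vectorSpan ℝ P) = n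
  simplicial : ∀ F : Set E, IsExposed ℝ P F → F ≠ P → IsGeometricSimplex F

/-- A facet of a polytope: a nonempty face of codimension one. -/
def IsPolytopeFacet (P F : Set E) : Prop :=
  IsExposed ℝ P F ∧ F.Nonempty ∧
    Module.finrank ℝ (vectorSpan ℝ F) + 1 = Module.finrank ℝ (vectorSpan ℝ P)

/-- The facet hypergraph `F(P)` of a polytope: its vertices are the vertices of `P`, and each
facet of `P` is represented as the set of its vertices. -/
def polytopeFacetHypergraph (P : Set E) : Hypergraph E where
  vertexSet := P.extremePoints ℝ
  edgeSet := {e | ∃ F : Set E, IsPolytopeFacet P F ∧ e = F.extremePoints ℝ}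
  subset_vertexSet_of_mem_edgeSet' := by
    rintro e ⟨F, hF, rfl⟩
    exact hF.1.isExtreme.extremePoints_subset_extremePoints

/-- The boundary complex `K(P)` of a simplicial polytope. -/
def boundaryComplex (P : Set E) : PreAbstractSimplicialComplex E :=
  complexOf (polytopeFacetHypergraph P)

end Polytopes

end FacetTransversal

open FacetTransversal

/-! Gluing `C^d_+` onto a facet `b` deletes `b` and adds `d + 2` vertices: an antipode of each
vertex of `b`, and an apex. The new facets are the mixed ones (antipodes over a nonempty proper
index set `A`, vertices of `b` over its complement) and the apex facets (the apex with all antipodes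
but one).

For the transversal number, the induction (`IsTower.glued`) carries two facts besides the value
`2k`: dropping one facet at the apex lowers the bound by at most one, and any two facets at the apex
share a further vertex. Let `T` be a transversal after gluing. If `T` misses `b`, its old part has
at least `2k - 1` vertices, and the mixed facets with a single antipode force all `d + 1 ≥ 3`
antipodes into `T`. If `T` meets `b`, its old part is a transversal of the old complex, and the apex
facets force a new vertex. A single new vertex cannot be an antipode, as some apex facet omits it.
If it is the apex, the mixed facets with a single old vertex force all of `b` into `T`; the old apex
is then redundant in `T`, so the old part has at least `2k + 1` vertices. Conversely, a transversal
of the old complex is completed by the new apex and the antipode of a vertex of `b` that it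
contains.

For polytopality, `IsRealization` encodes a polytope around the origin by linearly independent facet
cones that cover the space, with a supporting functional for each facet. Gluing is a regular
subdivision of one cone, lifted by a small amount (`IsRealization.refine`, with explicit data in
`IsRealization.glued`).

For `d = 2`, the vertices of every simplicial 3-polytope have a two-colouring without monochromatic
facets; both colour classes are transversals and one has at most half of the vertices. Tutte's
condition holds for the dual graph, so the triangles are matched across edges
(`exists_triangle_matching`). The cochain equal to 0 on matched edges and 1 on the others sums to
zero modulo 2 on each triangle. The first cohomology vanishes, as a sweep by a generic functional
shows (`IsRealization.exists_potential`), so the cochain is the coboundary of a colouring. This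
applies to arbitrary polytopes because each is a realization of its facets
(`IsSimplicialPolytope.exists_isRealization`, by polarity). The tetrahedron attains `1/2`. -/

namespace FacetTransversal

/-! ### Convex hulls of finite sets -/

section ConvexHull

variable {E : Type*} [NormedAddCommGroup E] [NormedSpace ℝ E]

/-- The face of a convex hull on which a functional attains the value `M`, an upper bound. -/
theorem setOf_convexHull_eq {s : Set E} (l : E →ₗ[ℝ] ℝ) {M : ℝ} (h : ∀ x ∈ s, l x ≤ M) :
    {x ∈ convexHull ℝ s | l x = M} = convexHull ℝ {x ∈ s | l x = M} := by
  have hle : ∀ x ∈ convexHull ℝ s, l x ≤ M := fun x hx =>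
    convexHull_min (t := {x | l x ≤ M}) h (convex_halfSpace_le l.isLinear M) hx
  have heq : ∀ x ∈ convexHull ℝ {x ∈ s | l x = M}, l x = M := fun x hx =>
    convexHull_min (t := {x | l x = M}) (fun x hx => hx.2) (convex_hyperplane l.isLinear M) hx
  apply Set.Subset.antisymm
  -- The union on the right is convex: a proper convex combination involving a point with value
  -- below `M` stays below `M`.
  · have key : convexHull ℝ s ⊆ {x | l x < M} ∪ convexHull ℝ {x ∈ s | l x = M} := by
      apply convexHull_min
      · intro x hx
        rcases (h x hx).lt_or_eq with h1 | h1
        · exact Or.inl h1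
        · exact Or.inr (subset_convexHull ℝ _ ⟨hx, h1⟩)
      · rw [convex_iff_forall_pos]
        intro x hx y hy a b ha hb hab
        have hM : a * M + b * M = M := by rw [← add_mul, hab, one_mul]
        have hx' : l x ≤ M := hx.elim (fun h => le_of_lt h) fun h => (heq x h).le
        have hy' : l y ≤ M := hy.elim (fun h => le_of_lt h) fun h => (heq y h).le
        rcases hx with hx | hx
        · left
          simp only [Set.mem_ofPred_eq, map_add, map_smul, smul_eq_mul] at hx ⊢
          linarith [mul_lt_mul_of_pos_left hx ha, mul_le_mul_of_nonneg_left hy' hb.le]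
        rcases hy with hy | hy
        · left
          simp only [Set.mem_ofPred_eq, map_add, map_smul, smul_eq_mul] at hy ⊢
          linarith [mul_le_mul_of_nonneg_left hx' ha.le, mul_lt_mul_of_pos_left hy hb]
        · exact Or.inr (convex_convexHull ℝ _ hx hy ha.le hb.le hab)
    rintro x ⟨hx, hxM⟩
    exact (key hx).resolve_left fun h => (ne_of_lt h) hxM
  · intro x hx
    exact ⟨convexHull_mono (fun x hx => hx.1) hx, heq x hx⟩

theorem convexHull_extremePoints {s : Set E} (hs : s.Finite) :
    convexHull ℝ ((convexHull ℝ s).extremePoints ℝ) = convexHull ℝ s := by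
  have := closure_convexHull_extremePoints (s := convexHull ℝ s) (hs.isCompact_convexHull ℝ)
    (convex_convexHull ℝ s)
  have h : ((convexHull ℝ s).extremePoints ℝ).Finite := hs.subset extremePoints_convexHull_subset
  rwa [(h.isClosed_convexHull ℝ).closure_eq] at this

/-- If some `x` in `s` were not extreme, the extreme points, which span the hull, would lie in
`s.erase x`. Then `x` would be in the hull of the other points, against affine independence. -/
theorem extremePoints_convexHull_of_affineIndependent {s : Finset E}
    (hs : AffineIndependent ℝ (fun x : s => (x : E))) :
    (convexHull ℝ (s : Set E)).extremePoints ℝ = s := by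
  classical
  apply Set.Subset.antisymm extremePoints_convexHull_subset
  intro x hx
  by_contra hne
  have h1 : (convexHull ℝ (s : Set E)).extremePoints ℝ ⊆ (s.erase x : Finset E) := by
    intro y hy
    have hy' := extremePoints_convexHull_subset hy
    rw [Finset.coe_erase]
    exact ⟨hy', fun h => hne (by rwa [Set.mem_singleton_iff.1 h] at hy)⟩
  have h2 : x ∈ convexHull ℝ ((s.erase x : Finset E) : Set E) := by
    have h3 := convexHull_mono (𝕜 := ℝ) h1
    rw [convexHull_extremePoints s.finite_toSet] at h3
    exact h3 (subset_convexHull ℝ _ hx)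
  have h4 := hs.convexHull_inter (t₁ := {x}) (t₂ := s.erase x) (by simpa using hx)
    (Finset.erase_subset _ _)
  have h5 : x ∈ convexHull ℝ ((({x} ∩ s.erase x : Finset E)) : Set E) := by
    push_cast
    push_cast at h4 h2
    rw [h4]
    exact ⟨by simp, h2⟩
  simp at h5

end ConvexHull

/-! ### Realizations -/

/-- The vertices of a family of facets. -/
def verts {U : Type*} (F : Set (Finset U)) : Set U := {v | ∃ f ∈ F, v ∈ f}

/-- The points `p v` are the vertices of a simplicial polytope with the origin in its interior,
the family of whose facets is `F`: every facet has a supporting functional, and the cones over the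
facets cover the space. -/
structure IsRealization {U E : Type*} [AddCommGroup E] [Module ℝ E]
    (F : Set (Finset U)) (p : U → E) : Prop where
  finite : F.Finite
  card : ∀ f ∈ F, f.card = Module.finrank ℝ E
  indep : ∀ f ∈ F, LinearIndepOn ℝ p (f : Set U)
  support : ∀ f ∈ F, ∃ l : E →ₗ[ℝ] ℝ, (∀ v ∈ f, l (p v) = 1) ∧
    ∀ v ∈ verts F, v ∉ f → l (p v) < 1
  cover : ∀ x : E, ∃ f ∈ F, ∃ c : U → ℝ, (∀ v, 0 ≤ c v) ∧ ∑ v ∈ f, c v • p v = x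

namespace IsRealization

/-! ### Linear algebra of facets and supporting functionals -/

section Linear

variable {U E : Type*} [AddCommGroup E] [Module ℝ E] {F : Set (Finset U)} {p : U → E}

theorem finite_verts (R : IsRealization F p) : (verts F).Finite := by
  have : verts F = ⋃ f ∈ F, (f : Set U) := by
    ext v; simp [verts]
  rw [this]
  exact R.finite.biUnion fun f _ => f.finite_toSet

theorem nonempty (R : IsRealization F p) : F.Nonempty := by
  obtain ⟨f, hf, -⟩ := R.cover 0
  exact ⟨f, hf⟩

/-- This is the form in which interiority of the origin is used: `x` is a nonnegative combination of
vertices, so some vertex shares its sign. -/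
theorem exists_pos (R : IsRealization F p) {l : E →ₗ[ℝ] ℝ} {x : E} (hx : 0 < l x) :
    ∃ v ∈ verts F, 0 < l (p v) := by
  obtain ⟨f, hf, c, hc, rfl⟩ := R.cover x
  by_contra! hcon
  refine absurd hx (not_lt.2 ?_)
  rw [map_sum]
  refine Finset.sum_nonpos fun v hv => ?_
  rw [map_smul, smul_eq_mul]
  exact mul_nonpos_of_nonneg_of_nonpos (hc v) (hcon v ⟨f, hf, hv⟩)

/-- The vertices on a supporting hyperplane lie in a common facet. -/
theorem exists_facet_of_le (R : IsRealization F p) {l : E →ₗ[ℝ] ℝ}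
    (hl : ∀ v ∈ verts F, l (p v) ≤ 1) : ∃ f ∈ F, ∀ v ∈ verts F, l (p v) = 1 → v ∈ f := by
  have hfin : {v ∈ verts F | l (p v) = 1}.Finite := R.finite_verts.subset fun v hv => hv.1
  -- The facet sought is one whose cone contains the sum of the tight vertices. Evaluating `l`
  -- bounds the number of tight vertices by `∑ c`, which is the value of `lf` on the sum. Since `lf
  -- ≤ 1` at each vertex, equality holds throughout and every tight vertex lies in `f`.
  obtain ⟨f, hf, c, hc, hx⟩ := R.cover (∑ v ∈ hfin.toFinset, p v)
  obtain ⟨lf, h1, h2⟩ := R.support f hf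
  refine ⟨f, hf, ?_⟩
  have e1 : l (∑ v ∈ hfin.toFinset, p v) = hfin.toFinset.card := by
    rw [map_sum, Finset.sum_congr rfl (fun v hv => ((hfin.mem_toFinset).1 hv).2)]
    simp
  have e2 : l (∑ v ∈ f, c v • p v) ≤ ∑ v ∈ f, c v := by
    rw [map_sum]
    refine Finset.sum_le_sum fun v hv => ?_
    rw [map_smul, smul_eq_mul]
    exact mul_le_of_le_one_right (hc v) (hl v ⟨f, hf, hv⟩)
  have e3 : lf (∑ v ∈ f, c v • p v) = ∑ v ∈ f, c v := by
    rw [map_sum]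
    refine Finset.sum_congr rfl fun v hv => ?_
    rw [map_smul, smul_eq_mul, h1 v hv, mul_one]
  have e4 : lf (∑ v ∈ hfin.toFinset, p v) = ∑ v ∈ hfin.toFinset, lf (p v) := map_sum _ _ _
  have hle : ∀ v ∈ verts F, lf (p v) ≤ 1 := fun v hv => by
    by_cases h : v ∈ f
    · exact (h1 v h).le
    · exact (h2 v hv h).le
  rw [hx] at e2 e3
  intro v hv hv1
  by_contra hvf
  have : ∑ v ∈ hfin.toFinset, lf (p v) < ∑ v ∈ hfin.toFinset, 1 :=
    Finset.sum_lt_sum (fun w hw => hle w ((hfin.mem_toFinset).1 hw).1)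
      ⟨v, (hfin.mem_toFinset).2 ⟨hv, hv1⟩, h2 v hv hvf⟩
  simp only [Finset.sum_const, nsmul_eq_mul, mul_one] at this
  linarith

theorem exists_coord (R : IsRealization F p) {f : Finset U} (hf : f ∈ F) (c : U → ℝ) :
    ∃ l : E →ₗ[ℝ] ℝ, ∀ v ∈ f, l (p v) = c v := by
  have h := R.indep f hf
  let b := Module.Basis.span h
  obtain ⟨l, hl⟩ := (b.constr ℝ (fun v => c v)).exists_extend
  refine ⟨l, fun v hv => ?_⟩
  have h1 := LinearMap.congr_fun hl (b ⟨v, hv⟩)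
  rw [Module.Basis.constr_basis] at h1
  rw [← h1, LinearMap.comp_apply, Submodule.subtype_apply]
  congr 1
  exact (congrArg Subtype.val (Module.Basis.span_apply h ⟨v, hv⟩)).symm

theorem span_eq_top [FiniteDimensional ℝ E] (R : IsRealization F p) {f : Finset U} (hf : f ∈ F) :
    Submodule.span ℝ (p '' f) = ⊤ := by
  apply Submodule.eq_top_of_finrank_eq
  rw [Set.image_eq_range, finrank_span_eq_card (R.indep f hf)]
  simpa using R.card f hf

theorem functional_ext [FiniteDimensional ℝ E] (R : IsRealization F p) {f : Finset U} (hf : f ∈ F)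
    {l m : E →ₗ[ℝ] ℝ} (h : ∀ v ∈ f, l (p v) = m (p v)) : l = m := by
  apply LinearMap.ext_on (R.span_eq_top hf)
  rintro _ ⟨v, hv, rfl⟩
  exact h v hv

theorem injOn (R : IsRealization F p) : Set.InjOn p (verts F) := by
  rintro v ⟨f, hf, hv⟩ w hw hvw
  obtain ⟨l, h1, h2⟩ := R.support f hf
  have hwf : w ∈ f := by
    by_contra h
    have := h2 w hw h
    rw [← hvw, h1 v hv] at this
    exact lt_irrefl _ this
  exact (R.indep f hf).injOn hv hwf hvw

theorem eq_of_subset (R : IsRealization F p) {f g : Finset U} (hf : f ∈ F) (hg : g ∈ F)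
    (h : f ⊆ g) : f = g :=
  Finset.eq_of_subset_of_card_le h (by rw [R.card f hf, R.card g hg])

end Linear

/-! ### Faces of the convex hull of a realization -/

section Polytope

variable {U E : Type*} [NormedAddCommGroup E] [NormedSpace ℝ E] {F : Set (Finset U)} {p : U → E}

theorem affineIndependent_image [DecidableEq E] (R : IsRealization F p) {f s : Finset U} (hf : f ∈ F)
    (hs : s ⊆ f) : AffineIndependent ℝ (fun x : s.image p => (x : E)) := by
  apply LinearIndependent.affineIndependent ℝ
  have h : LinearIndepOn ℝ p (s : Set U) := (R.indep f hf).mono (by exact_mod_cast hs)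
  have := h.id_image
  rw [LinearIndepOn] at this
  rw [← Finset.coe_image] at this
  exact this

/-- A nonzero functional vanishing on all directions would be constant on the vertices, yet
`exists_pos` gives vertices on both sides of its kernel. -/
theorem vectorSpan_eq_top (R : IsRealization F p) :
    vectorSpan ℝ (convexHull ℝ (p '' verts F)) = ⊤ := by
  by_contra hne
  obtain ⟨l, hl0, hl⟩ := Submodule.exists_le_ker_of_lt_top _ (lt_top_iff_ne_top.2 hne)
  obtain ⟨x, hx⟩ : ∃ x, 0 < l x := by
    by_contra! hcon
    apply hl0
    ext x
    have h1 := hcon x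
    have h2 := hcon (-x)
    rw [map_neg] at h2
    rw [LinearMap.zero_apply]
    linarith
  obtain ⟨v, hv, hv'⟩ := R.exists_pos hx
  obtain ⟨w, hw, hw'⟩ := R.exists_pos (l := -l) (x := -x) (by simpa using hx)
  have := hl (vsub_mem_vectorSpan ℝ (subset_convexHull ℝ _ ⟨v, hv, rfl⟩)
    (subset_convexHull ℝ _ ⟨w, hw, rfl⟩))
  rw [LinearMap.mem_ker, vsub_eq_sub, map_sub] at this
  rw [LinearMap.neg_apply] at hw'
  linarith

theorem support_le (R : IsRealization F p) {f : Finset U} (hf : f ∈ F) :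
    ∃ l : E →ₗ[ℝ] ℝ, (∀ v ∈ f, l (p v) = 1) ∧ (∀ v ∈ verts F, v ∉ f → l (p v) < 1) ∧
      ∀ v ∈ verts F, l (p v) ≤ 1 := by
  obtain ⟨l, h1, h2⟩ := R.support f hf
  refine ⟨l, h1, h2, fun v hv => ?_⟩
  by_cases h : v ∈ f
  · exact (h1 v h).le
  · exact (h2 v hv h).le

theorem setOf_face_eq {l : E →ₗ[ℝ] ℝ} {M : ℝ}
    (hl : ∀ v ∈ verts F, l (p v) ≤ M) :
    {x ∈ convexHull ℝ (p '' verts F) | l x = M} =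
      convexHull ℝ (p '' {v ∈ verts F | l (p v) = M}) := by
  rw [setOf_convexHull_eq l (by rintro _ ⟨v, hv, rfl⟩; exact hl v hv)]
  congr 1
  ext x
  constructor
  · rintro ⟨⟨v, hv, rfl⟩, hx⟩
    exact ⟨v, ⟨hv, hx⟩, rfl⟩
  · rintro ⟨v, ⟨hv, hx⟩, rfl⟩
    exact ⟨⟨v, hv, rfl⟩, hx⟩

/-- The proper nonempty exposed faces are spanned by subsets of facets. -/
theorem exists_of_isExposed (R : IsRealization F p) {G : Set E}
    (hG : IsExposed ℝ (convexHull ℝ (p '' verts F)) G) (hne : G.Nonempty)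
    (hG' : G ≠ convexHull ℝ (p '' verts F)) :
    ∃ f ∈ F, ∃ s : Finset U, s ⊆ f ∧ G = convexHull ℝ (p '' s) := by
  classical
  obtain ⟨l, hl⟩ := hG hne
  obtain ⟨x, hx⟩ := hne
  obtain ⟨hxP, hxm⟩ : x ∈ {x ∈ convexHull ℝ (p '' verts F) |
    ∀ y ∈ convexHull ℝ (p '' verts F), l y ≤ l x} := hl ▸ hx
  have hv : ∀ v ∈ verts F, l (p v) ≤ l x := fun v hv =>
    hxm _ (subset_convexHull ℝ _ ⟨v, hv, rfl⟩)
  -- A nonpositive maximum over the vertices forces `l = 0` by `exists_pos`, and then the face is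
  -- the whole polytope.
  have hpos : 0 < l x := by
    by_contra! hcon
    have hl0 : l = 0 := by
      by_contra hl0
      obtain ⟨y, hy⟩ : ∃ y, 0 < l y := by
        by_contra! hc
        apply hl0
        ext y
        have h1 := hc y
        have h2 := hc (-y)
        rw [map_neg] at h2
        rw [zero_apply]
        linarith
      obtain ⟨v, hv1, hv2⟩ := R.exists_pos (l := (l : E →ₗ[ℝ] ℝ)) (x := y) hy
      have := hv v hv1
      simp only [ContinuousLinearMap.coe_coe] at hv2
      linarith
    apply hG'
    rw [hl, hl0]
    simp
  -- Dividing by the positive maximum turns `l` into a functional bounded by 1 on the vertices.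
  obtain ⟨f, hf, hft⟩ := R.exists_facet_of_le (l := (l x)⁻¹ • (l : E →ₗ[ℝ] ℝ)) (fun v h => by
    rw [LinearMap.smul_apply, smul_eq_mul, inv_mul_le_one₀ hpos]
    exact hv v h)
  refine ⟨f, hf, f.filter (fun v => l (p v) = l x), Finset.filter_subset _ _, ?_⟩
  have e1 : ((f.filter (fun v => l (p v) = l x) : Finset U) : Set U) =
      {v ∈ verts F | (l : E →ₗ[ℝ] ℝ) (p v) = l x} := by
    ext v
    simp only [Finset.coe_filter, Set.mem_ofPred_eq, ContinuousLinearMap.coe_coe]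
    constructor
    · exact fun h => ⟨⟨f, hf, h.1⟩, h.2⟩
    · refine fun h => ⟨hft v h.1 ?_, h.2⟩
      rw [LinearMap.smul_apply, smul_eq_mul, ContinuousLinearMap.coe_coe, h.2,
        inv_mul_cancel₀ hpos.ne']
  rw [e1, ← setOf_face_eq (l := (l : E →ₗ[ℝ] ℝ)) hv]
  rw [hl]
  ext y
  constructor
  · rintro ⟨hy, hy1⟩
    exact ⟨hy, le_antisymm (hxm y hy) (hy1 x hxP)⟩
  · rintro ⟨hy, hy1⟩
    refine ⟨hy, fun z hz => ?_⟩
    simp only [ContinuousLinearMap.coe_coe] at hy1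
    rw [hy1]
    exact hxm z hz

theorem finrank_vectorSpan_image (R : IsRealization F p) {f s : Finset U} (hf : f ∈ F)
    (hs : s ⊆ f) (hne : s.Nonempty) :
    Module.finrank ℝ (vectorSpan ℝ (convexHull ℝ (p '' (s : Set U)))) + 1 = s.card := by
  classical
  rw [← direction_affineSpan, affineSpan_convexHull, direction_affineSpan]
  have h := R.affineIndependent_image hf hs
  have hc : (s.image p).card = s.card := Finset.card_image_of_injOn
    (R.injOn.mono fun v hv => show v ∈ verts F from ⟨f, hf, hs hv⟩)
  have h0 : 0 < s.card := hne.card_pos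
  have := h.finrank_vectorSpan (n := s.card - 1) (by
    rw [Fintype.card_coe, hc]; omega)
  rw [Subtype.range_coe_subtype, Finset.setOfPred_mem, Finset.coe_image] at this
  omega

theorem extremePoints_image (R : IsRealization F p) {f s : Finset U} (hf : f ∈ F)
    (hs : s ⊆ f) : (convexHull ℝ (p '' (s : Set U))).extremePoints ℝ = p '' s := by
  classical
  have := extremePoints_convexHull_of_affineIndependent (R.affineIndependent_image hf hs)
  simpa using this

variable [FiniteDimensional ℝ E]

theorem isExposed_facet (R : IsRealization F p) {f : Finset U} (hf : f ∈ F)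
    (hne : f.Nonempty) :
    IsExposed ℝ (convexHull ℝ (p '' verts F)) (convexHull ℝ (p '' f)) := by
  intro _
  obtain ⟨l, h1, h2, h3⟩ := R.support_le hf
  refine ⟨LinearMap.toContinuousLinearMap l, ?_⟩
  have h4 := setOf_face_eq h3
  have h5 : {v ∈ verts F | l (p v) = 1} = f := by
    ext v
    constructor
    · rintro ⟨hv, hv1⟩
      by_contra h
      exact (h2 v hv h).ne hv1
    · exact fun hv => ⟨⟨f, hf, hv⟩, h1 v hv⟩
  have hle : ∀ x ∈ convexHull ℝ (p '' verts F), l x ≤ 1 := fun x hx =>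
    convexHull_min (t := {x | l x ≤ 1}) (by rintro _ ⟨v, hv, rfl⟩; exact h3 v hv)
      (convex_halfSpace_le l.isLinear 1) hx
  rw [h5] at h4
  rw [← h4]
  ext x
  constructor
  · rintro ⟨hx, hx1⟩
    exact ⟨hx, fun y hy => by simpa [hx1] using hle y hy⟩
  · rintro ⟨hx, hx1⟩
    refine ⟨hx, le_antisymm (hle x hx) ?_⟩
    obtain ⟨v, hv⟩ := hne
    have := hx1 (p v) (subset_convexHull ℝ _ ⟨v, ⟨f, hf, hv⟩, rfl⟩)
    simpa [h1 v hv] using this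

variable [Nontrivial E]

theorem facet_nonempty (R : IsRealization F p) {f : Finset U} (hf : f ∈ F) : f.Nonempty := by
  rw [← Finset.card_pos, R.card f hf]
  exact Module.finrank_pos

/-- A proper face is spanned by a subset of some facet in `F`, and codimension one leaves no room
for a proper subset. -/
theorem isPolytopeFacet_iff (R : IsRealization F p) (G : Set E) :
    IsPolytopeFacet (convexHull ℝ (p '' verts F)) G ↔ ∃ f ∈ F, G = convexHull ℝ (p '' f) := by
  have htop : Module.finrank ℝ (vectorSpan ℝ (convexHull ℝ (p '' verts F))) =
      Module.finrank ℝ E := by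
    rw [R.vectorSpan_eq_top, finrank_top]
  constructor
  · rintro ⟨hexp, hne, hdim⟩
    have hG : G ≠ convexHull ℝ (p '' verts F) := by
      rintro rfl
      omega
    obtain ⟨f, hf, s, hs, rfl⟩ := R.exists_of_isExposed hexp hne hG
    have hsne : s.Nonempty := by
      rw [Finset.nonempty_iff_ne_empty]
      rintro rfl
      simp at hne
    have h1 := R.finrank_vectorSpan_image hf hs hsne
    rw [htop, h1] at hdim
    have : s = f := Finset.eq_of_subset_of_card_le hs (by rw [R.card f hf, hdim])
    exact ⟨f, hf, by rw [this]⟩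
  · rintro ⟨f, hf, rfl⟩
    refine ⟨R.isExposed_facet hf (R.facet_nonempty hf), ?_, ?_⟩
    · rw [convexHull_nonempty_iff]
      exact (Finset.coe_nonempty.2 (R.facet_nonempty hf)).image p
    · rw [R.finrank_vectorSpan_image hf subset_rfl (R.facet_nonempty hf), htop, R.card f hf]

theorem extremePoints_eq (R : IsRealization F p) :
    (convexHull ℝ (p '' verts F)).extremePoints ℝ = p '' verts F := by
  apply Set.Subset.antisymm extremePoints_convexHull_subset
  rintro _ ⟨v, ⟨f, hf, hv⟩, rfl⟩
  apply (R.isExposed_facet hf (R.facet_nonempty hf)).isExtreme.extremePoints_subset_extremePoints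
  rw [R.extremePoints_image hf subset_rfl]
  exact ⟨v, hv, rfl⟩

theorem isSimplicialPolytope (R : IsRealization F p) :
    IsSimplicialPolytope (Module.finrank ℝ E) (convexHull ℝ (p '' verts F)) := by
  classical
  refine ⟨?_, ⟨(R.finite_verts.image p).toFinset, by simp⟩, ?_, ?_⟩
  · obtain ⟨f, hf⟩ := R.nonempty
    obtain ⟨v, hv⟩ := R.facet_nonempty hf
    exact ⟨p v, subset_convexHull ℝ _ ⟨v, ⟨f, hf, hv⟩, rfl⟩⟩
  · rw [R.vectorSpan_eq_top, finrank_top]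
  · intro G hG hne
    rcases G.eq_empty_or_nonempty with rfl | hGne
    · refine ⟨∅, ?_, by simp⟩
      have : Subsingleton (((∅ : Finset E)) : Type _) := ⟨fun a => absurd a.2 (Finset.notMem_empty _)⟩
      exact affineIndependent_of_subsingleton ℝ _
    obtain ⟨f, hf, s, hs, rfl⟩ := R.exists_of_isExposed hG hGne hne
    exact ⟨s.image p, R.affineIndependent_image hf hs, by simp⟩

theorem vertexSet_eq (R : IsRealization F p) :
    (polytopeFacetHypergraph (convexHull ℝ (p '' verts F))).vertexSet = p '' verts F :=
  R.extremePoints_eq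

theorem edgeSet_eq (R : IsRealization F p) :
    (polytopeFacetHypergraph (convexHull ℝ (p '' verts F))).edgeSet =
      {e | ∃ f ∈ F, e = p '' f} := by
  ext e
  constructor
  · rintro ⟨G, hG, rfl⟩
    obtain ⟨f, hf, rfl⟩ := (R.isPolytopeFacet_iff G).1 hG
    exact ⟨f, hf, R.extremePoints_image hf subset_rfl⟩
  · rintro ⟨f, hf, rfl⟩
    exact ⟨_, (R.isPolytopeFacet_iff _).2 ⟨f, hf, rfl⟩, (R.extremePoints_image hf subset_rfl).symm⟩

theorem isomorphic (K : PreAbstractSimplicialComplex U)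
    (hK : ∀ s, s ∈ K.faces ↔ s.Nonempty ∧ ∃ f ∈ F, s ⊆ f) (R : IsRealization F p) :
    Isomorphic K (boundaryComplex (convexHull ℝ (p '' verts F))) := by
  classical
  have hv : vertices K = verts F := by
    ext v
    simp [vertices, hK, verts]
  refine ⟨p, hv ▸ R.injOn, ?_⟩
  apply PreAbstractSimplicialComplex.ext
  ext s
  simp only [PreAbstractSimplicialComplex.map, boundaryComplex, complexOf, R.edgeSet_eq,
    Set.mem_image, Set.mem_ofPred_eq, hK]
  constructor
  · rintro ⟨t, ⟨ht, f, hf, htf⟩, h⟩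
    have hs : s = t.image p := by rw [← h]
    subst hs
    refine ⟨ht.image p, _, ⟨f, hf, rfl⟩, ?_⟩
    rw [Finset.coe_image]
    exact Set.image_mono (by exact_mod_cast htf)
  · rintro ⟨hs, _, ⟨f, hf, rfl⟩, hsf⟩
    rw [← Finset.coe_image, Finset.coe_subset, Finset.subset_image_iff] at hsf
    obtain ⟨t, ht, rfl⟩ := hsf
    refine ⟨t, ⟨Finset.image_nonempty.1 hs, f, hf, ht⟩, ?_⟩
    congr

theorem transversalNumber_eq (R : IsRealization F p) {H : Hypergraph U} (hV : H.vertexSet = verts F)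
    (hE : H.edgeSet = {e | ∃ f ∈ F, e = (f : Set U)}) :
    transversalNumber (polytopeFacetHypergraph (convexHull ℝ (p '' verts F))) =
      transversalNumber H := by
  classical
  unfold transversalNumber
  congr 1
  ext n
  simp only [IsTransversal, R.vertexSet_eq, R.edgeSet_eq, hV, hE, Set.mem_ofPred_eq]
  constructor
  · rintro ⟨T, ⟨hT1, hT2⟩, rfl⟩
    rw [Finset.subset_set_image_iff] at hT1
    obtain ⟨T, hT, rfl⟩ := hT1
    refine ⟨T, ⟨hT, ?_⟩, (Finset.card_image_of_injOn (R.injOn.mono hT)).symm⟩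
    rintro _ ⟨f, hf, rfl⟩
    obtain ⟨x, hx, w, hw, hwx⟩ := hT2 _ ⟨f, hf, rfl⟩
    obtain ⟨v, hv, rfl⟩ := Finset.mem_image.1 hx
    rw [R.injOn ⟨f, hf, hw⟩ (hT hv) hwx] at hw
    exact ⟨v, hv, hw⟩
  · rintro ⟨T, ⟨hT1, hT2⟩, rfl⟩
    refine ⟨T.image p, ⟨?_, ?_⟩, Finset.card_image_of_injOn (R.injOn.mono hT1)⟩
    · rw [Finset.coe_image]
      exact Set.image_mono hT1
    · rintro _ ⟨f, hf, rfl⟩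
      obtain ⟨v, hv, hvf⟩ := hT2 _ ⟨f, hf, rfl⟩
      exact ⟨p v, Finset.mem_image_of_mem p hv, v, hvf, rfl⟩

end Polytope

end IsRealization

/-! ### Refining the cone over a facet -/

namespace IsRealization

open Filter Topology

variable {U O E : Type*} [AddCommGroup E] [Module ℝ E] {F : Set (Finset U)} {p : U → E}

theorem linearIndepOn_smul {ι : Type*} {s : Finset ι} {q : ι → E} (h : LinearIndepOn ℝ q (s : Set ι))
    {a : ι → ℝ} (ha : ∀ i, a i ≠ 0) : LinearIndepOn ℝ (fun i => a i • q i) (s : Set ι) := by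
  rw [linearIndepOn_finset_iff] at h ⊢
  intro c hc i hi
  simp only [smul_smul] at hc
  exact (mul_eq_zero.1 (h _ hc i hi)).resolve_right (ha i)

/-- Replacing a facet `f` by a regular subdivision `G` of it, whose new vertices lie in the interior
of `f` and are lifted slightly. -/
theorem refine [Finite O] (R : IsRealization F p) {f : Finset U} (hf : f ∈ F)
    {G : Set (Finset (U ⊕ O))} (r : O → E) (h : O → ℝ) (hGfin : G.Finite)
    (hcard : ∀ g ∈ G, g.card = Module.finrank ℝ E)
    (hsub : ∀ g ∈ G, ∀ v, Sum.inl v ∈ g → v ∈ f)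
    (hr : ∀ o, ∃ c : U → ℝ, (∀ v ∈ f, 0 < c v) ∧ ∑ v ∈ f, c v • p v = r o)
    (hne : f.Nonempty)
    (hind : ∀ g ∈ G, LinearIndepOn ℝ (Sum.elim p r) (g : Set (U ⊕ O)))
    (hm : ∀ g ∈ G, ∃ m : E →ₗ[ℝ] ℝ, (∀ v, Sum.inl v ∈ g → m (p v) = 0) ∧
      (∀ v ∈ f, Sum.inl v ∉ g → 0 < m (p v)) ∧ (∀ o, Sum.inr o ∈ g → m (r o) = h o) ∧
      ∀ o, Sum.inr o ∉ g → h o < m (r o))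
    (hcov : ∀ c : U → ℝ, (∀ v, 0 ≤ c v) → ∃ g ∈ G, ∃ c' : U ⊕ O → ℝ, (∀ x, 0 ≤ c' x) ∧
      ∑ x ∈ g, c' x • Sum.elim p r x = ∑ v ∈ f, c v • p v) :
    ∃ p' : U ⊕ O → E,
      IsRealization ({g | ∃ f' ∈ F, f' ≠ f ∧ g = f'.disjSum ∅} ∪ G) p' := by
  choose! lin hlin1 hlin2 using R.support
  choose! m hm1 hm2 hm3 hm4 using hm
  choose c hc hcr using hr
  -- `s o` is the height of the new ray at which it meets the hyperplane of `f`: the point `r o / s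
  -- o` lies on that hyperplane.
  set s : O → ℝ := fun o => lin f (r o) with hs
  have hsc : ∀ o, s o = ∑ v ∈ f, c o v := fun o => by
    simp only [hs]
    rw [← hcr o, map_sum]
    refine Finset.sum_congr rfl fun v hv => ?_
    rw [map_smul, hlin1 f hf v hv, smul_eq_mul, mul_one]
  have hspos : ∀ o, 0 < s o := fun o => by
    rw [hsc]
    exact Finset.sum_pos (hc o) hne
  -- Each `r o` is interior to the cone of `f`, so it involves a vertex outside `f'` with positive
  -- weight, where the functional of `f'` is strictly below 1.
  have hlt : ∀ f' ∈ F, f' ≠ f → ∀ o, lin f' (r o) < s o := by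
    intro f' hf' hff o
    rw [hsc, ← hcr o, map_sum]
    have hle : ∀ v ∈ f, lin f' (c o v • p v) ≤ c o v := fun v hv => by
      rw [map_smul, smul_eq_mul]
      refine mul_le_of_le_one_right (hc o v hv).le ?_
      by_cases h : v ∈ f'
      · exact (hlin1 f' hf' v h).le
      · exact (hlin2 f' hf' v ⟨f, hf, hv⟩ h).le
    obtain ⟨v, hv, hvf⟩ : ∃ v ∈ f, v ∉ f' := by
      by_contra! hcon
      exact hff (R.eq_of_subset hf hf' hcon).symm
    refine Finset.sum_lt_sum hle ⟨v, hv, ?_⟩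
    rw [map_smul, smul_eq_mul]
    exact mul_lt_of_lt_one_right (hc o v hv) (hlin2 f' hf' v ⟨f, hf, hv⟩ hvf)
  have ev : ∀ a b x : ℝ, a < b → ∀ᶠ t in 𝓝[>] (0 : ℝ), a < b - t * x := by
    intro a b x hab
    have : Tendsto (fun t : ℝ => b - t * x) (𝓝[>] 0) (𝓝 (b - 0 * x)) :=
      (Continuous.tendsto (by fun_prop) 0).mono_left nhdsWithin_le_nhds
    exact this.eventually (lt_mem_nhds (by simpa using hab))
  have ev1 : ∀ᶠ t in 𝓝[>] (0 : ℝ), ∀ o, 0 < s o - t * h o :=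
    eventually_all.2 fun o => ev _ _ _ (hspos o)
  have ev2 : ∀ᶠ t in 𝓝[>] (0 : ℝ), ∀ f' ∈ F, f' ≠ f → ∀ o, lin f' (r o) < s o - t * h o := by
    rw [eventually_all_finite R.finite]
    intro f' hf'
    by_cases hff : f' = f
    · exact Eventually.of_forall fun t h => absurd hff h
    · have := eventually_all.2 fun o => ev _ _ (h o) (hlt f' hf' hff o)
      filter_upwards [this] with t ht _ using ht
  have ev3 : ∀ᶠ t in 𝓝[>] (0 : ℝ), ∀ g ∈ G, ∀ v ∈ verts F, v ∉ f →
      lin f (p v) - t * m g (p v) < 1 := by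
    rw [eventually_all_finite hGfin]
    intro g _
    rw [eventually_all_finite R.finite_verts]
    intro v hv
    by_cases hvf : v ∈ f
    · exact Eventually.of_forall fun t h => absurd hvf h
    · filter_upwards [ev _ _ (-m g (p v)) (hlin2 f hf v hv hvf)] with t ht _
      linarith
  -- All constraints on the lifting parameter are finitely many strict inequalities that hold at `t
  -- = 0`.
  obtain ⟨t, ht1, ht2, ht3, ht0⟩ :=
    (ev1.and (ev2.and (ev3.and self_mem_nhdsWithin))).exists
  replace ht0 : 0 < t := ht0
  -- The scaling is chosen so that `lin f - t • m g` takes the value `(s o - t * m g (r o)) / (s o -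
  -- t * h o)` at a new vertex. This is 1 when `m g (r o) = h o` and below 1 when `m g (r o)` is
  -- larger.
  let a : U ⊕ O → ℝ := Sum.elim (fun _ => 1) (fun o => (s o - t * h o)⁻¹)
  have ha : ∀ x, 0 < a x := by
    rintro (v | o)
    · exact one_pos
    · exact inv_pos.2 (ht1 o)
  have hpl : ∀ v, a (Sum.inl v) • Sum.elim p r (Sum.inl v) = p v := fun v => one_smul _ _
  have hlr : ∀ (l : E →ₗ[ℝ] ℝ) o, l (a (Sum.inr o) • Sum.elim p r (Sum.inr o)) =
      l (r o) / (s o - t * h o) := fun l o => by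
    rw [map_smul, smul_eq_mul, div_eq_inv_mul]
    rfl
  have hverts : ∀ v, Sum.inl v ∈ verts ({g | ∃ f' ∈ F, f' ≠ f ∧ g = f'.disjSum ∅} ∪ G) →
      v ∈ verts F := by
    rintro v ⟨g, ⟨f', hf', -, rfl⟩ | hg, hv⟩
    · exact ⟨f', hf', by simpa using hv⟩
    · exact ⟨f, hf, hsub g hg v hv⟩
  refine ⟨fun x => a x • Sum.elim p r x, ?_, ?_, ?_, ?_, ?_⟩
  · refine Set.Finite.union ?_ hGfin
    refine (R.finite.image fun f' : Finset U => f'.disjSum (∅ : Finset O)).subset ?_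
    rintro _ ⟨f', hf', -, rfl⟩
    exact ⟨f', hf', rfl⟩
  · rintro _ (⟨f', hf', -, rfl⟩ | hg)
    · rw [Finset.card_disjSum, R.card f' hf']; rfl
    · exact hcard _ hg
  · rintro _ (⟨f', hf', -, rfl⟩ | hg)
    · have h1 := R.indep f' hf'
      rw [linearIndepOn_finset_iff] at h1 ⊢
      intro c hc x hx
      rw [Finset.sum_disjSum] at hc
      simp only [hpl, Finset.sum_empty, add_zero] at hc
      obtain ⟨v, hv, rfl⟩ : ∃ v ∈ f', Sum.inl v = x := by simpa using hx
      exact h1 _ hc v hv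
    · exact linearIndepOn_smul (hind _ hg) fun x => (ha x).ne'
  · rintro _ (⟨f', hf', hff, rfl⟩ | hg)
    · refine ⟨lin f', ?_, ?_⟩
      · rintro (v | o) hv
        · rw [hpl]
          exact hlin1 f' hf' v (by simpa using hv)
        · simp at hv
      · rintro (v | o) hv hvf
        · rw [hpl]
          exact hlin2 f' hf' v (hverts v hv) (by simpa using hvf)
        · rw [hlr, div_lt_one (ht1 o)]
          exact ht2 f' hf' hff o
    · rename_i g
      refine ⟨lin f - t • m g, ?_, ?_⟩
      · rintro (v | o) hv
        · rw [hpl, LinearMap.sub_apply, LinearMap.smul_apply, hm1 g hg v hv,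
            hlin1 f hf v (hsub g hg v hv), smul_zero, sub_zero]
        · rw [hlr, LinearMap.sub_apply, LinearMap.smul_apply, hm3 g hg o hv, smul_eq_mul]
          exact div_self (ht1 o).ne'
      · rintro (v | o) hv hvg
        · rw [hpl, LinearMap.sub_apply, LinearMap.smul_apply, smul_eq_mul]
          by_cases hvf : v ∈ f
          · rw [hlin1 f hf v hvf]
            have := mul_pos ht0 (hm2 g hg v hvf hvg)
            linarith
          · exact ht3 g hg v (hverts v hv) hvf
        · rw [hlr, div_lt_one (ht1 o), LinearMap.sub_apply, LinearMap.smul_apply, smul_eq_mul]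
          have := mul_lt_mul_of_pos_left (hm4 g hg o hvg) ht0
          linarith
  · intro x
    obtain ⟨f', hf', d, hd, rfl⟩ := R.cover x
    by_cases hff : f' = f
    -- Positive rescaling of the vertices leaves the cones unchanged; only the coefficients are
    -- divided by `a`.
    · obtain ⟨g, hg, c', hc', hcc⟩ := hcov d hd
      refine ⟨g, Or.inr hg, fun x => c' x / a x, fun x => div_nonneg (hc' x) (ha x).le, ?_⟩
      rw [hff, ← hcc]
      refine Finset.sum_congr rfl fun x _ => ?_
      rw [smul_smul, div_mul_cancel₀ _ (ha x).ne']
    · refine ⟨f'.disjSum ∅, Or.inl ⟨f', hf', hff, rfl⟩, Sum.elim d 0, ?_, ?_⟩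
      · rintro (v | o)
        · exact hd v
        · exact le_rfl
      · rw [Finset.sum_disjSum, Finset.sum_empty, add_zero]
        exact Finset.sum_congr rfl fun v _ => congrArg (d v • ·) (hpl v)

/-- Realizations are transported along bijections of the vertex sets. -/
theorem map_equiv {U' : Type*} (R : IsRealization F p) (e : U ≃ U') :
    IsRealization ((Finset.map e.toEmbedding) '' F) (p ∘ e.symm) := by
  have hvs : ∀ v, v ∈ verts ((Finset.map e.toEmbedding) '' F) → e.symm v ∈ verts F := by
    rintro v ⟨_, ⟨f, hf, rfl⟩, hv⟩
    obtain ⟨w, hw, rfl⟩ := Finset.mem_map.1 hv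
    exact ⟨f, hf, by simpa using hw⟩
  refine ⟨R.finite.image _, ?_, ?_, ?_, ?_⟩
  · rintro _ ⟨f, hf, rfl⟩
    rw [Finset.card_map, R.card f hf]
  · rintro _ ⟨f, hf, rfl⟩
    have h1 := R.indep f hf
    rw [linearIndepOn_finset_iff] at h1 ⊢
    intro c hc x hx
    rw [Finset.sum_map] at hc
    obtain ⟨w, hw, rfl⟩ := Finset.mem_map.1 hx
    exact h1 (fun v => c (e v)) (by simpa using hc) w hw
  · rintro _ ⟨f, hf, rfl⟩
    obtain ⟨l, h1, h2⟩ := R.support f hf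
    refine ⟨l, ?_, ?_⟩
    · intro v hv
      obtain ⟨w, hw, rfl⟩ := Finset.mem_map.1 hv
      simpa using h1 w hw
    · intro v hv hvf
      refine h2 _ (hvs v hv) fun h => hvf ?_
      exact Finset.mem_map.2 ⟨_, h, by simp⟩
  · intro x
    obtain ⟨f, hf, c, hc, rfl⟩ := R.cover x
    exact ⟨_, ⟨f, hf, rfl⟩, c ∘ e.symm, fun v => hc _, by simp [Finset.sum_map]⟩

end IsRealization

/-! ### Gluing a cross-polytope with an apex onto a facet -/

section Glued

/-- The equation for `B` locates a point in the subdivided cone: `B` will be the total weight of the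
antipodes. It is solved by the intermediate value theorem between half of the minimum of `x`, where
the sum vanishes, and `∑ i, x i`. The last clause makes the index set `A` of a mixed facet nonempty.
-/
theorem exists_sum_max_eq {ι : Type*} [Fintype ι] [Nonempty ι] (hι : 2 ≤ Fintype.card ι) (x : ι → ℝ) (hx : ∀ i, 0 ≤ x i) :
    ∃ B : ℝ, 0 ≤ B ∧ ∑ i, max (2 * B - x i) 0 = B ∧ ∃ i, x i ≤ 2 * B := by
  obtain ⟨i₀, hi₀⟩ := Finite.exists_min x
  have hsum : x i₀ ≤ ∑ i, x i := Finset.single_le_sum (fun i _ => hx i) (Finset.mem_univ i₀)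
  have hsum0 : 0 ≤ ∑ i, x i := Finset.sum_nonneg fun i _ => hx i
  have hle : x i₀ / 2 ≤ ∑ i, x i := by linarith [hx i₀]
  have hcont : ContinuousOn (fun B : ℝ => ∑ i, max (2 * B - x i) 0 - B)
      (Set.Icc (x i₀ / 2) (∑ i, x i)) := by fun_prop
  have h0 : (0 : ℝ) ∈ Set.Icc (∑ i, max (2 * (x i₀ / 2) - x i) 0 - x i₀ / 2)
      (∑ i, max (2 * (∑ i, x i) - x i) 0 - ∑ i, x i) := by
    constructor
    · rw [Finset.sum_eq_zero fun i _ => max_eq_right (by linarith [hi₀ i])]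
      linarith [hx i₀]
    · have h1 : ∑ i, (2 * (∑ i, x i) - x i) ≤ ∑ i, max (2 * (∑ i, x i) - x i) 0 :=
        Finset.sum_le_sum fun i _ => le_max_left _ _
      rw [Finset.sum_sub_distrib, Finset.sum_const, nsmul_eq_mul, Finset.card_univ] at h1
      have h2 : (2 : ℝ) ≤ Fintype.card ι := by exact_mod_cast hι
      nlinarith
  obtain ⟨B, ⟨hB1, hB2⟩, hB⟩ := intermediate_value_Icc hle hcont h0
  refine ⟨B, by linarith [hx i₀], by linarith, i₀, by linarith⟩

variable {U ι : Type*} [Fintype ι] [DecidableEq ι]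

/-- The facet of a cross-polytope glued onto the facet `b` that contains the vertices antipodal to
`b i` for `i ∈ A`, and `b i` for the other `i`. -/
def mixedFacet (b : ι ↪ U) (A : Finset ι) : Finset (U ⊕ Option ι) :=
  (Aᶜ.map b).disjSum (A.map Function.Embedding.some)

/-- The facet spanned by the apex and all but one of the vertices opposite to the base facet. -/
def apexFacet (U : Type*) {ι : Type*} [Fintype ι] [DecidableEq ι] (j : ι) :
    Finset (U ⊕ Option ι) :=
  (∅ : Finset U).disjSum (Finset.insertNone (Finset.univ.erase j))

/-- The facets obtained by gluing a cross-polytope with an apex onto the facet `b`. -/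
def gluedFacets (F : Set (Finset U)) (b : ι ↪ U) : Set (Finset (U ⊕ Option ι)) :=
  {g | ∃ f ∈ F, f ≠ Finset.univ.map b ∧ g = f.disjSum ∅} ∪
    ({g | ∃ A : Finset ι, A.Nonempty ∧ A ≠ Finset.univ ∧ g = mixedFacet b A} ∪
      {g | ∃ j : ι, g = apexFacet U j})

variable {E : Type*} [AddCommGroup E] [Module ℝ E] {F : Set (Finset U)} {p : U → E}

/-- The cone over `b` is subdivided by rays interior to it, and the subdivision is regular because
explicit functionals, one for each new facet, agree with the heights `h` on that facet and exceed
them at the other new rays. -/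
theorem IsRealization.glued [FiniteDimensional ℝ E] (R : IsRealization F p) (b : ι ↪ U)
    (hf : Finset.univ.map b ∈ F) (hι : 2 ≤ Fintype.card ι) :
    ∃ p' : U ⊕ Option ι → E, IsRealization (gluedFacets F b) p' := by
  have : Nonempty ι := Fintype.card_pos_iff.1 (by omega)
  set N : ℝ := (Fintype.card ι : ℝ) with hN
  have hN2 : (2 : ℝ) ≤ N := by rw [hN]; exact_mod_cast hι
  have hcardE : Fintype.card ι = Module.finrank ℝ E := by
    rw [← R.card _ hf, Finset.card_map, Finset.card_univ]
  have hli : LinearIndependent ℝ (p ∘ b) := by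
    have := R.indep _ hf
    rw [Finset.coe_map, Finset.coe_univ, Set.image_univ,
      linearIndepOn_range_iff b.injective] at this
    exact this
  let Bs : Module.Basis ι ℝ E := basisOfLinearIndependentOfCardEqFinrank hli hcardE
  have hBs : ∀ i, p (b i) = Bs i := fun i => by
    simp [Bs]
  have hB : ∀ i j, Bs.coord i (p (b j)) = if i = j then 1 else 0 := fun i j => by
    rw [hBs, Module.Basis.coord_apply, Module.Basis.repr_self, Finsupp.single_apply]
    simp [eq_comm]
  set w : E := ∑ i, p (b i) with hw
  have hBw : ∀ i, Bs.coord i w = 1 := fun i => by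
    rw [hw, map_sum]
    simp [hB]
  -- The apex lies on the barycentric ray. The antipode of `b k` is that vertex reflected through
  -- `w`, which has coordinate 1 at `k` and 2 elsewhere.
  let r : Option ι → E := fun o => o.elim w fun k => (2 : ℝ) • w - p (b k)
  have hBu : ∀ i k, Bs.coord i (r (some k)) = 2 - if i = k then 1 else 0 := fun i k => by
    change Bs.coord i ((2 : ℝ) • w - p (b k)) = _
    rw [map_sub, map_smul, hBw, hB]
    simp
  have hBw' : ∀ i, Bs.coord i (r none) = 1 := hBw
  have hext : ∀ x y : E, (∀ i, Bs.coord i x = Bs.coord i y) → x = y := fun x y h =>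
    Bs.ext_elem h
  -- The functional with value 1 on all antipodes has value `N / (2N - 1)` at `w`. The apex height
  -- is slightly larger, so the apex is lifted beyond the simplex of antipodes, but it stays below
  -- the values `|A| / (2|A| - 1)` with `|A| < N`, so it does not pass the mixed facets.
  let h : Option ι → ℝ := fun o => o.elim ((N + 1 / (2 * N)) / (2 * N - 1)) fun _ => 1
  refine R.refine hf (G := _ ∪ _) r h ?_ ?_ ?_ ?_ (Finset.univ_nonempty.map) ?_ ?_ ?_
  · refine Set.Finite.union ?_ ?_
    · exact (Set.toFinite (Set.range (mixedFacet b))).subset fun g ⟨A, _, _, hg⟩ => ⟨A, hg.symm⟩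
    · exact (Set.toFinite (Set.range (apexFacet U (ι := ι)))).subset fun g ⟨j, hg⟩ => ⟨j, hg.symm⟩
  · rintro _ (⟨A, hA1, hA2, rfl⟩ | ⟨j, rfl⟩)
    · rw [mixedFacet, Finset.card_disjSum, Finset.card_map, Finset.card_map,
        Finset.card_compl_add_card, hcardE]
    · rw [apexFacet, Finset.card_disjSum, Finset.card_insertNone, Finset.card_empty,
        Finset.card_erase_of_mem (Finset.mem_univ j), Finset.card_univ, ← hcardE]
      omega
  · rintro _ (⟨A, hA1, hA2, rfl⟩ | ⟨j, rfl⟩) v hv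
    · rw [mixedFacet, Finset.inl_mem_disjSum, Finset.mem_map] at hv
      obtain ⟨i, -, rfl⟩ := hv
      simp
    · simp [apexFacet] at hv
  · rintro (_ | k)
    · exact ⟨fun _ => 1, fun _ _ => one_pos, by simp [r, hw]⟩
    · classical
      refine ⟨fun v => if v = b k then 1 else 2, fun v _ => by positivity, ?_⟩
      apply hext
      intro i
      rw [hBu, Finset.sum_map, map_sum]
      simp only [EmbeddingLike.apply_eq_iff_eq, map_smul, hB, smul_eq_mul, mul_ite, mul_one,
        mul_zero, Finset.sum_ite_eq, Finset.mem_univ, if_true]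
      split_ifs <;> norm_num
  · rintro _ (⟨A, hA1, hA2, rfl⟩ | ⟨j, rfl⟩)
    · rw [linearIndepOn_finset_iff]
      intro c hc
      rw [mixedFacet, Finset.sum_disjSum, Finset.sum_map, Finset.sum_map] at hc
      set S : ℝ := ∑ k ∈ A, c (Sum.inr (some k)) with hS
      have key : ∀ i, (if i ∈ A then 0 else c (Sum.inl (b i))) +
          (2 * S - if i ∈ A then c (Sum.inr (some i)) else 0) = 0 := by
        intro i
        have h1 := congrArg (Bs.coord i) hc
        simp only [map_add, map_sum, map_smul, Sum.elim_inl, Sum.elim_inr, hB, smul_eq_mul,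
          Function.Embedding.some_apply, hBu, mul_sub, mul_ite, mul_one, mul_zero, map_zero,
          Finset.sum_sub_distrib, Finset.sum_ite_eq, Finset.mem_compl, ← Finset.sum_mul] at h1
        rw [← hS] at h1
        split_ifs at h1 ⊢ <;> linarith
      have hA : ∀ i ∈ A, c (Sum.inr (some i)) = 2 * S := fun i hi => by
        have := key i
        rw [if_pos hi, if_pos hi] at this
        linarith
      -- Summing the equal coefficients `2 * S` over `A` returns `S`, that is `S * (2|A| - 1) = 0`.
      have hS0 : S = 0 := by
        have h1 : S = A.card * (2 * S) := by
          conv_lhs => rw [hS]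
          rw [Finset.sum_congr rfl hA, Finset.sum_const, nsmul_eq_mul]
        have h2 : (1 : ℝ) ≤ A.card := by exact_mod_cast hA1.card_pos
        have h3 : S * (2 * A.card - 1) = 0 := by linarith
        exact (mul_eq_zero.1 h3).resolve_right (by linarith)
      rintro (v | o) hv
      · rw [mixedFacet, Finset.inl_mem_disjSum, Finset.mem_map] at hv
        obtain ⟨i, hi, rfl⟩ := hv
        have := key i
        rw [if_neg (Finset.mem_compl.1 hi), if_neg (Finset.mem_compl.1 hi)] at this
        linarith
      · rw [mixedFacet, Finset.inr_mem_disjSum, Finset.mem_map] at hv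
        obtain ⟨i, hi, rfl⟩ := hv
        change c (Sum.inr (some i)) = 0
        rw [hA i hi, hS0, mul_zero]
    · rw [linearIndepOn_finset_iff]
      intro c hc
      rw [apexFacet, Finset.sum_disjSum, Finset.sum_empty, zero_add, Finset.sum_insertNone] at hc
      set S : ℝ := ∑ k ∈ Finset.univ.erase j, c (Sum.inr (some k)) with hS
      have key : ∀ i, c (Sum.inr none) + (2 * S - if i ≠ j then c (Sum.inr (some i)) else 0) = 0 := by
        intro i
        have h1 := congrArg (Bs.coord i) hc
        simp only [map_add, map_sum, map_smul, Sum.elim_inr, smul_eq_mul,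
          hBu, hBw', mul_sub, mul_ite, mul_one, mul_zero, map_zero,
          Finset.sum_sub_distrib, Finset.sum_ite_eq, Finset.mem_erase, Finset.mem_univ, and_true,
          ← Finset.sum_mul] at h1
        rw [← hS] at h1
        linarith
      -- The coordinate `j` of the missing antipode gives the coefficient of the apex plus `2 * S`
      -- equal to zero; comparison with the other coordinates kills the antipodes.
      have hj := key j
      simp only [ne_eq, not_true_eq_false, if_false, sub_zero] at hj
      have hz : ∀ i ∈ Finset.univ.erase j, c (Sum.inr (some i)) = 0 := fun i hi => by
        have := key i
        rw [if_pos (Finset.ne_of_mem_erase hi)] at this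
        linarith
      have hS0 : S = 0 := Finset.sum_eq_zero hz
      rintro (v | _ | i) hv
      · simp [apexFacet] at hv
      · linarith
      · rw [apexFacet, Finset.inr_mem_disjSum, Finset.some_mem_insertNone] at hv
        exact hz i hv
  · rintro _ (⟨A, hA1, hA2, rfl⟩ | ⟨j, rfl⟩)
    · have hc1 : (1 : ℝ) ≤ A.card := by exact_mod_cast hA1.card_pos
      have hc2 : (A.card : ℝ) + 1 ≤ N := by
        have := (Finset.card_lt_iff_ne_univ A).2 hA2
        rw [hN]
        exact_mod_cast this
      have hpos : (0 : ℝ) < 2 * A.card - 1 := by linarith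
      have hmB : ∀ i, (∑ k ∈ A, Bs.coord k) (p (b i)) = if i ∈ A then 1 else 0 := fun i => by
        simp [LinearMap.sum_apply, hB]
      have hmu : ∀ i, (∑ k ∈ A, Bs.coord k) (r (some i)) =
          2 * A.card - if i ∈ A then 1 else 0 := fun i => by
        rw [LinearMap.sum_apply]
        simp only [hBu, Finset.sum_sub_distrib, Finset.sum_const, nsmul_eq_mul, Finset.sum_ite_eq']
        ring
      have hmw : (∑ k ∈ A, Bs.coord k) (r none) = A.card := by
        rw [LinearMap.sum_apply]
        simp [hBw']
      -- On an antipode the sum of the coordinates over `A` is `2|A| - 1` for an index in `A` and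
      -- `2|A|` otherwise, whence the normalisation.
      refine ⟨(2 * (A.card : ℝ) - 1)⁻¹ • ∑ k ∈ A, Bs.coord k, ?_, ?_, ?_, ?_⟩
      · intro v hv
        rw [mixedFacet, Finset.inl_mem_disjSum, Finset.mem_map] at hv
        obtain ⟨i, hi, rfl⟩ := hv
        rw [LinearMap.smul_apply, hmB, if_neg (Finset.mem_compl.1 hi), smul_zero]
      · intro v hv hvg
        obtain ⟨i, -, rfl⟩ := Finset.mem_map.1 hv
        have hi : i ∈ A := by
          by_contra h
          exact hvg (by simpa [mixedFacet] using h)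
        rw [LinearMap.smul_apply, hmB, if_pos hi, smul_eq_mul, mul_one]
        exact inv_pos.2 hpos
      · rintro (_ | i) hv
        · simp [mixedFacet] at hv
        · have hi : i ∈ A := by simpa [mixedFacet] using hv
          rw [LinearMap.smul_apply, hmu, if_pos hi, smul_eq_mul]
          exact inv_mul_cancel₀ hpos.ne'
      · rintro (_ | i) hv
        · rw [LinearMap.smul_apply, hmw, smul_eq_mul, inv_mul_eq_div]
          change (N + 1 / (2 * N)) / (2 * N - 1) < _
          rw [div_lt_div_iff₀ (by linarith) hpos]
          have h1 : 1 / (2 * N) * (2 * A.card - 1) < 1 := by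
            rw [one_div, inv_mul_lt_one₀ (by linarith)]
            linarith
          nlinarith
        · have hi : i ∉ A := by simpa [mixedFacet] using hv
          rw [LinearMap.smul_apply, hmu, if_neg hi, smul_eq_mul, inv_mul_eq_div]
          change (1 : ℝ) < _
          rw [lt_div_iff₀ hpos]
          linarith
    · have hm1 : ∀ i, (∑ k, Bs.coord k) (p (b i)) = 1 := fun i => by
        simp [LinearMap.sum_apply, hB]
      have hm2 : ∀ i, (∑ k, Bs.coord k) (r (some i)) = 2 * N - 1 := fun i => by
        rw [LinearMap.sum_apply]
        simp only [hBu, Finset.sum_sub_distrib, Finset.sum_const, nsmul_eq_mul, Finset.sum_ite_eq',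
          Finset.mem_univ, if_true, Finset.card_univ]
        ring
      have hm3 : (∑ k, Bs.coord k) (r none) = N := by
        rw [LinearMap.sum_apply]
        simp [hBw', hN]
      have hN1 : (0 : ℝ) < 2 * N - 1 := by linarith
      have hN1' : 2 * N - 1 ≠ 0 := hN1.ne'
      have hN0 : N ≠ 0 := by linarith
      have hq : (1 + 1 / N) / (2 * N - 1) * (2 * N - 1) = 1 + 1 / N := div_mul_cancel₀ _ hN1'
      have hei : 1 / (2 * N) = 1 / N / 2 := by field_simp
      have hα : 0 < (1 + 1 / N) / (2 * N - 1) := by positivity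
      have hα' : 0 < (1 + 1 / N) / (2 * N - 1) - 1 / (2 * N) := by
        rw [sub_pos, div_lt_div_iff₀ (by linarith) hN1]
        have : 1 / N * N = 1 := by field_simp
        nlinarith
      -- A multiple of the coordinate `j` tilts the symmetric functional about the apex facet:
      -- antipodes other than `j` get `1 + 1/N - 1/N = 1`, while the antipode `j` gets `1 + 1/(2N)`.
      refine ⟨((1 + 1 / N) / (2 * N - 1)) • (∑ k, Bs.coord k) - (1 / (2 * N)) • Bs.coord j,
        ?_, ?_, ?_, ?_⟩
      · intro v hv
        simp [apexFacet] at hv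
      · intro v hv _
        obtain ⟨i, -, rfl⟩ := Finset.mem_map.1 hv
        rw [LinearMap.sub_apply, LinearMap.smul_apply, LinearMap.smul_apply, hm1, hB]
        simp only [smul_eq_mul]
        split_ifs
        · linarith
        · linarith
      · rintro (_ | i) hv
        · rw [LinearMap.sub_apply, LinearMap.smul_apply, LinearMap.smul_apply, hm3, hBw']
          change _ = (N + 1 / (2 * N)) / (2 * N - 1)
          rw [smul_eq_mul, smul_eq_mul, eq_div_iff hN1']
          linear_combination N * hq - hei * (2 * N - 2)
        · have hi : i ≠ j := by simpa [apexFacet] using hv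
          rw [LinearMap.sub_apply, LinearMap.smul_apply, LinearMap.smul_apply, hm2, hBu,
            if_neg hi.symm]
          change _ = (1 : ℝ)
          rw [smul_eq_mul, smul_eq_mul]
          linear_combination hq - 2 * hei
      · rintro (_ | i) hv
        · simp [apexFacet] at hv
        · have hi : i = j := by simpa [apexFacet] using hv
          rw [LinearMap.sub_apply, LinearMap.smul_apply, LinearMap.smul_apply, hm2, hBu,
            if_pos hi.symm]
          change (1 : ℝ) < _
          simp only [smul_eq_mul]
          rw [div_mul_cancel₀ _ hN1.ne']
          have : 0 < 1 / N := by positivity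
          linarith
  · intro c hc
    -- With antipode weights `max (2B - c i) 0` of total `B`, their combination has coordinate `2B -
    -- max (2B - c i) 0` at `i`. Adding the weight `max (c i - 2B) 0` on `b i` gives exactly `c i`.
    -- The support is a mixed facet unless every `c i` is at most `2B`.
    obtain ⟨B, hB0, hBsum, i₀, hi₀⟩ := exists_sum_max_eq hι (fun i => c (b i)) fun i => hc _
    have hRHS : ∀ i, Bs.coord i (∑ v ∈ Finset.univ.map b, c v • p v) = c (b i) := fun i => by
      rw [Finset.sum_map, map_sum]
      simp [hB]
    by_cases hall : ∀ i, c (b i) ≤ 2 * B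
    · have hmax : ∀ i, max (2 * B - c (b i)) 0 = 2 * B - c (b i) := fun i =>
        max_eq_left (by linarith [hall i])
      simp only [hmax] at hBsum
      obtain ⟨j, hj⟩ := Finite.exists_max fun i => c (b i)
      -- Now the point lies under the simplex of antipodes, and the omitted antipode is the one over
      -- a largest coordinate, so that the weights `c (b j) - c (b k)` are nonnegative. The apex
      -- weight follows from `∑ c = (2N - 1) * B`.
      refine ⟨_, Or.inr ⟨j, rfl⟩, Sum.elim 0 fun o => o.elim ((2 * B - c (b j)) * (2 * N - 1))
        fun k => c (b j) - c (b k), ?_, ?_⟩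
      · rintro (v | _ | k)
        · exact le_rfl
        · exact mul_nonneg (by linarith [hall j]) (by linarith)
        · exact sub_nonneg.2 (hj k)
      · apply hext
        intro i
        rw [hRHS, apexFacet, Finset.sum_disjSum, Finset.sum_empty, zero_add, Finset.sum_insertNone,
          Finset.sum_erase _ (by simp)]
        simp only [map_add, map_sum, map_smul, Sum.elim_inr, Option.elim_some, Option.elim_none,
          smul_eq_mul, hBu, hBw', mul_sub, mul_ite, mul_one, mul_zero,
          Finset.sum_sub_distrib, Finset.sum_ite_eq, Finset.mem_univ, if_true, ← Finset.sum_mul,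
          Finset.sum_const, Finset.card_univ, nsmul_eq_mul] at hBsum ⊢
        rw [← hN] at hBsum ⊢
        linarith
    · push Not at hall
      obtain ⟨i₁, hi₁⟩ := hall
      set A : Finset ι := Finset.univ.filter fun i => c (b i) ≤ 2 * B with hA
      have hmem : ∀ i, i ∈ A ↔ c (b i) ≤ 2 * B := fun i => by simp [hA]
      refine ⟨_, Or.inl ⟨A, ⟨i₀, (hmem _).2 hi₀⟩, fun h => ?_, rfl⟩,
        Sum.elim (fun v => max (c v - 2 * B) 0) fun o => o.elim 0 fun k => max (2 * B - c (b k)) 0,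
        ?_, ?_⟩
      · have := (hmem i₁).1 (h ▸ Finset.mem_univ i₁)
        linarith
      · rintro (v | _ | k)
        · exact le_max_right _ _
        · exact le_rfl
        · exact le_max_right _ _
      · apply hext
        intro i
        have hsumA : ∑ k ∈ A, max (2 * B - c (b k)) 0 = B := by
          refine Eq.trans ?_ hBsum
          refine Finset.sum_subset (Finset.subset_univ A) fun k _ hk => ?_
          rw [hmem] at hk
          exact max_eq_right (by linarith)
        rw [hRHS, mixedFacet, Finset.sum_disjSum, Finset.sum_map, Finset.sum_map]
        simp only [map_add, map_sum, map_smul, Sum.elim_inl, Sum.elim_inr, hB, smul_eq_mul,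
          Function.Embedding.some_apply, Option.elim_some, hBu, mul_sub, mul_ite, mul_one, mul_zero,
          Finset.sum_sub_distrib, Finset.sum_ite_eq, Finset.mem_compl, ← Finset.sum_mul, hsumA,
          hmem]
        by_cases hi : c (b i) ≤ 2 * B
        · rw [if_neg (not_not.2 hi), if_pos hi, max_eq_left (by linarith)]
          ring
        · rw [if_pos hi, if_neg hi, max_eq_left (by linarith)]
          ring

end Glued

/-! ### The boundary of a simplex -/

/-- The facets of the boundary of a simplex. -/
def simplexFacets (U : Type*) [Fintype U] [DecidableEq U] : Set (Finset U) :=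
  {g | ∃ z, g = Finset.univ.erase z}

/-- The vertices are a basis and the negative of its sum; the only linear relation among them, up to
scaling, is that they sum to zero. -/
theorem exists_isRealization_simplex {U E : Type*} [Fintype U] [DecidableEq U] [AddCommGroup E]
    [Module ℝ E] [FiniteDimensional ℝ E] (hU : Fintype.card U = Module.finrank ℝ E + 1) :
    ∃ p : U → E, IsRealization (simplexFacets U) p := by
  suffices H : ∃ p : Option (Fin (Module.finrank ℝ E)) → E, IsRealization
      (simplexFacets (Option (Fin (Module.finrank ℝ E)))) p by
    obtain ⟨p, hp⟩ := H
    have e : Option (Fin (Module.finrank ℝ E)) ≃ U := Fintype.equivOfCardEq (by simp [hU])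
    have := hp.map_equiv e
    refine ⟨p ∘ e.symm, ?_⟩
    convert this using 1
    ext g
    constructor
    · rintro ⟨z, rfl⟩
      refine ⟨_, ⟨e.symm z, rfl⟩, ?_⟩
      ext x
      simp
    · rintro ⟨_, ⟨z, rfl⟩, rfl⟩
      refine ⟨e z, ?_⟩
      ext x
      simp
  set n := Module.finrank ℝ E
  let B : Module.Basis (Fin n) ℝ E := Module.finBasis ℝ E
  let p : Option (Fin n) → E := fun o => o.elim (-∑ i, B i) B
  have hsum : ∀ c : Option (Fin n) → ℝ, ∑ x, c x • p x = ∑ i, (c (some i) - c none) • B i := by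
    intro c
    rw [Fintype.sum_option]
    change c none • (-∑ i, B i) + ∑ i, c (some i) • B i = _
    simp only [sub_smul, Finset.sum_sub_distrib, smul_neg, Finset.smul_sum]
    abel
  refine ⟨p, Set.toFinite _, ?_, ?_, ?_, ?_⟩
  · rintro _ ⟨z, rfl⟩
    simp [n]
  · rintro _ ⟨z, rfl⟩
    rw [linearIndepOn_finset_iff]
    intro c hc
    have h1 : ∑ x, (if x = z then 0 else c x) • p x = 0 := by
      rw [← Finset.add_sum_erase _ _ (Finset.mem_univ z), if_pos rfl, zero_smul, zero_add, ← hc]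
      exact Finset.sum_congr rfl fun x hx => by rw [if_neg (Finset.ne_of_mem_erase hx)]
    rw [hsum] at h1
    have h2 := Fintype.linearIndependent_iff.1 B.linearIndependent _ h1
    have h3 : ∀ x, (if x = z then 0 else c x) = (if (none : Option (Fin n)) = z then 0 else c none) := by
      rintro (_ | i)
      · rfl
      · exact sub_eq_zero.1 (h2 i)
    have h4 := h3 z
    rw [if_pos rfl] at h4
    intro x hx
    have h5 := h3 x
    rwa [← h4, if_neg (Finset.ne_of_mem_erase hx)] at h5
  · rintro _ ⟨z, rfl⟩
    -- Values on the vertices come from a functional as soon as they sum to zero; with `n` ones, the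
    -- value at `z` must be `-n`.
    let a : Option (Fin n) → ℝ := fun x => if x = z then -n else 1
    have ha : ∑ x, a x = 0 := by
      rw [← Finset.add_sum_erase _ _ (Finset.mem_univ z),
        Finset.sum_congr rfl fun x hx => if_neg (Finset.ne_of_mem_erase hx)]
      simp [a]
    have hp : ∀ x, B.constr ℝ (fun i => a (some i)) (p x) = a x := by
      rintro (_ | i)
      · change B.constr ℝ (fun i => a (some i)) (-∑ i, B i) = _
        rw [Fintype.sum_option] at ha
        simp only [map_neg, map_sum, Module.Basis.constr_basis]
        linarith
      · exact Module.Basis.constr_basis _ _ _ _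
    refine ⟨B.constr ℝ fun i => a (some i), fun v hv => ?_, fun v _ hv => ?_⟩
    · rw [hp]
      exact if_neg (Finset.ne_of_mem_erase hv)
    · rw [hp]
      have : v = z := by simpa using hv
      simp only [a, if_pos this]
      have : (0 : ℝ) ≤ n := Nat.cast_nonneg n
      linarith
  · intro x
    let y : Option (Fin n) → ℝ := fun o => o.elim 0 (B.repr x)
    -- Subtracting the minimal coefficient along the relation makes all coefficients nonnegative and
    -- removes `z`.
    obtain ⟨z, hz⟩ := Finite.exists_min y
    refine ⟨_, ⟨z, rfl⟩, fun v => y v - y z, fun v => sub_nonneg.2 (hz v), ?_⟩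
    rw [Finset.sum_erase _ (by simp), hsum]
    conv_rhs => rw [← B.sum_repr x]
    exact Finset.sum_congr rfl fun i _ => by simp [y]

/-! ### Pure complexes and connected sums -/

/-- `K` is pure with set of facets `F`, all of them of cardinality `n`, and every ridge lies in
at least two facets. -/
structure IsPure {V : Type*} (K : PreAbstractSimplicialComplex V) (F : Set (Finset V)) (n : ℕ) :
    Prop where
  mem_faces : ∀ s, s ∈ K.faces ↔ s.Nonempty ∧ ∃ f ∈ F, s ⊆ f
  card : ∀ f ∈ F, f.card = n
  ridge : ∀ f ∈ F, ∀ v ∈ f, ∃ g ∈ F, g ≠ f ∧ ∀ w ∈ f, w ≠ v → w ∈ g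

namespace IsPure

variable {V W : Type*} {K : PreAbstractSimplicialComplex V} {L : PreAbstractSimplicialComplex W}
  {F : Set (Finset V)} {G : Set (Finset W)} {n : ℕ}

theorem eq_of_subset (h : IsPure K F n) {f g : Finset V} (hf : f ∈ F) (hg : g ∈ F) (hfg : f ⊆ g) :
    f = g :=
  Finset.eq_of_subset_of_card_le hfg (by rw [h.card f hf, h.card g hg])

theorem exists_notMem (h : IsPure K F n) {f g : Finset V} (hf : f ∈ F) (hg : g ∈ F) (hfg : f ≠ g) :
    ∃ x ∈ f, x ∉ g := by
  by_contra! hc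
  exact hfg (h.eq_of_subset hf hg hc)

theorem isFacet_iff (h : IsPure K F n) (hn : n ≠ 0) (f : Finset V) : IsFacet K f ↔ f ∈ F := by
  have hmem : ∀ f ∈ F, f ∈ K.faces := fun f hf =>
    (h.mem_faces f).2 ⟨Finset.card_ne_zero.1 (by rw [h.card f hf]; exact hn), f, hf, subset_rfl⟩
  constructor
  · intro hf
    obtain ⟨-, g, hg, hfg⟩ := (h.mem_faces f).1 hf.1
    rwa [le_antisymm hfg (hf.2 (hmem g hg) hfg)]
  · intro hf
    refine ⟨hmem f hf, fun s hs hfs => ?_⟩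
    obtain ⟨-, g, hg, hsg⟩ := (h.mem_faces s).1 hs
    rw [h.eq_of_subset hf hg (hfs.trans hsg)]
    exact hsg

theorem vertices_eq (h : IsPure K F n) : vertices K = verts F := by
  ext v
  simp [vertices, h.mem_faces, verts]

/-- A proper subface of `f` lies in a ridge of `f`, hence in another facet, so deleting `f` loses no
smaller face. -/
theorem mem_removeFacet (h : IsPure K F n) {f : Finset V} (hf : f ∈ F)
    (s : Finset V) : s ∈ (removeFacet K f).faces ↔ s.Nonempty ∧ ∃ g ∈ F, g ≠ f ∧ s ⊆ g := by
  constructor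
  · rintro ⟨hs, hfs⟩
    obtain ⟨hne, g, hg, hsg⟩ := (h.mem_faces s).1 hs
    refine ⟨hne, ?_⟩
    by_cases hgf : g = f
    · subst hgf
      obtain ⟨v, hv, hvs⟩ := Finset.not_subset.1 hfs
      obtain ⟨g', hg', hne', hsub⟩ := h.ridge g hf v hv
      exact ⟨g', hg', hne', fun w hw => hsub w (hsg hw) fun hwv => hvs (hwv ▸ hw)⟩
    · exact ⟨g, hg, hgf, hsg⟩
  · rintro ⟨hne, g, hg, hgf, hsg⟩
    exact ⟨(h.mem_faces s).2 ⟨hne, g, hg, hsg⟩, fun hfs =>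
      hgf (h.eq_of_subset hf hg (hfs.trans hsg)).symm⟩

end IsPure

/-! ### Facets of a connected sum -/

section ConnectedSum

variable {V W : Type*}

theorem glue_of_mem {f : Finset V} {g : Finset W} (ψ : f ≃ g) {w : W} (h : w ∈ g) :
    glue f g ψ w = Sum.inl (ψ.symm ⟨w, h⟩ : V) := dif_pos h

theorem glue_of_notMem {f : Finset V} {g : Finset W} (ψ : f ≃ g) {w : W} (h : w ∉ g) :
    glue f g ψ w = Sum.inr ⟨w, h⟩ := dif_neg h

theorem glue_injective {f : Finset V} {g : Finset W} (ψ : f ≃ g) :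
    Function.Injective (glue f g ψ) := by
  intro x y hxy
  by_cases hx : x ∈ g <;> by_cases hy : y ∈ g
  · rw [glue_of_mem ψ hx, glue_of_mem ψ hy, Sum.inl.injEq, Subtype.coe_inj,
      EmbeddingLike.apply_eq_iff_eq, Subtype.mk.injEq] at hxy
    exact hxy
  · rw [glue_of_mem ψ hx, glue_of_notMem ψ hy] at hxy
    cases hxy
  · rw [glue_of_notMem ψ hx, glue_of_mem ψ hy] at hxy
    cases hxy
  · rw [glue_of_notMem ψ hx, glue_of_notMem ψ hy, Sum.inr.injEq, Subtype.mk.injEq] at hxy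
    exact hxy

theorem glue_apply_coe {f : Finset V} {g : Finset W} (ψ : f ≃ g) (v : f) :
    glue f g ψ (ψ v) = Sum.inl (v : V) := by
  rw [glue_of_mem ψ (ψ v).2]
  simp

/-- The embedding of the vertices of the second summand into a connected sum. -/
noncomputable def glueEmbedding {f : Finset V} {g : Finset W} (ψ : f ≃ g) :
    W ↪ V ⊕ {w : W // w ∉ g} := ⟨glue f g ψ, glue_injective ψ⟩

/-- The facets of a connected sum. -/
def sumFacets (F : Set (Finset V)) (G : Set (Finset W)) (f : Finset V) (g : Finset W) (ψ : f ≃ g) :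
    Set (Finset (V ⊕ {w : W // w ∉ g})) :=
  {h | ∃ f' ∈ F, f' ≠ f ∧ h = f'.map Function.Embedding.inl} ∪
    {h | ∃ g' ∈ G, g' ≠ g ∧ h = g'.map (glueEmbedding ψ)}

variable {K : PreAbstractSimplicialComplex V} {L : PreAbstractSimplicialComplex W}
  {F : Set (Finset V)} {G : Set (Finset W)} {n : ℕ}

/-- Purity passes to connected sums; the delicate point is the ridges on the common sphere, which
change their second facet to one from the other summand. -/
theorem IsPure.connectedSum (hK : IsPure K F n) (hL : IsPure L G n) {f : Finset V} (hf : f ∈ F)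
    {g : Finset W} (hg : g ∈ G) (ψ : f ≃ g) :
    IsPure (connectedSum K L f g ψ) (sumFacets F G f g ψ) n := by
  classical
  have hinr : ∀ g' ∈ G, g' ≠ g → ∃ x : {w : W // w ∉ g}, Sum.inr x ∈ g'.map (glueEmbedding ψ) := by
    intro g' hg' hne
    obtain ⟨x, hx, hxg⟩ := hL.exists_notMem hg' hg hne
    exact ⟨⟨x, hxg⟩, Finset.mem_map.2 ⟨x, hx, glue_of_notMem ψ hxg⟩⟩
  refine ⟨?_, ?_, ?_⟩
  · intro s
    constructor
    · rintro (⟨t, ht, hts⟩ | ⟨t, ht, hts⟩)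
      · obtain ⟨hne, f', hf', hff, htf⟩ := (hK.mem_removeFacet hf t).1 ht
        have hs : s = t.map Function.Embedding.inl := by rw [← hts, Finset.map_eq_image]; rfl
        subst hs
        exact ⟨hne.map, _, Or.inl ⟨f', hf', hff, rfl⟩, Finset.map_subset_map.2 htf⟩
      · obtain ⟨hne, f', hf', hff, htf⟩ := (hL.mem_removeFacet hg t).1 ht
        have hs : s = t.map (glueEmbedding ψ) := by rw [← hts, Finset.map_eq_image]; rfl
        subst hs
        exact ⟨hne.map, _, Or.inr ⟨f', hf', hff, rfl⟩, Finset.map_subset_map.2 htf⟩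
    · rintro ⟨hne, _, ⟨f', hf', hff, rfl⟩ | ⟨f', hf', hff, rfl⟩, hs⟩
      · obtain ⟨t, ht, rfl⟩ := Finset.subset_map_iff.1 hs
        refine Or.inl ⟨t, (hK.mem_removeFacet hf t).2
          ⟨Finset.map_nonempty.1 hne, f', hf', hff, ht⟩, ?_⟩
        rw [Finset.map_eq_image]
        rfl
      · obtain ⟨t, ht, rfl⟩ := Finset.subset_map_iff.1 hs
        refine Or.inr ⟨t, (hL.mem_removeFacet hg t).2
          ⟨Finset.map_nonempty.1 hne, f', hf', hff, ht⟩, ?_⟩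
        rw [Finset.map_eq_image]
        rfl
  · rintro _ (⟨f', hf', -, rfl⟩ | ⟨g', hg', -, rfl⟩)
    · rw [Finset.card_map, hK.card f' hf']
    · rw [Finset.card_map, hL.card g' hg']
  · rintro _ (⟨f', hf', hff, rfl⟩ | ⟨g', hg', hgg, rfl⟩) _ hv'
    · obtain ⟨v, hv, rfl⟩ := Finset.mem_map.1 hv'
      obtain ⟨f'', hf'', hne, hsub⟩ := hK.ridge f' hf' v hv
      -- If the neighbour across the ridge is the deleted facet, it is replaced by the facet of the
      -- other summand adjacent to `g` across the corresponding ridge. That facet has a vertex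
      -- outside `g`, so it differs from the old one.
      by_cases h : f'' = f
      · subst h
        obtain ⟨u, hu, huf⟩ := hK.exists_notMem hf hf' hne
        obtain ⟨g', hg', hgg, hgsub⟩ := hL.ridge g hg (ψ ⟨u, hu⟩) (ψ ⟨u, hu⟩).2
        refine ⟨_, Or.inr ⟨g', hg', hgg, rfl⟩, fun heq => ?_, fun w hw' hwv => ?_⟩
        · obtain ⟨x, hx⟩ := hinr g' hg' hgg
          rw [heq] at hx
          simp at hx
        · obtain ⟨w, hw, rfl⟩ := Finset.mem_map.1 hw'
          have hwf := hsub w hw fun h => hwv (congrArg _ h)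
          refine Finset.mem_map.2 ⟨ψ ⟨w, hwf⟩, hgsub _ (ψ ⟨w, hwf⟩).2 fun h => huf ?_,
            glue_apply_coe ψ ⟨w, hwf⟩⟩
          rw [Subtype.coe_inj, EmbeddingLike.apply_eq_iff_eq, Subtype.mk.injEq] at h
          exact h ▸ hw
      · refine ⟨_, Or.inl ⟨f'', hf'', h, rfl⟩, fun heq => hne ?_, fun w hw' hwv => ?_⟩
        · exact Finset.map_injective _ heq
        · obtain ⟨w, hw, rfl⟩ := Finset.mem_map.1 hw'
          exact Finset.mem_map_of_mem _ (hsub w hw fun h => hwv (congrArg _ h))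
    · obtain ⟨v, hv, rfl⟩ := Finset.mem_map.1 hv'
      obtain ⟨g'', hg'', hne, hsub⟩ := hL.ridge g' hg' v hv
      by_cases h : g'' = g
      · subst h
        obtain ⟨u, hu, hug⟩ := hL.exists_notMem hg hg' hne
        obtain ⟨f', hf', hff, hfsub⟩ := hK.ridge f hf (ψ.symm ⟨u, hu⟩) (ψ.symm ⟨u, hu⟩).2
        refine ⟨_, Or.inl ⟨f', hf', hff, rfl⟩, fun heq => ?_, fun w hw' hwv => ?_⟩
        · obtain ⟨x, hx⟩ := hinr g' hg' hgg
          rw [← heq] at hx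
          simp at hx
        · obtain ⟨w, hw, rfl⟩ := Finset.mem_map.1 hw'
          have hwg := hsub w hw fun h => hwv (congrArg _ h)
          change glue f g'' ψ w ∈ _
          rw [glue_of_mem ψ hwg]
          refine Finset.mem_map_of_mem _ (hfsub _ (ψ.symm ⟨w, hwg⟩).2 fun h => hug ?_)
          rw [Subtype.coe_inj, EmbeddingLike.apply_eq_iff_eq, Subtype.mk.injEq] at h
          exact h ▸ hw
      · refine ⟨_, Or.inr ⟨g'', hg'', h, rfl⟩, fun heq => hne ?_, fun w hw' hwv => ?_⟩
        · exact Finset.map_injective _ heq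
        · obtain ⟨w, hw, rfl⟩ := Finset.mem_map.1 hw'
          exact Finset.mem_map_of_mem _ (hsub w hw fun h => hwv (congrArg _ h))

end ConnectedSum

theorem isPure_simplexBoundary (d : ℕ) :
    IsPure (simplexBoundary d) (simplexFacets (Fin (d + 2))) (d + 1) := by
  refine ⟨fun s => ?_, ?_, ?_⟩
  · refine and_congr_right fun _ => ⟨fun hs => ?_, ?_⟩
    · obtain ⟨z, hz⟩ : ∃ z, z ∉ s := by
        by_contra! h
        exact hs (Finset.eq_univ_iff_forall.2 h)
      exact ⟨_, ⟨z, rfl⟩, fun x hx => Finset.mem_erase.2 ⟨fun h => hz (h ▸ hx), Finset.mem_univ x⟩⟩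
    · rintro ⟨_, ⟨z, rfl⟩, hs⟩ rfl
      exact absurd (hs (Finset.mem_univ z)) (Finset.notMem_erase z _)
  · rintro _ ⟨z, rfl⟩
    simp
  · rintro _ ⟨z, rfl⟩ v hv
    refine ⟨_, ⟨v, rfl⟩, fun h => ?_, fun w _ hwv => by simpa using hwv⟩
    rw [← h] at hv
    simp at hv

/-- The facet of the cross-polytope with the given signs. -/
def signFacet {d : ℕ} (σ : Fin (d + 1) → Bool) : Finset (Fin (d + 1) × Bool) :=
  Finset.univ.map ⟨fun i => (i, σ i), fun _ _ h => congrArg Prod.fst h⟩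

theorem mem_signFacet {d : ℕ} (σ : Fin (d + 1) → Bool) (x : Fin (d + 1) × Bool) :
    x ∈ signFacet σ ↔ x.2 = σ x.1 := by
  constructor
  · intro h
    obtain ⟨i, -, rfl⟩ := Finset.mem_map.1 h
    rfl
  · intro h
    exact Finset.mem_map.2 ⟨x.1, Finset.mem_univ _, Prod.ext rfl h.symm⟩

theorem isPure_crossPolytopeBoundary (d : ℕ) :
    IsPure (crossPolytopeBoundary d) (Set.range signFacet) (d + 1) := by
  refine ⟨fun s => ?_, ?_, ?_⟩
  · refine and_congr_right fun _ => ⟨fun hs => ?_, ?_⟩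
    · refine ⟨_, ⟨fun i => decide ((i, true) ∈ s), rfl⟩, ?_⟩
      rintro ⟨i, _ | _⟩ hx
      · rw [mem_signFacet]
        exact (decide_eq_false fun h => hs i ⟨h, hx⟩).symm
      · rw [mem_signFacet]
        exact (decide_eq_true hx).symm
    · rintro ⟨_, ⟨σ, rfl⟩, hs⟩ i ⟨h1, h2⟩
      have h1 := (mem_signFacet _ _).1 (hs h1)
      have h2 := (mem_signFacet _ _).1 (hs h2)
      simp only at h1 h2
      rw [← h1] at h2
      cases h2
  · rintro _ ⟨σ, rfl⟩
    simp [signFacet]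
  · rintro _ ⟨σ, rfl⟩ ⟨i, b⟩ hv
    refine ⟨_, ⟨Function.update σ i (!σ i), rfl⟩, fun h => ?_, fun w hw hwv => ?_⟩
    · have : (i, σ i) ∈ signFacet (Function.update σ i (!σ i)) := by rw [h, mem_signFacet]
      rw [mem_signFacet] at this
      simp at this
    · rw [mem_signFacet] at hw hv ⊢
      rw [Function.update_of_ne, hw]
      rintro rfl
      apply hwv
      simp only at hv
      rw [Prod.ext_iff]
      exact ⟨rfl, by rw [hw, hv]⟩

/-! ### The facets of `X # C_+` -/

theorem antipode_signFacet {d : ℕ} (σ : Fin (d + 1) → Bool) :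
    antipode (signFacet σ) = signFacet fun i => !σ i := by
  ext ⟨i, b⟩
  simp only [antipode, Finset.mem_image, mem_signFacet]
  constructor
  · rintro ⟨⟨j, c⟩, h, h2⟩
    rw [Prod.mk.injEq] at h2
    obtain ⟨rfl, rfl⟩ := h2
    exact congrArg _ h
  · intro h
    exact ⟨(i, σ i), rfl, Prod.ext rfl h.symm⟩

theorem signFacet_injective {d : ℕ} :
    Function.Injective (signFacet : (Fin (d + 1) → Bool) → Finset (Fin (d + 1) × Bool)) := by
  intro σ τ h
  funext i
  have : (i, σ i) ∈ signFacet τ := by rw [← h, mem_signFacet]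
  exact (mem_signFacet _ _).1 this

theorem mem_baseFacet {d : ℕ} (σ : Fin (d + 1) → Bool) (q : Finset (Fin (d + 2)))
    (x : (Fin (d + 1) × Bool) ⊕ {w : Fin (d + 2) // w ∉ q}) :
    x ∈ baseFacet d (signFacet σ) q ↔ ∃ i, x = Sum.inl (i, !σ i) := by
  rw [baseFacet, antipode_signFacet, Finset.mem_map]
  constructor
  · rintro ⟨⟨i, c⟩, h, rfl⟩
    rw [mem_signFacet] at h
    simp only at h
    exact ⟨i, by rw [h]; rfl⟩
  · rintro ⟨i, rfl⟩
    exact ⟨_, (mem_signFacet _ _).2 rfl, rfl⟩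

theorem baseFacet_mem_sumFacets {d : ℕ} (σ : Fin (d + 1) → Bool) {q : Finset (Fin (d + 2))}
    (ψ : signFacet σ ≃ q) :
    baseFacet d (signFacet σ) q ∈
      sumFacets (Set.range signFacet) (simplexFacets (Fin (d + 2))) (signFacet σ) q ψ := by
  classical
  refine Or.inl ⟨_, ⟨fun i => !σ i, rfl⟩, fun h => ?_, ?_⟩
  · have := congrFun (signFacet_injective h) 0
    simp at this
  · rw [baseFacet, antipode_signFacet]

/-- The facets of `X # C_+` are, up to relabelling, those obtained by gluing a cross-polytope with
an apex onto a facet of `X`. -/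
theorem exists_equiv_gluedFacets {d : ℕ} {V : Type} {X : PreAbstractSimplicialComplex V}
    {F : Set (Finset V)} (hX : IsPure X F (d + 1)) {f : Finset V} (hf : f ∈ F)
    {p : Finset (Fin (d + 1) × Bool)} (hp : IsFacet (crossPolytopeBoundary d) p)
    {q : Finset (Fin (d + 2))} (hq : IsFacet (simplexBoundary d) q)
    (ψS : p ≃ q) (ψ : f ≃ baseFacet d p q) (w : {w : Fin (d + 2) // w ∉ q}) :
    ∃ (b : Fin (d + 1) ↪ V) (e : V ⊕ Option (Fin (d + 1)) ≃
        V ⊕ {x : (Fin (d + 1) × Bool) ⊕ {w : Fin (d + 2) // w ∉ q} // x ∉ baseFacet d p q}),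
      Finset.univ.map b = f ∧
      e (Sum.inr none) = Sum.inr ⟨Sum.inr w, apex_notMem_baseFacet d p q w⟩ ∧
      IsPure (connectedSum X (crossPlus d p q ψS) f (baseFacet d p q) ψ)
        (Finset.map e.toEmbedding '' gluedFacets F b) (d + 1) := by
  classical
  rw [(isPure_crossPolytopeBoundary d).isFacet_iff (by omega)] at hp
  rw [(isPure_simplexBoundary d).isFacet_iff (by omega)] at hq
  have hC : IsPure (crossPlus d p q ψS)
      (sumFacets (Set.range signFacet) (simplexFacets (Fin (d + 2))) p q ψS) (d + 1) :=
    (isPure_crossPolytopeBoundary d).connectedSum (isPure_simplexBoundary d) hp hq ψS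
  obtain ⟨σ, rfl⟩ := hp
  obtain ⟨z, rfl⟩ := hq
  have hw : ∀ x : {w : Fin (d + 2) // w ∉ Finset.univ.erase z}, x = w := by
    have : ∀ x : {w : Fin (d + 2) // w ∉ Finset.univ.erase z}, (x : Fin (d + 2)) = z :=
      fun x => by simpa using x.2
    exact fun x => Subtype.ext ((this x).trans (this w).symm)
  have hwz : (w : Fin (d + 2)) = z := by simpa using w.2
  have hsum := hX.connectedSum hC hf (baseFacet_mem_sumFacets σ ψS) ψ
  have hbase : ∀ i, (Sum.inl (i, !σ i) : (Fin (d + 1) × Bool) ⊕ _) ∈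
      baseFacet d (signFacet σ) (Finset.univ.erase z) := fun i => (mem_baseFacet _ _ _).2 ⟨i, rfl⟩
  have hnbase : ∀ i, (Sum.inl (i, σ i) : (Fin (d + 1) × Bool) ⊕ _) ∉
      baseFacet d (signFacet σ) (Finset.univ.erase z) := fun i h => by
    obtain ⟨j, hj⟩ := (mem_baseFacet _ _ _).1 h
    rw [Sum.inl.injEq, Prod.mk.injEq] at hj
    obtain ⟨rfl, hj⟩ := hj
    simp at hj
  -- With `p` of signs `σ`, the base facet has signs `!σ`; the index `i` labels both the base vertex
  -- `(i, !σ i)`, identified with `b i`, and its antipode `(i, σ i)`.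
  let b : Fin (d + 1) ↪ V := ⟨fun i => ψ.symm ⟨_, hbase i⟩, fun i j h => by
    have h1 := Subtype.coe_inj.1 h
    rw [EmbeddingLike.apply_eq_iff_eq, Subtype.mk.injEq, Sum.inl.injEq, Prod.mk.injEq] at h1
    exact h1.1⟩
  have hglue_base : ∀ i, glue f _ ψ (Sum.inl (i, !σ i)) = Sum.inl (b i) := fun i =>
    glue_of_mem ψ (hbase i)
  have hglue_opp : ∀ i, glue f _ ψ (Sum.inl (i, σ i)) = Sum.inr ⟨_, hnbase i⟩ := fun i =>
    glue_of_notMem ψ (hnbase i)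
  have hglue_apex : glue f _ ψ (Sum.inr w) = Sum.inr ⟨_, apex_notMem_baseFacet d _ _ w⟩ :=
    glue_of_notMem ψ _
  have hb : Finset.univ.map b = f := by
    ext v
    constructor
    · intro h
      obtain ⟨i, -, rfl⟩ := Finset.mem_map.1 h
      exact (ψ.symm ⟨_, hbase i⟩).2
    · intro hv
      obtain ⟨i, hi⟩ := (mem_baseFacet _ _ _).1 (ψ ⟨v, hv⟩).2
      refine Finset.mem_map.2 ⟨i, Finset.mem_univ i, ?_⟩
      have : (⟨_, hbase i⟩ : {x // x ∈ baseFacet d (signFacet σ) (Finset.univ.erase z)}) =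
        ψ ⟨v, hv⟩ := Subtype.ext hi.symm
      change (ψ.symm ⟨_, hbase i⟩ : V) = v
      rw [this, Equiv.symm_apply_apply]
  let e₀ : V ⊕ Option (Fin (d + 1)) → V ⊕ {x : (Fin (d + 1) × Bool) ⊕
      {w : Fin (d + 2) // w ∉ Finset.univ.erase z} //
        x ∉ baseFacet d (signFacet σ) (Finset.univ.erase z)} :=
    Sum.map id fun o => o.elim ⟨Sum.inr w, apex_notMem_baseFacet d _ _ w⟩
      fun i => ⟨Sum.inl (i, σ i), hnbase i⟩
  have he₀ : Function.Bijective e₀ := by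
    refine Sum.map_bijective.2 ⟨Function.bijective_id, ?_, ?_⟩
    · rintro (_ | i) (_ | j) h <;> simp only [Option.elim, Subtype.mk.injEq] at h
      · rfl
      · cases h
      · cases h
      · rw [Sum.inl.injEq, Prod.mk.injEq] at h
        rw [h.1]
    · rintro ⟨⟨i, c⟩ | x, hx⟩
      · refine ⟨some i, Subtype.ext ?_⟩
        by_cases hc : c = σ i
        · subst hc; rfl
        · refine absurd ((mem_baseFacet _ _ _).2 ⟨i, ?_⟩) hx
          rw [Bool.eq_not_of_ne hc]
      · exact ⟨none, Subtype.ext (congrArg Sum.inr (hw x).symm)⟩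
  let e := Equiv.ofBijective e₀ he₀
  have he_inl : ∀ v, e (Sum.inl v) = Sum.inl v := fun v => rfl
  have he_none : e (Sum.inr none) = Sum.inr ⟨Sum.inr w, apex_notMem_baseFacet d _ _ w⟩ := rfl
  have he_some : ∀ i, e (Sum.inr (some i)) = Sum.inr ⟨_, hnbase i⟩ := fun i => rfl
  have hold : ∀ f' : Finset V, f'.map Function.Embedding.inl =
      (f'.disjSum (∅ : Finset (Option (Fin (d + 1))))).map e.toEmbedding := by
    intro f'
    ext x
    obtain ⟨y, rfl⟩ := e.surjective x
    rw [Finset.mem_map_equiv, Equiv.symm_apply_apply]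
    rcases y with v | o
    · simp [he_inl]
    · rcases o with _ | i
      · simp [he_none]
      · simp [he_some]
  -- A facet of the cross-polytope is determined by the set where its signs agree with `σ`. The full
  -- set is `p`, deleted by the inner connected sum; the empty set is the base facet, deleted by the
  -- outer one.
  have hmixed : ∀ τ : Fin (d + 1) → Bool, ((signFacet τ).map Function.Embedding.inl).map (glueEmbedding ψ) =
      (mixedFacet b (Finset.univ.filter fun i => τ i = σ i)).map e.toEmbedding := by
    intro τ
    have hτ : ∀ i, glue f _ ψ (Sum.inl (i, τ i)) = if τ i = σ i then e (Sum.inr (some i))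
        else e (Sum.inl (b i)) := by
      intro i
      split_ifs with h
      · rw [h, hglue_opp, he_some]
      · rw [Bool.eq_not_of_ne h, hglue_base, he_inl]
    ext x
    obtain ⟨y, rfl⟩ := e.surjective x
    rw [Finset.mem_map_equiv, Equiv.symm_apply_apply]
    have : e y ∈ ((signFacet τ).map Function.Embedding.inl).map (glueEmbedding ψ) ↔
        ∃ i, (if τ i = σ i then Sum.inr (some i) else Sum.inl (b i)) = y := by
      constructor
      · intro h
        obtain ⟨x, hx, hxy⟩ := Finset.mem_map.1 h
        obtain ⟨⟨i, c⟩, hc, rfl⟩ := Finset.mem_map.1 hx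
        have hc := (mem_signFacet _ _).1 hc
        simp only at hc
        subst hc
        have := (hτ i).symm.trans hxy
        rw [← apply_ite e] at this
        exact ⟨i, e.injective this⟩
      · rintro ⟨i, rfl⟩
        rw [apply_ite e, ← hτ]
        exact Finset.mem_map_of_mem (glueEmbedding ψ)
          (Finset.mem_map_of_mem Function.Embedding.inl ((mem_signFacet _ _).2 rfl))
    rw [this, mixedFacet]
    rcases y with v | o
    · simp only [Finset.inl_mem_disjSum, Finset.mem_map, Finset.mem_compl, Finset.mem_filter,
        Finset.mem_univ, true_and]
      refine exists_congr fun i => ?_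
      split_ifs with h <;> simp [h]
    · simp only [Finset.inr_mem_disjSum, Finset.mem_map, Finset.mem_filter,
        Finset.mem_univ, true_and]
      refine exists_congr fun i => ?_
      split_ifs with h <;> simp [h]
  -- The facets of `S^d` other than `q` omit one vertex of `q`, and through `ψS` this is one
  -- antipode.
  have hapex : ∀ i, ((Finset.univ.erase (ψS ⟨(i, σ i), (mem_signFacet _ _).2 rfl⟩ :
      Fin (d + 2))).map (glueEmbedding ψS)).map (glueEmbedding ψ) =
      (apexFacet V i).map e.toEmbedding := by
    intro i
    ext x
    obtain ⟨y, rfl⟩ := e.surjective x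
    rw [Finset.mem_map_equiv, Equiv.symm_apply_apply]
    have hS : ∀ j, glue f _ ψ (glue (signFacet σ) _ ψS
        (ψS ⟨(j, σ j), (mem_signFacet _ _).2 rfl⟩)) = e (Sum.inr (some j)) := fun j => by
      rw [glue_apply_coe, hglue_opp, he_some]
    have hSz : glue f _ ψ (glue (signFacet σ) _ ψS w) = e (Sum.inr none) := by
      rw [glue_of_notMem ψS w.2, hglue_apex, he_none]
    have hsurj : ∀ x : Fin (d + 2), x = w ∨
        ∃ j, (ψS ⟨(j, σ j), (mem_signFacet _ _).2 rfl⟩ : Fin (d + 2)) = x := by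
      intro x
      by_cases hx : x = z
      · exact Or.inl (hx.trans hwz.symm)
      · right
        have hxq : x ∈ Finset.univ.erase z := Finset.mem_erase.2 ⟨hx, Finset.mem_univ x⟩
        obtain ⟨⟨⟨j, c⟩, hj⟩, hjx⟩ := ψS.surjective ⟨x, hxq⟩
        have hc := (mem_signFacet _ _).1 hj
        simp only at hc
        subst hc
        exact ⟨j, congrArg Subtype.val hjx⟩
    have hne : ∀ j, (ψS ⟨(j, σ j), (mem_signFacet _ _).2 rfl⟩ : Fin (d + 2)) ≠ w := fun j h =>
      w.2 (h ▸ (ψS ⟨(j, σ j), (mem_signFacet _ _).2 rfl⟩).2)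
    have hinj : ∀ j k, (ψS ⟨(j, σ j), (mem_signFacet _ _).2 rfl⟩ : Fin (d + 2)) =
        ψS ⟨(k, σ k), (mem_signFacet _ _).2 rfl⟩ → j = k := fun j k h => by
      rw [Subtype.coe_inj, EmbeddingLike.apply_eq_iff_eq, Subtype.mk.injEq, Prod.mk.injEq] at h
      exact h.1
    rw [Finset.map_map, Finset.mem_map, apexFacet]
    constructor
    · rintro ⟨x, hx, hxy⟩
      rcases hsurj x with rfl | ⟨j, rfl⟩
      · have hxy := e.injective (hSz.symm.trans hxy)
        rw [← hxy]
        simp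
      · have hxy := e.injective ((hS j).symm.trans hxy)
        rw [← hxy, Finset.inr_mem_disjSum, Finset.some_mem_insertNone]
        exact Finset.mem_erase.2 ⟨fun h => Finset.ne_of_mem_erase hx (by rw [h]), Finset.mem_univ j⟩
    · intro hy
      rcases y with v | _ | j
      · simp at hy
      · exact ⟨w, Finset.mem_erase.2 ⟨(hne i).symm, Finset.mem_univ _⟩, hSz⟩
      · rw [Finset.inr_mem_disjSum, Finset.some_mem_insertNone] at hy
        exact ⟨_, Finset.mem_erase.2 ⟨fun h => Finset.ne_of_mem_erase hy (hinj _ _ h),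
          Finset.mem_univ _⟩, hS j⟩
  refine ⟨b, e, hb, he_none, ?_⟩
  convert hsum using 1
  ext h
  constructor
  · rintro ⟨_, ⟨f', hf', hff, rfl⟩ | ⟨A, hA1, hA2, rfl⟩ | ⟨j, rfl⟩, rfl⟩
    · exact Or.inl ⟨f', hf', hb ▸ hff, (hold f').symm⟩
    · let τ : Fin (d + 1) → Bool := fun i => if i ∈ A then σ i else !σ i
      have hτ : (Finset.univ.filter fun i => τ i = σ i) = A := by
        ext i
        by_cases hi : i ∈ A <;> simp [τ, hi]
      refine Or.inr ⟨(signFacet τ).map Function.Embedding.inl, Or.inl ⟨_, ⟨τ, rfl⟩, fun h => hA2 ?_, rfl⟩,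
        fun h => ?_, ?_⟩
      · rw [← hτ, signFacet_injective h]
        simp
      · rw [baseFacet, antipode_signFacet] at h
        have h1 : signFacet τ = signFacet fun i => !σ i :=
          Finset.map_injective _ h
        obtain ⟨i, hi⟩ := hA1
        have := congrFun (signFacet_injective h1) i
        simp [τ, hi] at this
      · rw [hmixed, hτ]
    · refine Or.inr ⟨_, Or.inr ⟨_, ⟨_, rfl⟩, fun h => ?_, rfl⟩, fun h => ?_, (hapex j).symm⟩
      · have h1 := (Finset.ext_iff.1 h _).2 (ψS ⟨(j, σ j), (mem_signFacet _ _).2 rfl⟩).2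
        simp at h1
      · have h1 : (Sum.inr w : (Fin (d + 1) × Bool) ⊕ _) ∈
            baseFacet d (signFacet σ) (Finset.univ.erase z) := by
          rw [← h, Finset.mem_map]
          refine ⟨w, Finset.mem_erase.2 ⟨fun h => w.2 ?_, Finset.mem_univ _⟩,
            glue_of_notMem ψS w.2⟩
          rw [h]
          exact (ψS ⟨(j, σ j), (mem_signFacet _ _).2 rfl⟩).2
        exact apex_notMem_baseFacet d _ _ w h1
  · rintro (⟨f', hf', hff, rfl⟩ | ⟨_, ⟨_, ⟨τ, rfl⟩, hne, rfl⟩ | ⟨_, ⟨y, rfl⟩, hne, rfl⟩, hne', rfl⟩)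
    · exact ⟨_, Or.inl ⟨f', hf', hb.symm ▸ hff, rfl⟩, (hold f').symm⟩
    · refine ⟨_, Or.inr (Or.inl ⟨_, ?_, ?_, rfl⟩), (hmixed τ).symm⟩
      · by_contra hcon
        rw [Finset.not_nonempty_iff_eq_empty, Finset.filter_eq_empty_iff] at hcon
        apply hne'
        have : τ = fun i => !σ i := funext fun i => Bool.eq_not_of_ne (hcon (Finset.mem_univ i))
        rw [baseFacet, antipode_signFacet, this]
      · intro h
        rw [Finset.filter_eq_self] at h
        exact hne (congrArg _ (funext fun i => h i (Finset.mem_univ i)))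
    · have hy : y ∈ Finset.univ.erase z := by
        refine Finset.mem_erase.2 ⟨?_, Finset.mem_univ y⟩
        rintro rfl
        exact hne rfl
      obtain ⟨⟨⟨j, c⟩, hj⟩, hjx⟩ := ψS.surjective ⟨y, hy⟩
      have hc := (mem_signFacet _ _).1 hj
      simp only at hc
      subst hc
      refine ⟨_, Or.inr (Or.inr ⟨j, rfl⟩), ?_⟩
      rw [← hapex j, hjx]

/-! ### Transversals and realizations of the complexes `X^d_k` -/

section Tower

/-- The properties of the facets of `X^d_k` with apex `a` established by induction on `k`. -/
structure IsTower {V : Type*} (d k : ℕ) (F : Set (Finset V)) (a : V) : Prop where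
  realization : ∃ p : V → EuclideanSpace ℝ (Fin (d + 1)), IsRealization F p
  card : Nat.card V = k * (d + 2)
  mem_verts : ∀ v, v ∈ verts F
  -- This property and `le_card_succ` concern only facets at the apex, which is why the construction
  -- always glues at such a facet.
  share : ∀ f ∈ F, ∀ g ∈ F, a ∈ f → a ∈ g → ∃ x, x ≠ a ∧ x ∈ f ∧ x ∈ g
  le_card : ∀ T : Finset V, (∀ f ∈ F, ∃ v ∈ T, v ∈ f) → 2 * k ≤ T.card
  le_card_succ : ∀ f ∈ F, a ∈ f → ∀ T : Finset V, (∀ g ∈ F, g ≠ f → ∃ v ∈ T, v ∈ g) →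
    2 * k ≤ T.card + 1
  exists_transversal : ∃ T : Finset V, (∀ f ∈ F, ∃ v ∈ T, v ∈ f) ∧ T.card = 2 * k

theorem IsTower.map_equiv {V V' : Type*} {d k : ℕ} {F : Set (Finset V)} {a : V}
    (h : IsTower d k F a) (e : V ≃ V') :
    IsTower d k (Finset.map e.toEmbedding '' F) (e a) := by
  have hsymm : ∀ {T : Finset V'} {f : Finset V}, (∃ v ∈ T, v ∈ f.map e.toEmbedding) →
      ∃ v ∈ T.map e.symm.toEmbedding, v ∈ f := by
    rintro T f ⟨v, hv, hvf⟩
    exact ⟨e.symm v, by simpa using hv, by simpa [Finset.mem_map_equiv] using hvf⟩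
  refine ⟨?_, ?_, ?_, ?_, ?_, ?_, ?_⟩
  · obtain ⟨p, hp⟩ := h.realization
    exact ⟨_, hp.map_equiv e⟩
  · rw [← Nat.card_congr e, h.card]
  · intro v
    obtain ⟨f, hf, hv⟩ := h.mem_verts (e.symm v)
    exact ⟨_, ⟨f, hf, rfl⟩, by simpa [Finset.mem_map_equiv] using hv⟩
  · rintro _ ⟨f, hf, rfl⟩ _ ⟨g, hg, rfl⟩ haf hag
    obtain ⟨x, hx, hxf, hxg⟩ := h.share f hf g hg (by simpa using haf) (by simpa using hag)
    exact ⟨e x, by simpa using hx, by simpa using hxf, by simpa using hxg⟩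
  · intro T hT
    have := h.le_card (T.map e.symm.toEmbedding) fun f hf => hsymm (hT _ ⟨f, hf, rfl⟩)
    rwa [Finset.card_map] at this
  · rintro _ ⟨f, hf, rfl⟩ haf T hT
    have := h.le_card_succ f hf (by simpa using haf) (T.map e.symm.toEmbedding) fun g hg hgf =>
      hsymm (hT _ ⟨g, hg, rfl⟩ fun h => hgf (Finset.map_injective _ h))
    rwa [Finset.card_map] at this
  · obtain ⟨T, hT, hc⟩ := h.exists_transversal
    refine ⟨T.map e.toEmbedding, ?_, by rw [Finset.card_map, hc]⟩
    rintro _ ⟨f, hf, rfl⟩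
    obtain ⟨v, hv, hvf⟩ := hT f hf
    exact ⟨e v, Finset.mem_map_of_mem _ hv, Finset.mem_map_of_mem _ hvf⟩

theorem exists_notMem_of_card_lt {α : Type*} [Fintype α] {s : Finset α}
    (h : s.card < Fintype.card α) : ∃ x, x ∉ s := by
  by_contra! hc
  rw [Finset.eq_univ_iff_forall.2 hc, Finset.card_univ] at h
  exact lt_irrefl _ h

/-- Two vertices are needed since the facet opposite to a vertex avoids it, and one is still needed
after a facet is dropped. Facets at `a` share a further vertex because `d + 2 ≥ 4` leaves one
outside `a` and the two omitted vertices. -/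
theorem isTower_simplexFacets {d : ℕ} (hd : 2 ≤ d) (a : Fin (d + 2)) :
    IsTower d 1 (simplexFacets (Fin (d + 2))) a := by
  refine ⟨exists_isRealization_simplex (by simp), by simp, ?_, ?_, ?_, ?_, ?_⟩
  · intro v
    obtain ⟨z, hz⟩ := exists_ne v
    exact ⟨_, ⟨z, rfl⟩, by simpa using hz.symm⟩
  · rintro _ ⟨y, rfl⟩ _ ⟨z, rfl⟩ - -
    obtain ⟨x, hx⟩ := exists_notMem_of_card_lt (s := {a, y, z})
      (Finset.card_le_three.trans_lt (by rw [Fintype.card_fin]; omega))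
    simp only [Finset.mem_insert, Finset.mem_singleton, not_or] at hx
    exact ⟨x, hx.1, by simpa using hx.2.1, by simpa using hx.2.2⟩
  · intro T hT
    by_contra! hlt
    have hsub : ∃ x, T ⊆ {x} := by
      rcases T.eq_empty_or_nonempty with rfl | ⟨x, hx⟩
      · exact ⟨a, Finset.empty_subset _⟩
      · exact ⟨x, fun y hy => Finset.mem_singleton.2
          (Finset.card_le_one.1 (by omega) y hy x hx)⟩
    obtain ⟨x, hx⟩ := hsub
    obtain ⟨v, hv, hvf⟩ := hT _ ⟨x, rfl⟩
    exact Finset.ne_of_mem_erase hvf (Finset.mem_singleton.1 (hx hv))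
  · rintro _ ⟨z, rfl⟩ - T hT
    obtain ⟨y, hy⟩ := exists_ne z
    obtain ⟨v, hv, -⟩ := hT _ ⟨y, rfl⟩ fun h => hy (by
      have := (Finset.ext_iff.1 h y)
      simpa using this)
    have := Finset.card_pos.2 ⟨v, hv⟩
    omega
  · refine ⟨{0, 1}, ?_, by simp⟩
    rintro _ ⟨z, rfl⟩
    by_cases hz : z = 0
    · exact ⟨1, by simp, by simp [hz]⟩
    · exact ⟨0, by simp, by simpa using Ne.symm hz⟩

/-- The auxiliary properties recur at the new apex. Two apex facets omit at most two of the `d + 1 ≥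
3` antipodes, so they share one. If one apex facet is dropped, another still forces a new vertex,
which costs only one unit in the bound. -/
theorem IsTower.glued {V : Type*} {d k : ℕ} (hd : 2 ≤ d) {F : Set (Finset V)} {a : V}
    (h : IsTower d k F a) (b : Fin (d + 1) ↪ V) (hb : Finset.univ.map b ∈ F)
    (ha : a ∈ Finset.univ.map b) : IsTower d (k + 1) (gluedFacets F b) (Sum.inr none) := by
  obtain ⟨p, hp⟩ := h.realization
  have hfin : Finite V := Set.finite_univ_iff.1
    (hp.finite_verts.subset fun v _ => h.mem_verts v)
  have : Nontrivial (Fin (d + 1)) := Fin.nontrivial_iff_two_le.2 (by omega)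
  have hold : ∀ f ∈ F, f ≠ Finset.univ.map b → f.disjSum ∅ ∈ gluedFacets F b :=
    fun f hf hne => Or.inl ⟨f, hf, hne, rfl⟩
  have hmix : ∀ A : Finset (Fin (d + 1)), A.Nonempty → A ≠ Finset.univ →
      mixedFacet b A ∈ gluedFacets F b := fun A h1 h2 => Or.inr (Or.inl ⟨A, h1, h2, rfl⟩)
  have hapex : ∀ j, apexFacet V j ∈ gluedFacets F b := fun j => Or.inr (Or.inr ⟨j, rfl⟩)
  have hsing : ∀ i : Fin (d + 1), ({i} : Finset (Fin (d + 1))) ≠ Finset.univ := fun i hi => by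
    obtain ⟨j, hj⟩ := exists_ne i
    exact hj (Finset.mem_singleton.1 (hi.symm ▸ Finset.mem_univ j))
  have hofApex : ∀ g ∈ gluedFacets F b, Sum.inr none ∈ g → ∃ j, g = apexFacet V j := by
    rintro _ (⟨f, hf, -, rfl⟩ | ⟨A, -, -, rfl⟩ | ⟨j, rfl⟩) hg
    · simp at hg
    · simp [mixedFacet] at hg
    · exact ⟨j, rfl⟩
  -- the properties of a set of vertices meeting all facets, up to one facet at the apex
  have key : ∀ (T : Finset (V ⊕ Option (Fin (d + 1)))) (j₀ : Fin (d + 1)),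
      (∀ g ∈ gluedFacets F b, g ≠ apexFacet V j₀ → ∃ v ∈ T, v ∈ g) →
      (∀ f ∈ F, f ≠ Finset.univ.map b → ∃ v ∈ T.toLeft, v ∈ f) ∧
      (∀ A : Finset (Fin (d + 1)), A.Nonempty → A ≠ Finset.univ →
        (∃ i ∉ A, b i ∈ T.toLeft) ∨ ∃ i ∈ A, some i ∈ T.toRight) ∧ T.toRight.Nonempty := by
    intro T j₀ hT
    have hmem : ∀ j : Fin (d + 1), Sum.inr none ∈ apexFacet V j := fun j => by simp [apexFacet]
    refine ⟨fun f hf hne => ?_, fun A h1 h2 => ?_, ?_⟩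
    · obtain ⟨v, hv, hvf⟩ := hT _ (hold f hf hne) fun h => by
        have := h ▸ hmem j₀
        simp at this
      obtain ⟨v, hvf', rfl⟩ : ∃ w ∈ f, Sum.inl w = v := by simpa using hvf
      exact ⟨v, Finset.mem_toLeft.2 hv, hvf'⟩
    · obtain ⟨v, hv, hvf⟩ := hT _ (hmix A h1 h2) fun h => by
        have := h ▸ hmem j₀
        simp [mixedFacet] at this
      rcases v with v | o
      · rw [mixedFacet, Finset.inl_mem_disjSum, Finset.mem_map] at hvf
        obtain ⟨i, hi, rfl⟩ := hvf
        exact Or.inl ⟨i, Finset.mem_compl.1 hi, Finset.mem_toLeft.2 hv⟩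
      · rw [mixedFacet, Finset.inr_mem_disjSum, Finset.mem_map] at hvf
        obtain ⟨i, hi, rfl⟩ := hvf
        exact Or.inr ⟨i, hi, Finset.mem_toRight.2 hv⟩
    · obtain ⟨j, hj⟩ := exists_ne j₀
      obtain ⟨v, hv, hvf⟩ := hT _ (hapex j) fun h => by
        have : Sum.inr (some j) ∈ apexFacet V j := by
          rw [h]
          simp [apexFacet, hj]
        simp [apexFacet] at this
      rcases v with v | o
      · simp [apexFacet] at hvf
      · exact ⟨o, Finset.mem_toRight.2 hv⟩
  -- When `b` is missed, a mixed facet with `A = {i}` can only be met at its antipode, so all `d +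
  -- 1` antipodes belong to `T`; together with the old bound `2k - 1` this suffices as `d ≥ 2`.
  have key2 : ∀ (T : Finset (V ⊕ Option (Fin (d + 1)))) (j₀ : Fin (d + 1)),
      (∀ g ∈ gluedFacets F b, g ≠ apexFacet V j₀ → ∃ v ∈ T, v ∈ g) →
      (¬ ∃ v ∈ T.toLeft, v ∈ Finset.univ.map b) → 2 * (k + 1) ≤ T.card := by
    intro T j₀ hT hnot
    obtain ⟨h1, h2, -⟩ := key T j₀ hT
    have h3 := h.le_card_succ _ hb ha T.toLeft h1
    have h4 : Finset.univ.map Function.Embedding.some ⊆ T.toRight := by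
      intro o ho
      obtain ⟨i, -, rfl⟩ := Finset.mem_map.1 ho
      rcases h2 {i} (Finset.singleton_nonempty i) (hsing i) with ⟨j, -, hj⟩ | ⟨j, hj, hj'⟩
      · exact absurd ⟨b j, hj, Finset.mem_map_of_mem b (Finset.mem_univ j)⟩ hnot
      · rwa [Finset.mem_singleton.1 hj] at hj'
    have h5 := Finset.card_le_card h4
    rw [Finset.card_map, Finset.card_univ, Fintype.card_fin] at h5
    have h6 := T.card_toLeft_add_card_toRight
    omega
  have key3 : ∀ T : Finset (V ⊕ Option (Fin (d + 1))),
      (∀ f ∈ F, f ≠ Finset.univ.map b → ∃ v ∈ T.toLeft, v ∈ f) →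
      (∃ v ∈ T.toLeft, v ∈ Finset.univ.map b) → ∀ f ∈ F, ∃ v ∈ T.toLeft, v ∈ f := by
    intro T h1 h2 f hf
    by_cases hfb : f = Finset.univ.map b
    · rwa [hfb]
    · exact h1 f hf hfb
  refine ⟨hp.glued b hb (by rw [Fintype.card_fin]; omega), ?_, ?_, ?_, ?_, ?_, ?_⟩
  · rw [Nat.card_sum, h.card]
    simp
    ring
  · rintro (v | _ | i)
    · obtain ⟨f, hf, hv⟩ := h.mem_verts v
      by_cases hfb : f = Finset.univ.map b
      · subst hfb
        obtain ⟨i, -, rfl⟩ := Finset.mem_map.1 hv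
        obtain ⟨j, hj⟩ := exists_ne i
        exact ⟨_, hmix {j} (Finset.singleton_nonempty j) (hsing j), by
          simpa [mixedFacet] using hj.symm⟩
      · exact ⟨_, hold f hf hfb, by simpa using hv⟩
    · exact ⟨_, hapex 0, by simp [apexFacet]⟩
    · obtain ⟨j, hj⟩ := exists_ne i
      exact ⟨_, hapex j, by simpa [apexFacet] using hj.symm⟩
  · intro f hf g hg haf hag
    obtain ⟨i, rfl⟩ := hofApex f hf haf
    obtain ⟨j, rfl⟩ := hofApex g hg hag
    obtain ⟨x, hx⟩ := exists_notMem_of_card_lt (s := {i, j})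
      (Finset.card_le_two.trans_lt (by rw [Fintype.card_fin]; omega))
    simp only [Finset.mem_insert, Finset.mem_singleton, not_or] at hx
    exact ⟨Sum.inr (some x), by simp, by simpa [apexFacet] using hx.1,
      by simpa [apexFacet] using hx.2⟩
  · intro T hT
    obtain ⟨h1, h2, h3⟩ := key T 0 fun g hg _ => hT g hg
    by_cases hhit : ∃ v ∈ T.toLeft, v ∈ Finset.univ.map b
    swap
    · exact key2 T 0 (fun g hg _ => hT g hg) hhit
    have h4 := h.le_card _ (key3 T h1 hhit)
    have h6 := T.card_toLeft_add_card_toRight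
    by_cases hcard : 2 ≤ T.toRight.card
    · omega
    have hone : T.toRight.card = 1 := by
      have := h3.card_pos
      omega
    obtain ⟨o, ho⟩ := Finset.card_eq_one.1 hone
    rcases o with _ | i
    -- The mixed facet whose only old vertex is `b i` contains no apex, so it must be met at `b i`.
    · have hall : ∀ i, b i ∈ T.toLeft := by
        intro i
        obtain ⟨j, hj⟩ := exists_ne i
        rcases h2 {i}ᶜ ⟨j, by simpa using hj⟩ (fun h => by
          have := h.symm ▸ Finset.mem_univ i
          simp at this) with ⟨j, hj, hj'⟩ | ⟨j, hj, hj'⟩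
        · rw [Finset.mem_compl, not_not, Finset.mem_singleton] at hj
          rwa [hj] at hj'
        · rw [ho] at hj'
          simp at hj'
      classical
      have haT : a ∈ T.toLeft := by
        obtain ⟨i, -, rfl⟩ := Finset.mem_map.1 ha
        exact hall i
      -- The old apex is superfluous: a facet containing it shares another vertex with `b`, and all
      -- of `b` lies in `T`.
      have h7 := h.le_card (T.toLeft.erase a) fun f hf => by
        by_cases haf : a ∈ f
        · obtain ⟨x, hx, hxb, hxf⟩ := h.share _ hb f hf ha haf
          obtain ⟨i, -, rfl⟩ := Finset.mem_map.1 hxb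
          exact ⟨b i, Finset.mem_erase.2 ⟨hx, hall i⟩, hxf⟩
        · obtain ⟨v, hv, hvf⟩ := key3 T h1 hhit f hf
          exact ⟨v, Finset.mem_erase.2 ⟨fun h => haf (h ▸ hvf), hv⟩, hvf⟩
      have h8 := Finset.card_erase_add_one haT
      omega
    -- The apex facet that omits the antipode `i` would not be met.
    · obtain ⟨v, hv, hvf⟩ := hT _ (hapex i)
      rcases v with v | o
      · simp [apexFacet] at hvf
      · rw [← Finset.mem_toRight, ho, Finset.mem_singleton] at hv
        subst hv
        simp [apexFacet] at hvf
  · intro f hf haf T hT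
    obtain ⟨j, rfl⟩ := hofApex f hf haf
    obtain ⟨h1, h2, h3⟩ := key T j hT
    by_cases hhit : ∃ v ∈ T.toLeft, v ∈ Finset.univ.map b
    · have h4 := h.le_card _ (key3 T h1 hhit)
      have h5 := h3.card_pos
      have h6 := T.card_toLeft_add_card_toRight
      omega
    · have := key2 T j hT hhit
      omega
  · obtain ⟨T, hT, hc⟩ := h.exists_transversal
    obtain ⟨v, hv, hvb⟩ := hT _ hb
    obtain ⟨i, -, rfl⟩ := Finset.mem_map.1 hvb
    -- A mixed facet contains either `b i` or its antipode, and both are chosen; the apex meets the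
    -- apex facets.
    refine ⟨T.disjSum {none, some i}, ?_, ?_⟩
    · rintro _ (⟨f, hf, -, rfl⟩ | ⟨A, -, -, rfl⟩ | ⟨j, rfl⟩)
      · obtain ⟨v, hv, hvf⟩ := hT f hf
        exact ⟨Sum.inl v, by simpa using hv, by simpa using hvf⟩
      · by_cases hi : i ∈ A
        · exact ⟨Sum.inr (some i), by simp, by simpa [mixedFacet] using hi⟩
        · exact ⟨Sum.inl (b i), by simpa using hv, by simpa [mixedFacet] using hi⟩
      · exact ⟨Sum.inr none, by simp, by simp [apexFacet]⟩
    · rw [Finset.card_disjSum, hc, Finset.card_pair (by simp)]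
      ring

theorem IsX.exists_facets {d : ℕ} (hd : 2 ≤ d) {k : ℕ} {V : Type}
    {X : PreAbstractSimplicialComplex V} {a : V} (hX : IsX d k V X a) :
    ∃ F : Set (Finset V), IsPure X F (d + 1) ∧ IsTower d k F a := by
  induction hX with
  | one a => exact ⟨_, isPure_simplexBoundary d, isTower_simplexFacets hd a⟩
  | succ hX f hf haf p hp q hq ψS ψ w ih =>
    obtain ⟨F, hF, hT⟩ := ih
    rw [hF.isFacet_iff (by omega)] at hf
    obtain ⟨b, e, rfl, he, hpure⟩ := exists_equiv_gluedFacets hF hf hp hq ψS ψ w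
    exact ⟨_, hpure, he ▸ (hT.glued hd b hf haf).map_equiv e⟩

theorem card_baseFacet (d : ℕ) {p : Finset (Fin (d + 1) × Bool)} (q : Finset (Fin (d + 2))) :
    (baseFacet d p q).card = p.card := by
  rw [baseFacet, Finset.card_map, antipode, Finset.card_image_of_injective]
  rintro ⟨i, x⟩ ⟨j, y⟩ h
  simpa using h

theorem exists_isX {d : ℕ} (hd : 2 ≤ d) (k : ℕ) :
    ∃ (V : Type) (X : PreAbstractSimplicialComplex V) (a : V), IsX d (k + 1) V X a := by
  induction k with
  | zero => exact ⟨_, _, _, IsX.one 0⟩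
  | succ k ih =>
    obtain ⟨V, X, a, hX⟩ := ih
    obtain ⟨F, hF, hT⟩ := hX.exists_facets hd
    obtain ⟨f, hf, haf⟩ := hT.mem_verts a
    have hp : IsFacet (crossPolytopeBoundary d) (signFacet fun _ => true) :=
      ((isPure_crossPolytopeBoundary d).isFacet_iff (by omega) _).2 ⟨_, rfl⟩
    have hq : IsFacet (simplexBoundary d) (Finset.univ.erase 0) :=
      ((isPure_simplexBoundary d).isFacet_iff (by omega) _).2 ⟨0, rfl⟩
    have hpc : (signFacet fun _ : Fin (d + 1) => true).card = d + 1 := by simp [signFacet]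
    exact ⟨_, _, _, IsX.succ hX f ((hF.isFacet_iff (by omega) f).2 hf) haf _ hp _ hq
      (Finset.equivOfCardEq (by rw [hpc]; simp))
      (Finset.equivOfCardEq (by rw [card_baseFacet, hpc, hF.card f hf])) ⟨0, by simp⟩⟩

end Tower

/-! ### Passage from facet families to the complexes and their polytopes -/

theorem ncard_vertices_eq_of_isomorphic {V W : Type*} {K : PreAbstractSimplicialComplex V}
    {L : PreAbstractSimplicialComplex W} (h : Isomorphic K L) :
    (vertices K).ncard = (vertices L).ncard := by
  classical
  obtain ⟨φ, hφ, rfl⟩ := h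
  rw [← Set.InjOn.ncard_image hφ]
  congr 1
  ext w
  constructor
  · rintro ⟨v, hv, rfl⟩
    exact ⟨{v}, hv, by simp⟩
  · rintro ⟨s, hs, hsw⟩
    obtain ⟨hne, hdown⟩ := K.isRelLowerSet_faces hs
    obtain ⟨v, hv⟩ := hne
    refine ⟨v, hdown (Finset.singleton_subset_iff.2 hv) (Finset.singleton_nonempty v), ?_⟩
    have : φ v ∈ ({w} : Finset W) := by
      rw [← hsw]
      exact Finset.mem_image_of_mem φ hv
    simpa using this

theorem IsPure.edgeSet_facetHypergraph {V : Type*} {K : PreAbstractSimplicialComplex V}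
    {F : Set (Finset V)} {n : ℕ} (h : IsPure K F n) (hn : n ≠ 0) :
    (facetHypergraph K).edgeSet = {e | ∃ f ∈ F, e = (f : Set V)} := by
  ext e
  simp only [facetHypergraph, h.isFacet_iff hn, Set.mem_ofPred_eq]

theorem IsTower.transversalNumber_eq {V : Type*} {K : PreAbstractSimplicialComplex V} {d k n : ℕ}
    {F : Set (Finset V)} {a : V} (hF : IsPure K F n) (hn : n ≠ 0) (hT : IsTower d k F a) :
    transversalNumber (facetHypergraph K) = 2 * k := by
  have hV : (facetHypergraph K).vertexSet = Set.univ := by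
    change vertices K = _
    rw [hF.vertices_eq]
    exact Set.eq_univ_of_forall hT.mem_verts
  refine IsLeast.csInf_eq ⟨?_, ?_⟩
  · obtain ⟨T, h1, h2⟩ := hT.exists_transversal
    refine ⟨T, ⟨by simp [hV], ?_⟩, h2⟩
    rw [hF.edgeSet_facetHypergraph hn]
    rintro _ ⟨f, hf, rfl⟩
    exact h1 f hf
  · rintro _ ⟨T, ⟨-, h1⟩, rfl⟩
    rw [hF.edgeSet_facetHypergraph hn] at h1
    exact hT.le_card T fun f hf => h1 _ ⟨f, hf, rfl⟩

theorem IsX.properties {d : ℕ} (hd : 2 ≤ d) {k : ℕ} {V : Type}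
    {X : PreAbstractSimplicialComplex V} {a : V} (hX : IsX d k V X a) :
    (vertices X).ncard = k * (d + 2) ∧ transversalNumber (facetHypergraph X) = 2 * k ∧
      ∃ P : Set (EuclideanSpace ℝ (Fin (d + 1))), IsSimplicialPolytope (d + 1) P ∧
        Isomorphic X (boundaryComplex P) ∧
        transversalNumber (polytopeFacetHypergraph P) = 2 * k ∧
        (polytopeFacetHypergraph P).vertexSet.ncard = k * (d + 2) := by
  obtain ⟨F, hF, hT⟩ := hX.exists_facets hd
  have hverts : verts F = Set.univ := Set.eq_univ_of_forall hT.mem_verts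
  have htn := hT.transversalNumber_eq hF (by omega)
  have hcard : (verts F).ncard = k * (d + 2) := by rw [hverts, Set.ncard_univ, hT.card]
  obtain ⟨p, hp⟩ := hT.realization
  refine ⟨by rw [hF.vertices_eq, hcard], htn, convexHull ℝ (p '' verts F), ?_, ?_, ?_, ?_⟩
  · simpa using hp.isSimplicialPolytope
  · exact hp.isomorphic X hF.mem_faces
  · rw [← htn]
    exact hp.transversalNumber_eq hF.vertices_eq (hF.edgeSet_facetHypergraph (by omega))
  · rw [hp.vertexSet_eq, Set.InjOn.ncard_image hp.injOn, hcard]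

/-! ### Perfect matchings between the triangles of a closed surface -/

section Matching

variable {U : Type*} [DecidableEq U]

/-- The pairs that lie in an odd number of the given triangles. -/
def boundaryPairs (C : Finset (Finset U)) : Finset (Finset U) :=
  (C.biUnion (Finset.powersetCard 2)).filter fun e => Odd (C.filter (e ⊆ ·)).card

/-- Incidences between selected pairs and triangles are counted in two ways. Restricting to `D` is
harmless because it contains every triangle of `C` with a selected pair. -/
theorem sum_card_filter_pairs {C D : Finset (Finset U)} (hDC : D ⊆ C) (q : Finset U → Prop)
    [DecidablePred q] (hq : ∀ f ∈ C, ∀ e, e ⊆ f → q e → f ∈ D) :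
    ∑ e ∈ (C.biUnion (Finset.powersetCard 2)).filter q, (C.filter (e ⊆ ·)).card =
      ∑ f ∈ D, ((f.powersetCard 2).filter q).card := by
  have h1 : ∀ e ∈ (C.biUnion (Finset.powersetCard 2)).filter q,
      (C.filter (e ⊆ ·)) = D.filter (e ⊆ ·) := by
    intro e he
    ext f
    simp only [Finset.mem_filter]
    exact ⟨fun h => ⟨hq f h.1 e h.2 (Finset.mem_filter.1 he).2, h.2⟩, fun h => ⟨hDC h.1, h.2⟩⟩
  rw [Finset.sum_congr rfl fun e he => by rw [h1 e he]]
  have h2 := Finset.sum_card_bipartiteAbove_eq_sum_card_bipartiteBelow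
    (s := (C.biUnion (Finset.powersetCard 2)).filter q) (t := D) (fun e f => e ⊆ f)
  unfold Finset.bipartiteAbove Finset.bipartiteBelow at h2
  rw [h2]
  refine Finset.sum_congr rfl fun f hf => ?_
  congr 1
  ext e
  simp only [Finset.mem_filter, Finset.mem_biUnion, Finset.mem_powersetCard]
  constructor
  · rintro ⟨⟨⟨g, -, -, h2⟩, h3⟩, h4⟩
    exact ⟨⟨h4, h2⟩, h3⟩
  · rintro ⟨⟨h1, h2⟩, h3⟩
    exact ⟨⟨⟨f, hDC hf, h1, h2⟩, h3⟩, h1⟩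

/-- Modulo 2 the number of boundary pairs is the number of incidences, `3 * C.card`, hence odd. A
single boundary pair is impossible since boundary pairs at each vertex are even in number. This
gives the bridgelessness in Petersen's theorem. -/
theorem three_le_card_boundaryPairs {C : Finset (Finset U)} (hC : ∀ f ∈ C, f.card = 3)
    (hodd : Odd C.card) : 3 ≤ (boundaryPairs C).card := by
  have h1 : Odd (boundaryPairs C).card := by
    have h := sum_card_filter_pairs (subset_refl C) (fun _ => True) fun f hf _ _ _ => hf
    simp only [Finset.filter_true] at h
    rw [boundaryPairs, ← Finset.odd_sum_iff_odd_card_odd, h,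
      Finset.sum_congr rfl fun f hf => by rw [Finset.card_powersetCard, hC f hf],
      Finset.sum_const, smul_eq_mul]
    exact hodd.mul (by decide)
  have h2 : (boundaryPairs C).card ≠ 1 := by
    intro h
    obtain ⟨e, he⟩ := Finset.card_eq_one.1 h
    have hemem : e ∈ boundaryPairs C := he ▸ Finset.mem_singleton_self e
    have hecard : e.card = 2 := by
      obtain ⟨f, -, hf⟩ := Finset.mem_biUnion.1 (Finset.mem_filter.1 hemem).1
      exact (Finset.mem_powersetCard.1 hf).2
    obtain ⟨x, hx⟩ := Finset.card_pos.1 (by rw [hecard]; norm_num)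
    -- Counting only pairs through an end `x` of the supposed unique boundary pair: every triangle
    -- at `x` contributes two, so the count is even.
    have h3 := sum_card_filter_pairs (Finset.filter_subset (x ∈ ·) C) (x ∈ ·)
      fun f hf e hef hxe => Finset.mem_filter.2 ⟨hf, hef hxe⟩
    have h4 : ∀ f ∈ C.filter (x ∈ ·), ((f.powersetCard 2).filter (x ∈ ·)).card = 2 := by
      intro f hf
      obtain ⟨hfC, hxf⟩ := Finset.mem_filter.1 hf
      have : (f.powersetCard 2).filter (x ∈ ·) = (f.erase x).image fun y => {x, y} := by
        ext g
        simp only [Finset.mem_filter, Finset.mem_powersetCard, Finset.mem_image, Finset.mem_erase]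
        constructor
        · rintro ⟨⟨hgf, hg⟩, hxg⟩
          obtain ⟨y, hy⟩ := Finset.card_eq_one.1
            (show (g.erase x).card = 1 by rw [Finset.card_erase_of_mem hxg, hg])
          have hyg : y ∈ g.erase x := hy ▸ Finset.mem_singleton_self y
          refine ⟨y, ⟨Finset.ne_of_mem_erase hyg, hgf (Finset.mem_of_mem_erase hyg)⟩, ?_⟩
          rw [← hy, Finset.insert_erase hxg]
        · rintro ⟨y, ⟨hyx, hyf⟩, rfl⟩
          refine ⟨⟨?_, Finset.card_pair hyx.symm⟩, Finset.mem_insert_self _ _⟩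
          intro z hz
          rcases Finset.mem_insert.1 hz with rfl | hz
          · exact hxf
          · rwa [Finset.mem_singleton.1 hz]
      rw [this, Finset.card_image_of_injOn, Finset.card_erase_of_mem hxf, hC f hfC]
      intro y hy z hz hyz
      have hy' : y ∈ ({x, z} : Finset U) := by
        rw [← show ({x, y} : Finset U) = {x, z} from hyz]
        simp
      rcases Finset.mem_insert.1 hy' with h | h
      · exact absurd h (Finset.ne_of_mem_erase hy)
      · exact Finset.mem_singleton.1 h
    rw [Finset.sum_congr rfl h4, Finset.sum_const, smul_eq_mul] at h3
    have h5 : ¬ Odd (∑ e ∈ (C.biUnion (Finset.powersetCard 2)).filter (x ∈ ·),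
        (C.filter (e ⊆ ·)).card) := by
      rw [h3, Nat.not_odd_iff_even]
      exact even_two.mul_left _
    rw [Finset.odd_sum_iff_odd_card_odd, Finset.filter_comm] at h5
    apply h5
    have h6 : (boundaryPairs C).filter (x ∈ ·) = {e} := by
      rw [he, Finset.filter_singleton, if_pos hx]
    rw [boundaryPairs] at h6
    rw [h6]
    simp
  obtain ⟨k, hk⟩ := h1
  omega

/-- **Petersen's theorem** for the dual graph of a closed surface: the triangles can be matched in
pairs with a common edge. -/
theorem exists_triangle_matching {F : Finset (Finset U)} (hcard : ∀ f ∈ F, f.card = 3)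
    (hthin : ∀ f ∈ F, ∀ e, e ⊆ f → e.card = 2 → (F.filter (e ⊆ ·)).card = 2) :
    ∃ m : Finset U → Finset U, ∀ f ∈ F, m f ∈ F ∧ m f ≠ f ∧ (f ∩ m f).card = 2 ∧ m (m f) = f := by
  have hinter : ∀ f ∈ F, ∀ g ∈ F, f ≠ g → ∀ e, e.card = 2 → e ⊆ f → e ⊆ g →
      (f ∩ g).card = 2 := by
    intro f hf g hg hne e he hef heg
    refine le_antisymm ?_ (he ▸ Finset.card_le_card (Finset.subset_inter hef heg))
    by_contra! hlt
    have h1 : f ∩ g = f := Finset.eq_of_subset_of_card_le Finset.inter_subset_left (by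
      rw [hcard f hf]; omega)
    exact hne (Finset.eq_of_subset_of_card_le (Finset.inter_eq_left.1 h1)
      (by rw [hcard f hf, hcard g hg]))
  let G : SimpleGraph F :=
    { Adj := fun f g => f ≠ g ∧ ((f : Finset U) ∩ g).card = 2
      symm := ⟨fun f g h => ⟨h.1.symm, by rw [Finset.inter_comm]; exact h.2⟩⟩
      loopless := ⟨fun f h => h.1 rfl⟩ }
  have hG : ∃ M : G.Subgraph, M.IsPerfectMatching := by
    rw [SimpleGraph.tutte]
    intro S hS
    unfold SimpleGraph.IsTutteViolator at hS
    set H := ((⊤ : G.Subgraph).deleteVerts S).coe with hH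
    classical
    let C : H.ConnectedComponent → Finset (Finset U) := fun c =>
      Finset.image (fun x : ((⊤ : G.Subgraph).deleteVerts S).verts => ((x : F) : Finset U))
        c.supp.toFinset
    have hmemC : ∀ c f, f ∈ C c → ∃ (h : f ∈ F) (h' : (⟨f, h⟩ : F) ∈
        ((⊤ : G.Subgraph).deleteVerts S).verts), H.connectedComponentMk ⟨⟨f, h⟩, h'⟩ = c := by
      intro c f hf
      obtain ⟨⟨⟨f, h⟩, h'⟩, hx, rfl⟩ := Finset.mem_image.1 hf
      exact ⟨h, h', by simpa using hx⟩
    have hCmem : ∀ c (f : Finset U) (h : f ∈ F) (h' : (⟨f, h⟩ : F) ∈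
        ((⊤ : G.Subgraph).deleteVerts S).verts), H.connectedComponentMk ⟨⟨f, h⟩, h'⟩ = c →
        f ∈ C c := by
      intro c f h h' hc
      exact Finset.mem_image.2 ⟨⟨⟨f, h⟩, h'⟩, by simpa using hc, rfl⟩
    have hCcard : ∀ c ∈ H.oddComponents, Odd (C c).card := by
      intro c hc
      have : (C c).card = c.supp.ncard := by
        rw [Finset.card_image_of_injective _ (fun x y h => Subtype.ext (Subtype.ext h)),
          Set.ncard_eq_toFinset_card']
      rw [this]
      exact hc
    have hCF : ∀ c, C c ⊆ F := fun c f hf => (hmemC c f hf).1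
    -- A boundary pair lies in an odd number of triangles of the component but in two altogether.
    -- The second triangle is adjacent to the component without belonging to it, so it was removed.
    have hB : ∀ c, ∀ e ∈ boundaryPairs (C c), ∃ f ∈ C c, ∃ g, ∃ hg : g ∈ F,
        (⟨g, hg⟩ : F) ∈ S ∧ e ⊆ f ∧ e ⊆ g ∧ e.card = 2 := by
      intro c e he
      obtain ⟨he1, he2⟩ := Finset.mem_filter.1 he
      obtain ⟨f, hf, hfe⟩ := Finset.mem_biUnion.1 he1
      obtain ⟨hef, hecard⟩ := Finset.mem_powersetCard.1 hfe
      have h2 := hthin f (hCF c hf) e hef hecard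
      have hlt : ((C c).filter (e ⊆ ·)).card < (F.filter (e ⊆ ·)).card := by
        refine lt_of_le_of_ne
          (Finset.card_le_card (Finset.filter_subset_filter _ (hCF c))) fun h => ?_
        rw [h, h2] at he2
        exact absurd he2 (by decide)
      obtain ⟨g, hg, hgC⟩ := Finset.exists_mem_notMem_of_card_lt_card hlt
      obtain ⟨hgF, heg⟩ := Finset.mem_filter.1 hg
      have hgC' : g ∉ C c := fun h => hgC (Finset.mem_filter.2 ⟨h, heg⟩)
      refine ⟨f, hf, g, hgF, ?_, hef, heg, hecard⟩
      by_contra hgS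
      obtain ⟨hfF, hf', hfc⟩ := hmemC c f hf
      apply hgC'
      refine hCmem c g hgF (by simpa using hgS) ?_
      rw [← hfc, SimpleGraph.ConnectedComponent.eq]
      apply SimpleGraph.Adj.reachable
      have hne : g ≠ f := fun h => hgC' (h ▸ hf)
      have hfS : (⟨f, hfF⟩ : F) ∉ S := by simpa using hf'
      rw [hH, SimpleGraph.Subgraph.coe_adj, SimpleGraph.Subgraph.deleteVerts_adj]
      refine ⟨by simp, hgS, by simp, hfS, ?_⟩
      rw [SimpleGraph.Subgraph.top_adj]
      exact ⟨fun h => hne (congrArg Subtype.val h), hinter g hgF f hfF hne e hecard heg hef⟩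
    -- A common boundary pair would lie in three triangles: one from each component and a removed
    -- one.
    have hdisj : ∀ c ∈ H.oddComponents.toFinset, ∀ c' ∈ H.oddComponents.toFinset, c ≠ c' →
        Disjoint (boundaryPairs (C c)) (boundaryPairs (C c')) := by
      intro c _ c' _ hne
      rw [Finset.disjoint_left]
      intro e he he'
      obtain ⟨f, hf, g, hg, hgS, hef, heg, hecard⟩ := hB c e he
      obtain ⟨f', hf', -, -, -, hef', -, -⟩ := hB c' e he'
      obtain ⟨h1, h2, h3⟩ := hmemC c f hf
      obtain ⟨h1', h2', h3'⟩ := hmemC c' f' hf'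
      have hS1 : (⟨f, h1⟩ : F) ∉ S := by simpa using h2
      have hS2 : (⟨f', h1'⟩ : F) ∉ S := by simpa using h2'
      have hff : f ≠ f' := by
        rintro rfl
        exact hne (h3.symm.trans h3')
      have hfg : f ≠ g := by
        rintro rfl
        exact hS1 hgS
      have hfg' : f' ≠ g := by
        rintro rfl
        exact hS2 hgS
      have h4 : ({f, f', g} : Finset (Finset U)) ⊆ F.filter (e ⊆ ·) := by
        intro x hx
        simp only [Finset.mem_insert, Finset.mem_singleton] at hx
        rcases hx with rfl | rfl | rfl
        · exact Finset.mem_filter.2 ⟨h1, hef⟩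
        · exact Finset.mem_filter.2 ⟨h1', hef'⟩
        · exact Finset.mem_filter.2 ⟨hg, heg⟩
      have h5 := Finset.card_le_card h4
      rw [hthin f h1 e hef hecard, Finset.card_eq_three.2 ⟨f, f', g, hff, hfg, hfg', rfl⟩] at h5
      omega
    -- Each removed triangle has only three pairs, while each odd component uses at least three;
    -- hence there are at most as many odd components as removed triangles.
    have hle : (H.oddComponents.toFinset.biUnion fun c => boundaryPairs (C c)).card ≤
        S.toFinset.card * 3 := by
      refine (Finset.card_le_card ?_).trans (Finset.card_biUnion_le_card_mul S.toFinset
        (fun g : F => (g : Finset U).powersetCard 2) 3 ?_)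
      · intro e he
        obtain ⟨c, -, hec⟩ := Finset.mem_biUnion.1 he
        obtain ⟨-, -, g, hg, hgS, -, heg, hecard⟩ := hB c e hec
        exact Finset.mem_biUnion.2 ⟨⟨g, hg⟩, by simpa using hgS,
          Finset.mem_powersetCard.2 ⟨heg, hecard⟩⟩
      · intro g _
        rw [Finset.card_powersetCard, hcard g g.2]
        decide
    have hge : H.oddComponents.toFinset.card * 3 ≤
        (H.oddComponents.toFinset.biUnion fun c => boundaryPairs (C c)).card := by
      rw [Finset.card_biUnion hdisj]
      exact Finset.card_nsmul_le_sum _ _ _ fun c hc => three_le_card_boundaryPairs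
        (fun f hf => hcard f (hCF c hf)) (hCcard c (by simpa using hc))
    rw [Set.ncard_eq_toFinset_card', Set.ncard_eq_toFinset_card'] at hS
    omega
  obtain ⟨M, hM⟩ := hG
  rw [SimpleGraph.Subgraph.isPerfectMatching_iff] at hM
  choose m hm1 hm2 using hM
  refine ⟨fun f => if h : f ∈ F then m ⟨f, h⟩ else f, fun f hf => ?_⟩
  have hadj := M.adj_sub (hm1 ⟨f, hf⟩)
  have hmm : m (m ⟨f, hf⟩) = ⟨f, hf⟩ := (hm2 _ _ (hm1 ⟨f, hf⟩).symm).symm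
  simp only [dif_pos hf, Subtype.coe_eta, Finset.coe_mem, dif_pos]
  exact ⟨trivial, fun h => hadj.1 (Subtype.ext h.symm), hadj.2, congrArg Subtype.val hmm⟩

/-- If all cocycles of a closed surface are coboundaries, its vertices can be coloured with two
colours without monochromatic triangles. -/
theorem exists_two_coloring {F : Finset (Finset U)} (hcard : ∀ f ∈ F, f.card = 3)
    (hthin : ∀ f ∈ F, ∀ e, e ⊆ f → e.card = 2 → (F.filter (e ⊆ ·)).card = 2)
    (hcoh : ∀ c : Finset U → ZMod 2, (∀ f ∈ F, ∑ v ∈ f, c (f.erase v) = 0) →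
      ∃ g : U → ZMod 2, ∀ f ∈ F, ∀ x ∈ f, ∀ y ∈ f, x ≠ y → g x + g y = c {x, y}) :
    ∃ g : U → ZMod 2, ∀ f ∈ F, ∃ x ∈ f, ∃ y ∈ f, g x ≠ g y := by
  obtain ⟨m, hm⟩ := exists_triangle_matching hcard hthin
  classical
  -- Each triangle has exactly one matched edge, so it sees the values 0, 1, 1 and `c` is a cocycle.
  let c : Finset U → ZMod 2 := fun e => if ∃ f ∈ F, f ∩ m f = e then 0 else 1
  have hc : ∀ f ∈ F, ∀ e, e ⊆ f → e.card = 2 → c e = if e = f ∩ m f then 0 else 1 := by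
    intro f hf e hef he
    have : (∃ f ∈ F, f ∩ m f = e) ↔ e = f ∩ m f := by
      constructor
      · rintro ⟨h, hh, rfl⟩
        obtain ⟨h1, h2, h3, h4⟩ := hm h hh
        have h5 := hthin f hf _ hef he
        have h6 : ({h, m h} : Finset (Finset U)) = F.filter (h ∩ m h ⊆ ·) := by
          refine Finset.eq_of_subset_of_card_le ?_ (by rw [h5, Finset.card_pair h2.symm])
          intro x hx
          rcases Finset.mem_insert.1 hx with rfl | hx
          · exact Finset.mem_filter.2 ⟨hh, Finset.inter_subset_left⟩
          · rw [Finset.mem_singleton.1 hx]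
            exact Finset.mem_filter.2 ⟨h1, Finset.inter_subset_right⟩
        have h7 : f ∈ ({h, m h} : Finset (Finset U)) := by
          rw [h6]
          exact Finset.mem_filter.2 ⟨hf, hef⟩
        rcases Finset.mem_insert.1 h7 with rfl | h7
        · rfl
        · rw [Finset.mem_singleton.1 h7, h4, Finset.inter_comm]
      · rintro rfl
        exact ⟨f, hf, rfl⟩
    simp only [c, this]
  have hopp : ∀ f ∈ F, ∃ t ∈ f, f ∩ m f = f.erase t := by
    intro f hf
    obtain ⟨-, -, h3, -⟩ := hm f hf
    have h4 : (f \ (f ∩ m f)).card = 1 := by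
      rw [Finset.card_sdiff_of_subset Finset.inter_subset_left, hcard f hf, h3]
    obtain ⟨t, ht⟩ := Finset.card_eq_one.1 h4
    have htmem : t ∈ f \ (f ∩ m f) := ht ▸ Finset.mem_singleton_self t
    refine ⟨t, (Finset.mem_sdiff.1 htmem).1, ?_⟩
    rw [← Finset.sdiff_singleton_eq_erase, ← ht, Finset.sdiff_sdiff_eq_self Finset.inter_subset_left]
  have herase : ∀ f ∈ F, ∀ t ∈ f, (f.erase t).card = 2 := fun f hf t ht => by
    rw [Finset.card_erase_of_mem ht, hcard f hf]
  have hcerase : ∀ f ∈ F, ∀ t ∈ f, f ∩ m f = f.erase t → ∀ v ∈ f,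
      c (f.erase v) = if v = t then 0 else 1 := by
    intro f hf t ht hft v hv
    rw [hc f hf _ (Finset.erase_subset v f) (herase f hf v hv), hft]
    congr 1
    rw [Finset.erase_inj f hv]
  obtain ⟨g, hg⟩ := hcoh c fun f hf => by
    obtain ⟨t, ht, hft⟩ := hopp f hf
    rw [Finset.sum_congr rfl (hcerase f hf t ht hft), ← Finset.add_sum_erase _ _ ht, if_pos rfl,
      Finset.sum_congr rfl fun v hv => if_neg (Finset.ne_of_mem_erase hv), Finset.sum_const,
      herase f hf t ht]
    rfl
  refine ⟨g, fun f hf => ?_⟩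
  obtain ⟨t, ht, hft⟩ := hopp f hf
  obtain ⟨v, hv⟩ := Finset.card_pos.1 (by rw [herase f hf t ht]; norm_num)
  obtain ⟨hvt, hvf⟩ := Finset.mem_erase.1 hv
  obtain ⟨x, y, hxy, hfv⟩ := Finset.card_eq_two.1 (herase f hf v hvf)
  have hx : x ∈ f := Finset.mem_of_mem_erase (hfv ▸ Finset.mem_insert_self x {y} : x ∈ f.erase v)
  have hy : y ∈ f := Finset.mem_of_mem_erase
    (hfv ▸ Finset.mem_insert_of_mem (Finset.mem_singleton_self y) : y ∈ f.erase v)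
  -- The edge `{x, y}` of `f` is unmatched, so its ends have colours with sum 1.
  refine ⟨x, hx, y, hy, fun heq => ?_⟩
  have h1 := hg f hf x hx y hy hxy
  rw [← hfv, hcerase f hf t ht hft v hvf, if_neg hvt, heq, CharTwo.add_self_eq_zero] at h1
  exact zero_ne_one h1

end Matching

/-! ### The boundary complex of a three-dimensional polytope -/

theorem sum_erase_eq {U M : Type*} [DecidableEq U] [AddCommMonoid M] {f : Finset U} (hf : f.card = 3)
    {v u a : U} (hv : v ∈ f) (hu : u ∈ f) (ha : a ∈ f) (hvu : v ≠ u) (hva : v ≠ a) (hua : u ≠ a)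
    (c : Finset U → M) : ∑ t ∈ f, c (f.erase t) = c {u, a} + (c {v, a} + c {v, u}) := by
  have hfe : f = {v, u, a} := by
    symm
    refine Finset.eq_of_subset_of_card_le ?_ ?_
    · intro x hx
      simp only [Finset.mem_insert, Finset.mem_singleton] at hx
      rcases hx with rfl | rfl | rfl <;> assumption
    · rw [hf, Finset.card_eq_three.2 ⟨v, u, a, hvu, hva, hua, rfl⟩]
  have h1 : ({v, u, a} : Finset U).erase v = {u, a} := by grind
  have h2 : ({v, u, a} : Finset U).erase u = {v, a} := by grind
  have h3 : ({v, u, a} : Finset U).erase a = {v, u} := by grind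
  rw [hfe, Finset.sum_insert (by simp [hvu, hva]), Finset.sum_insert (by simp [hua]),
    Finset.sum_singleton, h1, h2, h3]

namespace IsRealization

/-! ### Ridges and rotation of supporting hyperplanes -/

section Ridge

variable {U E : Type*} [NormedAddCommGroup E] [NormedSpace ℝ E] {F : Set (Finset U)} {p : U → E}

/-- Every ridge of a facet lies in another facet. -/
theorem exists_ridge (R : IsRealization F p) {f : Finset U} (hf : f ∈ F) {v : U} (hv : v ∈ f) :
    ∃ g ∈ F, g ≠ f ∧ ∀ w ∈ f, w ≠ v → w ∈ g := by
  classical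
  obtain ⟨l, hl1, hl2, hl3⟩ := R.support_le hf
  -- The hyperplanes `l + t • m = 1` rotate about the ridge opposite to `v`: they contain it for
  -- every `t`, and move off `v` for `t > 0`.
  obtain ⟨m, hm⟩ := R.exists_coord hf fun w => if w = v then -1 else 0
  have hmv : m (p v) = -1 := by rw [hm v hv, if_pos rfl]
  obtain ⟨w₀, hw₀, hmw₀⟩ := R.exists_pos (l := m) (x := -p v) (by rw [map_neg, hmv]; norm_num)
  -- The rotation stops at the first vertex met; only vertices with `m > 0` can be met, and the
  -- ratio is the parameter at which this happens.
  obtain ⟨w, ⟨hw, hmw⟩, hmin⟩ := Set.exists_min_image {w ∈ verts F | 0 < m (p w)}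
    (fun w => (1 - l (p w)) / m (p w)) (R.finite_verts.subset fun w hw => hw.1) ⟨w₀, hw₀, hmw₀⟩
  have hwf : w ∉ f := fun h => by
    have := hm w h
    split_ifs at this <;> linarith
  set t := (1 - l (p w)) / m (p w) with ht
  have ht0 : 0 < t := div_pos (sub_pos.2 (hl2 w hw hwf)) hmw
  obtain ⟨g, hg, hgt⟩ := R.exists_facet_of_le (l := l + t • m) (fun x hx => by
    rw [LinearMap.add_apply, LinearMap.smul_apply, smul_eq_mul]
    rcases le_or_gt (m (p x)) 0 with h | h
    · have := mul_nonpos_of_nonneg_of_nonpos ht0.le h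
      linarith [hl3 x hx]
    · have := hmin x ⟨hx, h⟩
      rw [le_div_iff₀ h] at this
      linarith)
  refine ⟨g, hg, ?_, fun x hx hxv => hgt x ⟨f, hf, hx⟩ ?_⟩
  · rintro rfl
    apply hwf
    apply hgt w hw
    rw [LinearMap.add_apply, LinearMap.smul_apply, smul_eq_mul, ht, div_mul_cancel₀ _ hmw.ne']
    ring
  · rw [LinearMap.add_apply, LinearMap.smul_apply, hl1 x hx, hm x hx, if_neg hxv, smul_zero,
      add_zero]

/-- A ridge lies in at most two facets. -/
theorem eq_of_ridge [FiniteDimensional ℝ E] (R : IsRealization F p) {f g h e : Finset U}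
    (hf : f ∈ F) (hg : g ∈ F) (hh : h ∈ F) (hgf : g ≠ f) (hhf : h ≠ f) (hef : e ⊆ f) (heg : e ⊆ g)
    (heh : e ⊆ h) (he : e.card + 1 = f.card) : g = h := by
  classical
  obtain ⟨v, hv⟩ := Finset.card_eq_one.1
    (show (f \ e).card = 1 by rw [Finset.card_sdiff_of_subset hef]; omega)
  have hvfe : v ∈ f ∧ v ∉ e := Finset.mem_sdiff.1 (hv ▸ Finset.mem_singleton_self v)
  have hfe : ∀ w ∈ f, w ≠ v → w ∈ e := fun w hw hwv => by
    by_contra hwe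
    exact hwv (Finset.mem_singleton.1 (hv ▸ Finset.mem_sdiff.2 ⟨hw, hwe⟩))
  obtain ⟨lf, hlf1, hlf2, -⟩ := R.support_le hf
  obtain ⟨m, hm⟩ := R.exists_coord hf fun w => if w = v then -1 else 0
  have hmv : m (p v) = -1 := by rw [hm v hvfe.1, if_pos rfl]
  have hnot : ∀ g ∈ F, g ≠ f → e ⊆ g → v ∉ g := fun g hg hgf heg hvg =>
    hgf (R.eq_of_subset hf hg fun w hw => by
      by_cases hwv : w = v
      · rwa [hwv]
      · exact heg (hfe w hw hwv)).symm
  -- Functionals are determined on `f`, so those equal to 1 on `e` form the one-parameter family `lf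
  -- + t • m`.
  have hform : ∀ g ∈ F, g ≠ f → e ⊆ g → ∃ t : ℝ, (∀ w ∈ g, (lf + t • m) (p w) = 1) ∧
      ∀ w ∈ verts F, w ∉ g → (lf + t • m) (p w) < 1 := by
    intro g hg hgf heg
    obtain ⟨l, hl1, hl2⟩ := R.support g hg
    refine ⟨1 - l (p v), ?_⟩
    have : lf + (1 - l (p v)) • m = l := by
      refine R.functional_ext hf fun w hw => ?_
      rw [LinearMap.add_apply, LinearMap.smul_apply, smul_eq_mul, hlf1 w hw, hm w hw]
      split_ifs with hwv
      · rw [hwv]; ring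
      · rw [hl1 w (heg (hfe w hw hwv))]; ring
    rw [this]
    exact ⟨hl1, hl2⟩
  -- Two facets beyond the ridge occur at parameters `0 < t ≤ s`. A vertex of `g` outside `h` has `m
  -- > 0`, so at `s` its value is still at least 1, against the support of `h`.
  have key : ∀ g ∈ F, ∀ h ∈ F, g ≠ f → h ≠ f → e ⊆ g → e ⊆ h → ∀ t s : ℝ, t ≤ s →
      (∀ w ∈ g, (lf + t • m) (p w) = 1) → (∀ w ∈ verts F, w ∉ h → (lf + s • m) (p w) < 1) →
      (∀ w ∈ verts F, w ∉ g → (lf + t • m) (p w) < 1) → g = h := by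
    intro g hg h hh hgf hhf heg heh t s hts ht hs ht'
    refine R.eq_of_subset hg hh fun w hw => ?_
    by_contra hwh
    have hwf : w ∉ f := fun hwf => by
      by_cases hwv : w = v
      · exact hnot g hg hgf heg (hwv ▸ hw)
      · exact hwh (heh (hfe w hwf hwv))
    have h1 := ht w hw
    have h2 := hs w ⟨g, hg, hw⟩ hwh
    have h3 := hlf2 w ⟨g, hg, hw⟩ hwf
    have h4 := ht' v ⟨f, hf, hvfe.1⟩ (hnot g hg hgf heg)
    rw [LinearMap.add_apply, LinearMap.smul_apply, smul_eq_mul] at h1 h2 h4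
    rw [hlf1 v hvfe.1, hmv] at h4
    have hmw : 0 < m (p w) := by
      by_contra! hneg
      have := mul_nonpos_of_nonneg_of_nonpos (show 0 ≤ t by linarith) hneg
      linarith
    have := mul_le_mul_of_nonneg_right hts hmw.le
    linarith
  obtain ⟨t, ht1, ht2⟩ := hform g hg hgf heg
  obtain ⟨s, hs1, hs2⟩ := hform h hh hhf heh
  rcases le_total t s with hts | hts
  · exact key g hg h hh hgf hhf heg heh t s hts ht1 hs2 ht2
  · exact (key h hh g hg hhf hgf heh heg s t hts hs1 ht2 hs2).symm

/-- Some facet at `v` avoids `w`. -/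
theorem exists_facet_notMem (R : IsRealization F p) {v w : U} (hv : v ∈ verts F) (hwv : w ≠ v) :
    ∃ f ∈ F, v ∈ f ∧ w ∉ f := by
  obtain ⟨f, hf, hvf⟩ := hv
  by_cases hwf : w ∈ f
  · obtain ⟨g, hg, hgf, hsub⟩ := R.exists_ridge hf hwf
    refine ⟨g, hg, hsub v hvf hwv.symm, fun hwg => hgf (R.eq_of_subset hf hg fun x hx => ?_).symm⟩
    by_cases hxw : x = w
    · rwa [hxw]
    · exact hsub x hx hxw
  · exact ⟨f, hf, hvf, hwf⟩

/-- A functional that is maximal over the vertices exactly at `v`. -/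
theorem exists_vertex_functional (R : IsRealization F p) {v : U} (hv : v ∈ verts F) :
    ∃ N : E →ₗ[ℝ] ℝ, N (p v) = 1 ∧ ∀ w ∈ verts F, w ≠ v → N (p w) < 1 := by
  classical
  choose! l hl1 hl2 using R.support
  have hle : ∀ f ∈ F, ∀ w ∈ verts F, l f (p w) ≤ 1 := fun f hf w hw => by
    by_cases h : w ∈ f
    · exact (hl1 f hf w h).le
    · exact (hl2 f hf w hw h).le
  -- The functional is the average of the supporting functionals of the facets at `v`; it is strict
  -- at `w` because some of these facets avoid `w`.
  set S := R.finite.toFinset.filter (v ∈ ·) with hS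
  have hmem : ∀ f, f ∈ S ↔ f ∈ F ∧ v ∈ f := fun f => by simp [hS]
  have hpos : (0 : ℝ) < S.card := by
    obtain ⟨f, hf, hvf⟩ := hv
    exact_mod_cast Finset.card_pos.2 ⟨f, (hmem f).2 ⟨hf, hvf⟩⟩
  refine ⟨(S.card : ℝ)⁻¹ • ∑ f ∈ S, l f, ?_, fun w hw hwv => ?_⟩
  · rw [LinearMap.smul_apply, LinearMap.sum_apply, smul_eq_mul,
      Finset.sum_congr rfl fun f hf => hl1 f ((hmem f).1 hf).1 v ((hmem f).1 hf).2]
    simp [hpos.ne']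
  · rw [LinearMap.smul_apply, LinearMap.sum_apply, smul_eq_mul, inv_mul_lt_iff₀ hpos, mul_one]
    obtain ⟨f, hf, hvf, hwf⟩ := R.exists_facet_notMem hv hwv
    have : ∑ f ∈ S, l f (p w) < ∑ f ∈ S, 1 :=
      Finset.sum_lt_sum (fun f hf => hle f ((hmem f).1 hf).1 w hw)
        ⟨f, (hmem f).2 ⟨hf, hvf⟩, hl2 f hf w hw hwf⟩
    simpa using this

end Ridge

/-! ### Facets sharing an edge -/

section Three

variable {U E : Type*} [NormedAddCommGroup E] [NormedSpace ℝ E] [FiniteDimensional ℝ E]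
  {F : Set (Finset U)} {p : U → E}

theorem card_filter_facets [DecidableEq U] (R : IsRealization F p) {f e : Finset U} (hf : f ∈ F)
    (hef : e ⊆ f) (he : e.card + 1 = f.card) : (R.finite.toFinset.filter (e ⊆ ·)).card = 2 := by
  obtain ⟨v, hv⟩ := Finset.card_eq_one.1
    (show (f \ e).card = 1 by rw [Finset.card_sdiff_of_subset hef]; omega)
  have hvfe : v ∈ f ∧ v ∉ e := Finset.mem_sdiff.1 (hv ▸ Finset.mem_singleton_self v)
  obtain ⟨g, hg, hgf, hsub⟩ := R.exists_ridge hf hvfe.1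
  have heg : e ⊆ g := fun w hw => hsub w (hef hw) fun h => hvfe.2 (h ▸ hw)
  rw [Finset.card_eq_two]
  refine ⟨f, g, hgf.symm, ?_⟩
  ext h
  simp only [Finset.mem_filter, Set.Finite.mem_toFinset, Finset.mem_insert, Finset.mem_singleton]
  constructor
  · rintro ⟨hh, heh⟩
    by_cases hhf : h = f
    · exact Or.inl hhf
    · exact Or.inr (R.eq_of_ridge hf hh hg hhf hgf hef heh heg he)
  · rintro (rfl | rfl)
    · exact ⟨hf, hef⟩
    · exact ⟨hg, heg⟩

/-- An affine function vanishing on an edge and nonnegative on the two adjacent facets is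
nonnegative. -/
theorem nonneg_of_adjacent (R : IsRealization F p) {f g : Finset U} (hf : f ∈ F) (hg : g ∈ F)
    {v u a b : U} (hfe : ∀ x ∈ f, x = v ∨ x = u ∨ x = a) (hvf : v ∈ f) (huf : u ∈ f) (haf : a ∈ f)
    (hvg : v ∈ g) (hug : u ∈ g) (hbg : b ∈ g) (hbf : b ∉ f) (hag : a ∉ g)
    {l : E →ₗ[ℝ] ℝ} {k : ℝ} (hv : l (p v) = k) (hu : l (p u) = k) (ha : k ≤ l (p a))
    (hb : k ≤ l (p b)) : ∀ x ∈ verts F, k ≤ l (p x) := by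
  obtain ⟨lf, hf1, hf2, hf3⟩ := R.support_le hf
  obtain ⟨lg, hg1, hg2, hg3⟩ := R.support_le hg
  have hα : 0 < 1 - lf (p b) := sub_pos.2 (hf2 b ⟨g, hg, hbg⟩ hbf)
  have hβ : 0 < 1 - lg (p a) := sub_pos.2 (hg2 a ⟨f, hf, haf⟩ hag)
  set y := (l (p a) - k) / (1 - lg (p a)) with hy
  set x := (l (p b) - k) / (1 - lf (p b)) with hx
  have hy0 : 0 ≤ y := div_nonneg (by linarith) hβ.le
  have hx0 : 0 ≤ x := div_nonneg (by linarith) hα.le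
  have hya : y * (1 - lg (p a)) = l (p a) - k := div_mul_cancel₀ _ hβ.ne'
  have hxb : x * (1 - lf (p b)) = l (p b) - k := div_mul_cancel₀ _ hα.ne'
  -- The aim is `l - k = x * (1 - lf) + y * (1 - lg)` with `x, y ≥ 0`. The coefficient `y` is fixed
  -- by the value at `a` and `x` by the value at `b`.
  have hext : l + x • lf + y • lg = (k + x + y) • lf := by
    refine R.functional_ext hf fun z hz => ?_
    simp only [LinearMap.add_apply, LinearMap.smul_apply, smul_eq_mul, hf1 z hz]
    rcases hfe z hz with rfl | rfl | rfl
    · rw [hv, hg1 _ hvg]; ring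
    · rw [hu, hg1 _ hug]; ring
    · linarith
  have hval : ∀ z, l z + x * lf z + y * lg z = (k + x + y) * lf z := fun z => by
    have := LinearMap.congr_fun hext z
    simpa using this
  -- Evaluation at `b`, which is off the hyperplane of `f`, makes the constant `k + x + y` vanish.
  have hK : (k + x + y) * (1 - lf (p b)) = 0 := by
    have h1 := hval (p b)
    rw [hg1 b hbg] at h1
    linear_combination h1 + hxb
  have hK0 : k + x + y = 0 := (mul_eq_zero.1 hK).resolve_right hα.ne'
  intro z hz
  have h1 := hval (p z)
  have h2 := mul_nonneg hx0 (sub_nonneg.2 (hf3 z hz))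
  have h3 := mul_nonneg hy0 (sub_nonneg.2 (hg3 z hz))
  rw [hK0] at h1
  linarith

end Three

end IsRealization

theorem exists_third {U : Type*} [DecidableEq U] {f : Finset U} (hf : f.card = 3) {v u : U}
    (hv : v ∈ f) (hu : u ∈ f) (hvu : v ≠ u) :
    ∃ a ∈ f, a ≠ v ∧ a ≠ u ∧ ∀ x ∈ f, x = v ∨ x = u ∨ x = a := by
  obtain ⟨a, ha⟩ := Finset.card_eq_one.1 (show ((f.erase v).erase u).card = 1 by
    rw [Finset.card_erase_of_mem (Finset.mem_erase.2 ⟨hvu.symm, hu⟩), Finset.card_erase_of_mem hv,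
      hf])
  have hmem : ∀ x, x ∈ (f.erase v).erase u ↔ x = a := fun x => by rw [ha, Finset.mem_singleton]
  simp only [Finset.mem_erase] at hmem
  have haa := (hmem a).2 rfl
  refine ⟨a, haa.2.2, haa.2.1, haa.1, fun x hx => ?_⟩
  have := hmem x
  tauto

namespace IsRealization

/-! ### Descending links and vanishing of the first cohomology -/

section Link

variable {U E : Type*} [NormedAddCommGroup E] [NormedSpace ℝ E] {F : Set (Finset U)} {p : U → E}

/-- No three vertices are collinear. -/
theorem sub_ne_smul_sub (R : IsRealization F p) {v u w : U} (hv : v ∈ verts F) (hu : u ∈ verts F)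
    (hw : w ∈ verts F) (hvu : v ≠ u) (huw : u ≠ w) {s : ℝ} (hs0 : 0 < s)
    (hs1 : s ≤ 1) : p u - p v ≠ s • (p w - p v) := by
  classical
  intro h
  rcases hs1.eq_or_lt with rfl | hs1
  · rw [one_smul] at h
    exact huw (R.injOn hu hw (sub_left_injective h))
  -- A facet through the intermediate point `u` must contain `v` and `w` as well, since its
  -- functional is maximal at `u`; then linear independence on the facet is violated.
  obtain ⟨f, hf, huf⟩ := hu
  obtain ⟨l, hl1, hl2, hl3⟩ := R.support_le hf
  have hl := congrArg l h
  rw [map_sub, map_smul, map_sub, smul_eq_mul, hl1 u huf] at hl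
  have hlv := hl3 v hv
  have hlw := hl3 w hw
  have hvf : v ∈ f := by
    by_contra hvf
    have := hl2 v hv hvf
    nlinarith
  have hwf : w ∈ f := by
    by_contra hwf
    have := hl2 w hw hwf
    nlinarith
  obtain ⟨m, hm⟩ := R.exists_coord hf fun x => if x = u then 1 else 0
  have h2 := congrArg m h
  rw [map_sub, map_smul, map_sub, hm u huf, hm v hvf, hm w hwf, if_pos rfl, if_neg hvu,
    if_neg huw.symm] at h2
  simp at h2

/-- A linear functional separating the vertices, and separating the directions at each vertex
normalised by `N`. -/
theorem exists_generic_functional (R : IsRealization F p) {N : U → E →ₗ[ℝ] ℝ}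
    (hN : ∀ v ∈ verts F, ∀ w ∈ verts F, w ≠ v → N v (p w) < 1) :
    ∃ l : E →ₗ[ℝ] ℝ, Set.InjOn (fun u => l (p u)) (verts F) ∧ ∀ v ∈ verts F,
      Set.InjOn (fun u => (l (p u) - l (p v)) / (1 - N v (p u))) (verts F \ {v}) := by
  have hfin := R.finite_verts
  -- These are differences of directions at a vertex, projected to the hyperplane on which `N` drops
  -- by 1. They are nonzero for distinct vertices because no three vertices are collinear, so a
  -- functional avoiding finitely many zeros separates the slopes.
  set r : U × U × U → E := fun t =>
    (1 - N t.1 (p t.2.1))⁻¹ • (p t.2.1 - p t.1) - (1 - N t.1 (p t.2.2))⁻¹ • (p t.2.2 - p t.1)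
    with hr
  set S : Set E := ((fun t : U × U => p t.1 - p t.2) '' (verts F ×ˢ verts F) ∪
    r '' (verts F ×ˢ verts F ×ˢ verts F)) \ {0} with hS
  have hSfin : S.Finite :=
    (((hfin.prod hfin).image _).union ((hfin.prod (hfin.prod hfin)).image _)).sdiff
  have : Finite S := hSfin
  obtain ⟨l, hl⟩ := Module.exists_dual_forall_apply_ne_zero (K := ℝ) (fun x : S => (x : E))
    fun x => x.2.2
  have hl' : ∀ x ∈ S, l x ≠ 0 := fun x hx => hl ⟨x, hx⟩
  refine ⟨l, fun u hu w hw huw => ?_, fun v hv u hu w hw huw => ?_⟩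
  · by_contra hne
    refine hl' (p u - p w) ⟨Or.inl ⟨(u, w), ⟨hu, hw⟩, rfl⟩, fun h => hne ?_⟩ ?_
    · exact R.injOn hu hw (sub_eq_zero.1 h)
    · rw [map_sub, sub_eq_zero]; exact huw
  · by_contra hne
    have hα : 0 < 1 - N v (p u) := sub_pos.2 (hN v hv u hu.1 hu.2)
    have hβ : 0 < 1 - N v (p w) := sub_pos.2 (hN v hv w hw.1 hw.2)
    refine hl' (r (v, u, w)) ⟨Or.inr ⟨(v, u, w), ⟨hv, hu.1, hw.1⟩, rfl⟩, fun h => ?_⟩ ?_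
    · have h' := sub_eq_zero.1 h
      simp only at h'
      rcases le_total (1 - N v (p u)) (1 - N v (p w)) with hle | hle
      · refine R.sub_ne_smul_sub hv hu.1 hw.1 (Ne.symm hu.2) hne
          (s := (1 - N v (p u)) * (1 - N v (p w))⁻¹) (by positivity)
          (by rwa [← div_eq_mul_inv, div_le_one hβ]) ?_
        rw [mul_smul, ← h', smul_inv_smul₀ hα.ne']
      · refine R.sub_ne_smul_sub hv hw.1 hu.1 (Ne.symm hw.2) (Ne.symm hne)
          (s := (1 - N v (p w)) * (1 - N v (p u))⁻¹) (by positivity)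
          (by rwa [← div_eq_mul_inv, div_le_one hα]) ?_
        rw [mul_smul, h', smul_inv_smul₀ hβ.ne']
    · simp only at huw
      rw [hr]
      simp only [map_sub, map_smul, smul_eq_mul]
      rw [sub_eq_zero, ← div_eq_inv_mul, ← div_eq_inv_mul]
      exact huw

variable [FiniteDimensional ℝ E]

/-- In the link of `v`, a vertex whose normalised slope is not minimal over all vertices has a
neighbour of smaller slope. -/
theorem exists_slope_lt (R : IsRealization F p) (hE : Module.finrank ℝ E = 3) {v u w : U}
    {N l : E →ₗ[ℝ] ℝ} (hN1 : N (p v) = 1) (hN : ∀ w ∈ verts F, w ≠ v → N (p w) < 1)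
    {f : Finset U} (hf : f ∈ F) (hvf : v ∈ f) (huf : u ∈ f) (hvu : v ≠ u) (hw : w ∈ verts F)
    (hwv : w ≠ v)
    (hlt : (l (p w) - l (p v)) / (1 - N (p w)) < (l (p u) - l (p v)) / (1 - N (p u))) :
    ∃ g ∈ F, v ∈ g ∧ u ∈ g ∧ ∃ a ∈ g, a ≠ v ∧ a ≠ u ∧
      (l (p a) - l (p v)) / (1 - N (p a)) < (l (p u) - l (p v)) / (1 - N (p u)) := by
  classical
  by_contra! hcon
  obtain ⟨a, haf, hav, hau, hfe⟩ := exists_third ((R.card f hf).trans hE) hvf huf hvu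
  obtain ⟨g, hg, hgf, hsub⟩ := R.exists_ridge hf haf
  have hvg := hsub v hvf hav.symm
  have hug := hsub u huf hau.symm
  obtain ⟨b, hbg, hbv, hbu, hge⟩ := exists_third ((R.card g hg).trans hE) hvg hug hvu
  have hag : a ∉ g := fun hag => hgf (R.eq_of_subset hf hg fun x hx => by
    rcases hfe x hx with rfl | rfl | rfl <;> assumption).symm
  have hbf : b ∉ f := fun hbf => hgf (R.eq_of_subset hg hf fun x hx => by
    rcases hge x hx with rfl | rfl | rfl <;> assumption)
  set ρ := (l (p u) - l (p v)) / (1 - N (p u)) with hρ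
  have hpos : ∀ x ∈ verts F, x ≠ v → 0 < 1 - N (p x) := fun x hx hxv => sub_pos.2 (hN x hx hxv)
  have hu' : ρ * (1 - N (p u)) = l (p u) - l (p v) :=
    div_mul_cancel₀ _ (hpos u ⟨f, hf, huf⟩ hvu.symm).ne'
  have hle : ∀ x ∈ verts F, x ≠ v → ρ ≤ (l (p x) - l (p v)) / (1 - N (p x)) →
      l (p v) + ρ ≤ (l + ρ • N) (p x) := fun x hx hxv h => by
    rw [le_div_iff₀ (hpos x hx hxv)] at h
    rw [LinearMap.add_apply, LinearMap.smul_apply, smul_eq_mul]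
    linarith
  -- Slope at least `ρ` means that `l + ρ • N` is at least its value at `v`. If both neighbours of
  -- `u` in the link satisfied this, so would every vertex, including `w`.
  have key := R.nonneg_of_adjacent hf hg hfe hvf huf haf hvg hug hbg hbf hag
    (l := l + ρ • N) (k := l (p v) + ρ)
    (by rw [LinearMap.add_apply, LinearMap.smul_apply, smul_eq_mul, hN1, mul_one])
    (by rw [LinearMap.add_apply, LinearMap.smul_apply, smul_eq_mul]; linarith)
    (hle a ⟨f, hf, haf⟩ hav (hcon f hf hvf huf a haf hav hau))
    (hle b ⟨g, hg, hbg⟩ hbv (hcon g hg hvg hug b hbg hbv hbu)) w hw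
  rw [LinearMap.add_apply, LinearMap.smul_apply, smul_eq_mul] at key
  rw [div_lt_iff₀ (hpos w hw hwv)] at hlt
  linarith

/-- The first cohomology with coefficients modulo two of the boundary of a three-dimensional
simplicial polytope vanishes. -/
theorem exists_potential [DecidableEq U] (R : IsRealization F p) (hE : Module.finrank ℝ E = 3)
    (c : Finset U → ZMod 2) (hc : ∀ f ∈ F, ∑ v ∈ f, c (f.erase v) = 0) :
    ∃ g : U → ZMod 2, ∀ f ∈ F, ∀ x ∈ f, ∀ y ∈ f, x ≠ y → g x + g y = c {x, y} := by
  have hNex : ∀ v ∈ verts F, ∃ N : E →ₗ[ℝ] ℝ, N (p v) = 1 ∧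
      ∀ w ∈ verts F, w ≠ v → N (p w) < 1 := fun v hv => R.exists_vertex_functional hv
  choose! N hN1 hN using hNex
  obtain ⟨l, hl, hρ⟩ := R.exists_generic_functional hN
  have htwo : ∀ x : ZMod 2, x + x = 0 := by decide
  -- The potential is built by sweeping the vertices in the order of `l`; `S` is an initial segment
  -- of this order.
  suffices H : ∀ S : Finset U, (S : Set U) ⊆ verts F →
      (∀ x ∈ S, ∀ y ∈ verts F, l (p y) < l (p x) → y ∈ S) →
      ∃ g : U → ZMod 2, ∀ f ∈ F, ∀ x ∈ f, ∀ y ∈ f, x ∈ S → y ∈ S → x ≠ y →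
        g x + g y = c {x, y} by
    obtain ⟨g, hg⟩ := H R.finite_verts.toFinset (by simp) (by simp +contextual)
    refine ⟨g, fun f hf x hx y hy hxy => hg f hf x hx y hy ?_ ?_ hxy⟩
    · simpa using ⟨f, hf, hx⟩
    · simpa using ⟨f, hf, hy⟩
  intro S
  refine Finset.induction_on_max_value (fun v => l (p v)) S ?_ ?_
  · intro _ _
    exact ⟨0, by simp⟩
  intro v S hvS hmax ih hsub hlow
  have hvV : v ∈ verts F := hsub (by simp)
  have hSV : ∀ x ∈ S, x ∈ verts F := fun x hx => hsub (by simp [hx])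
  obtain ⟨g, hg⟩ := ih hSV fun x hx y hy hyx => by
    refine (Finset.mem_insert.1 (hlow x (Finset.mem_insert_of_mem hx) y hy hyx)).resolve_left ?_
    rintro rfl
    exact absurd (hmax x hx) (not_le.2 hyx)
  set ρ : U → ℝ := fun u => (l (p u) - l (p v)) / (1 - N v (p u)) with hρdef
  have hpos : ∀ x ∈ verts F, x ≠ v → 0 < 1 - N v (p x) := fun x hx hxv =>
    sub_pos.2 (hN v hvV x hx hxv)
  -- Negative slope at `v` means lying below `v`, that is, already swept.
  have hmemS : ∀ x ∈ verts F, x ≠ v → (ρ x < 0 ↔ x ∈ S) := by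
    intro x hx hxv
    rw [hρdef]
    simp only
    rw [div_lt_iff₀ (hpos x hx hxv), zero_mul, sub_neg]
    refine ⟨fun h => ?_, fun h => lt_of_le_of_ne (hmax x h) fun h' => hxv (hl hx hvV h')⟩
    exact (Finset.mem_insert.1 (hlow v (Finset.mem_insert_self v S) x hx h)).resolve_left hxv
  set L : Set U := {u | u ∈ S ∧ ∃ f ∈ F, v ∈ f ∧ u ∈ f} with hL
  have hLfin : L.Finite := S.finite_toSet.subset fun u hu => hu.1
  -- `θ u` is the value at `v` forced by the lower neighbour `u`; what must be shown is that all
  -- lower neighbours force the same one.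
  set θ : U → ZMod 2 := fun u => g u + c {v, u} with hθ
  -- Descent in the link: among lower neighbours with the same forced value, one of least slope has
  -- least slope over all vertices, for otherwise `exists_slope_lt` gives a lower one in a common
  -- triangle, where the cocycle condition preserves `θ`.
  have hmin : ∀ u ∈ L, ∃ w ∈ L, θ w = θ u ∧ ∀ x ∈ verts F, x ≠ v → ρ w ≤ ρ x := by
    intro u hu
    obtain ⟨w, ⟨hw, hwu⟩, hwmin⟩ := Set.exists_min_image {w ∈ L | θ w = θ u} ρ
      (hLfin.subset fun w hw => hw.1) ⟨u, hu, rfl⟩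
    refine ⟨w, hw, hwu, ?_⟩
    by_contra! hcon
    obtain ⟨x, hx, hxv, hlt⟩ := hcon
    obtain ⟨hwS, f, hf, hvf, hwf⟩ := hw
    have hwv : v ≠ w := fun h => hvS (h ▸ hwS)
    obtain ⟨h, hh, hvh, hwh, a, hah, hav, haw, halt⟩ :=
      R.exists_slope_lt hE (hN1 v hvV) (hN v hvV) hf hvf hwf hwv hx hxv hlt
    have hwneg := (hmemS w (hSV w hwS) hwv.symm).2 hwS
    have haS : a ∈ S := (hmemS a ⟨h, hh, hah⟩ hav).1 (halt.trans hwneg)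
    have hcoc := hc h hh
    rw [sum_erase_eq ((R.card h hh).trans hE) hvh hwh hah hwv hav.symm haw.symm,
      ← hg h hh w hwh a hah hwS haS haw.symm] at hcoc
    have hθa : θ a = θ w := by
      rw [hθ]
      simp only
      linear_combination hcoc - htwo (g w) - htwo (c {v, w})
    exact absurd (hwmin a ⟨⟨haS, h, hh, hvh, hah⟩, hθa.trans hwu⟩) (not_le.2 halt)
  -- Slopes at `v` are distinct, so all descents end at the same vertex. This is connectedness of
  -- the descending link.
  obtain ⟨t, ht⟩ : ∃ t, ∀ u ∈ L, θ u = t := by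
    rcases L.eq_empty_or_nonempty with h | ⟨u₀, hu₀⟩
    · exact ⟨0, by simp [h]⟩
    · refine ⟨θ u₀, fun u hu => ?_⟩
      obtain ⟨w, hw, hwu, hw'⟩ := hmin u hu
      obtain ⟨w₀, hw₀, hwu₀, hw₀'⟩ := hmin u₀ hu₀
      have h1 : w ∈ verts F \ {v} := ⟨hSV w hw.1, fun h => hvS (h ▸ hw.1)⟩
      have h2 : w₀ ∈ verts F \ {v} := ⟨hSV w₀ hw₀.1, fun h => hvS (h ▸ hw₀.1)⟩
      have : w = w₀ := hρ v hvV h1 h2 (le_antisymm (hw' w₀ h2.1 h2.2) (hw₀' w h1.1 h1.2))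
      rw [← hwu, this, hwu₀]
  have hvx : ∀ x ∈ S, x ≠ v := fun x hx h => hvS (h ▸ hx)
  refine ⟨Function.update g v t, fun f hf x hx y hy hxS hyS hxy => ?_⟩
  rcases Finset.mem_insert.1 hxS with rfl | hx'
  · have hyS := (Finset.mem_insert.1 hyS).resolve_left hxy.symm
    rw [Function.update_self, Function.update_of_ne hxy.symm, ← ht y ⟨hyS, f, hf, hx, hy⟩]
    simp only [hθ]
    linear_combination htwo (g y)
  rcases Finset.mem_insert.1 hyS with rfl | hy'
  · rw [Function.update_self, Function.update_of_ne hxy, ← ht x ⟨hx', f, hf, hy, hx⟩,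
      Finset.pair_comm x]
    simp only [hθ]
    linear_combination htwo (g x)
  · rw [Function.update_of_ne (hvx x hx'), Function.update_of_ne (hvx y hy')]
    exact hg f hf x hx y hy hx' hy' hxy

/-- The vertices of a three-dimensional simplicial polytope have a colouring with two colours
without monochromatic facets. -/
theorem exists_two_coloring (R : IsRealization F p) (hE : Module.finrank ℝ E = 3) :
    ∃ g : U → ZMod 2, ∀ f ∈ F, ∃ x ∈ f, ∃ y ∈ f, g x ≠ g y := by
  classical
  have hmem : ∀ f, f ∈ R.finite.toFinset ↔ f ∈ F := fun f => R.finite.mem_toFinset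
  obtain ⟨g, hg⟩ := FacetTransversal.exists_two_coloring (F := R.finite.toFinset)
    (fun f hf => (R.card f ((hmem f).1 hf)).trans hE)
    (fun f hf e hef he => R.card_filter_facets ((hmem f).1 hf) hef
      (by rw [he, R.card f ((hmem f).1 hf), hE]))
    (fun c hc => by
      obtain ⟨g, hg⟩ := R.exists_potential hE c fun f hf => hc f ((hmem f).2 hf)
      exact ⟨g, fun f hf => hg f ((hmem f).1 hf)⟩)
  exact ⟨g, fun f hf => hg f ((hmem f).2 hf)⟩

end Link

end IsRealization

/-! ### Simplicial polytopes are realizations of their facets -/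

section Facets

variable {E : Type*} [NormedAddCommGroup E] [NormedSpace ℝ E] {P G : Set E} {c : E}

/-- A proper face is cut out by a functional normalised at an interior point. -/
theorem exists_functional_of_isExposed (hc : ∀ w, ∃ ε : ℝ, 0 < ε ∧ c + ε • w ∈ P)
    (hG : IsExposed ℝ P G) (hne : G.Nonempty) (hGP : G ≠ P) :
    ∃ l : E →ₗ[ℝ] ℝ, (∀ v ∈ P, l (v - c) ≤ 1) ∧ ∀ v, v ∈ G ↔ v ∈ P ∧ l (v - c) = 1 := by
  obtain ⟨L, hL⟩ := hG hne
  obtain ⟨g, hg⟩ := hne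
  have hg' := hg
  rw [hL] at hg'
  have hcP : c ∈ P := by
    obtain ⟨ε, -, h⟩ := hc 0
    simpa using h
  -- If the maximum were attained at `c`, moving from `c` away from any `v` in `P` would show that
  -- `L` is constant on `P`, so the face would not be proper.
  have hpos : 0 < L g - L c := by
    refine sub_pos.2 (lt_of_le_of_ne (hg'.2 c hcP) fun heq => hGP ?_)
    rw [hL]
    refine Set.Subset.antisymm (fun v hv => hv.1) fun v hv => ⟨hv, fun y hy => ?_⟩
    obtain ⟨ε, hε, h⟩ := hc (c - v)
    have h1 := hg'.2 _ h
    rw [map_add, map_smul, map_sub, smul_eq_mul, heq] at h1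
    have h2 := hg'.2 y hy
    nlinarith
  refine ⟨(L g - L c)⁻¹ • (L : E →ₗ[ℝ] ℝ), fun v hv => ?_, fun v => ?_⟩
  · simp only [LinearMap.smul_apply, ContinuousLinearMap.coe_coe, map_sub, smul_eq_mul]
    rw [← mul_sub, inv_mul_le_iff₀ hpos, mul_one]
    linarith [hg'.2 v hv]
  · simp only [LinearMap.smul_apply, ContinuousLinearMap.coe_coe, map_sub, smul_eq_mul]
    rw [← mul_sub, inv_mul_eq_one₀ hpos.ne', hL]
    refine ⟨fun h => ⟨h.1, ?_⟩, fun h => ⟨h.1, fun y hy => ?_⟩⟩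
    · linarith [hg'.2 v h.1, h.2 g hg'.1]
    · linarith [hg'.2 y hy, h.2]

/-- Applying `l` to a linear relation shows that its coefficients sum to zero, so `c` cancels and
the relation is affine. -/
theorem linearIndepOn_sub_of_affineIndependent {t : Finset E}
    (ht : AffineIndependent ℝ (fun x : t => (x : E))) (l : E →ₗ[ℝ] ℝ)
    (hl : ∀ v ∈ t, l (v - c) = 1) : LinearIndepOn ℝ (fun v => v - c) (t : Set E) := by
  rw [linearIndepOn_finset_iff]
  intro a ha v hv
  have hsum : ∑ v ∈ t, a v = 0 := by
    have := congrArg l ha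
    rw [map_sum, map_zero] at this
    rw [← this]
    refine Finset.sum_congr rfl fun v hv => ?_
    rw [map_smul, hl v hv, smul_eq_mul, mul_one]
  have hsum' : ∑ v ∈ t, a v • v = 0 := by
    simp only [smul_sub, Finset.sum_sub_distrib, ← Finset.sum_smul, hsum, zero_smul,
      sub_zero] at ha
    exact ha
  exact affineIndependent_iff.1 ht Finset.univ (fun v => a v)
    (by rw [Finset.sum_coe_sort t a]; exact hsum)
    (by rw [Finset.sum_coe_sort t fun v => a v • v]; exact hsum') ⟨v, hv⟩ (Finset.mem_univ _)

theorem finrank_vectorSpan_convexHull {t : Finset E}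
    (ht : AffineIndependent ℝ (fun x : t => (x : E))) (hne : t.Nonempty) :
    Module.finrank ℝ (vectorSpan ℝ (convexHull ℝ (t : Set E))) + 1 = t.card := by
  rw [← direction_affineSpan, affineSpan_convexHull, direction_affineSpan]
  have hcard := Finset.card_pos.2 hne
  have := ht.finrank_vectorSpan (n := t.card - 1) (by rw [Fintype.card_coe]; omega)
  rw [Subtype.range_coe_subtype] at this
  change Module.finrank ℝ (vectorSpan ℝ (t : Set E)) = _ at this
  omega

end Facets

/-! ### The polar body and facets met by rays -/

section Polar

variable {E : Type*} [NormedAddCommGroup E] [InnerProductSpace ℝ E] {c : E}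

/-- The polar of a finite set with respect to the centre `c`. -/
def polar (s : Finset E) (c : E) : Set E := {z | ∀ v ∈ s, inner ℝ z (v - c) ≤ 1}

theorem inner_le_of_mem_polar {s : Finset E} {z y : E} (hz : z ∈ polar s c)
    (hy : y ∈ convexHull ℝ (s : Set E)) : inner ℝ z (y - c) ≤ 1 := by
  have h : convexHull ℝ (s : Set E) ⊆ {y | innerₛₗ ℝ z y ≤ 1 + inner ℝ z c} := by
    refine convexHull_min (fun v hv => ?_) (convex_halfSpace_le (innerₛₗ ℝ z).isLinear _)
    have := hz v hv
    rw [inner_sub_right] at this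
    simp only [Set.mem_ofPred_eq, innerₛₗ_apply_apply]
    linarith
  have := h hy
  simp only [Set.mem_ofPred_eq, innerₛₗ_apply_apply] at this
  rw [inner_sub_right]
  linarith

variable [FiniteDimensional ℝ E]

/-- A ball of radius `r` about `c` inside the polytope bounds the polar by `2 / r`, on testing `z`
against a point in its own direction. -/
theorem isCompact_polar {s : Finset E} (hc : c ∈ interior (convexHull ℝ (s : Set E))) :
    IsCompact (polar s c) := by
  obtain ⟨r, hr, hball⟩ := Metric.isOpen_iff.1 isOpen_interior c hc
  refine Metric.isCompact_of_isClosed_isBounded ?_ ?_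
  · have : polar s c = ⋂ v ∈ s, {z | inner ℝ z (v - c) ≤ 1} := by
      ext z; simp [polar]
    rw [this]
    exact isClosed_biInter fun v _ => isClosed_le (by fun_prop) continuous_const
  · refine (Metric.isBounded_closedBall (x := (0 : E)) (r := 2 / r)).subset fun z hz => ?_
    rw [mem_closedBall_zero_iff]
    rcases eq_or_ne z 0 with rfl | hz0
    · rw [norm_zero]; positivity
    have hzpos : 0 < ‖z‖ := norm_pos_iff.2 hz0
    have hy : c + (r / 2 * ‖z‖⁻¹) • z ∈ convexHull ℝ (s : Set E) := by
      apply interior_subset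
      apply hball
      rw [Metric.mem_ball, dist_eq_norm, add_sub_cancel_left, norm_smul, Real.norm_eq_abs,
        abs_of_pos (by positivity), mul_assoc, inv_mul_cancel₀ hzpos.ne']
      linarith
    have := inner_le_of_mem_polar hz hy
    rw [add_sub_cancel_left, inner_smul_right, real_inner_self_eq_norm_sq] at this
    rw [le_div_iff₀ hr]
    have h2 : r / 2 * ‖z‖⁻¹ * ‖z‖ ^ 2 = r / 2 * ‖z‖ := by
      field_simp
    rw [h2] at this
    linarith

/-- A linear functional is maximised over the polar at an extreme point. -/
theorem exists_extremePoint_polar {s : Finset E}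
    (hc : c ∈ interior (convexHull ℝ (s : Set E))) (x : E) :
    ∃ m ∈ (polar s c).extremePoints ℝ, ∀ z ∈ polar s c, inner ℝ z x ≤ inner ℝ m x := by
  have hK := isCompact_polar hc
  have hne : (polar s c).Nonempty := ⟨0, fun v _ => by simp⟩
  obtain ⟨z₀, hz₀, hmax⟩ := hK.exists_isMaxOn hne
    (show Continuous fun z => innerSL ℝ x z by fun_prop).continuousOn
  set B : Set E := {z ∈ polar s c | ∀ w ∈ polar s c, innerSL ℝ x w ≤ innerSL ℝ x z} with hB
  have hexp : IsExposed ℝ (polar s c) B := fun _ => ⟨innerSL ℝ x, rfl⟩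
  -- The maximisers form a compact exposed face, whose extreme points are extreme in the whole
  -- polar.
  obtain ⟨m, hm⟩ := (hexp.isCompact hK).extremePoints_nonempty ⟨z₀, hz₀, hmax⟩
  refine ⟨m, hexp.isExtreme.extremePoints_subset_extremePoints hm, fun z hz => ?_⟩
  have := hm.1.2 z hz
  rwa [innerSL_apply_apply, innerSL_apply_apply, real_inner_comm, real_inner_comm m] at this

/-- The tight constraints at an extreme point of the polar span the space. -/
theorem span_tight_eq_top {s : Finset E} {m : E} (hm : m ∈ (polar s c).extremePoints ℝ) :
    Submodule.span ℝ {x | ∃ v ∈ s, inner ℝ m (v - c) = 1 ∧ v - c = x} = ⊤ := by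
  classical
  set W := Submodule.span ℝ {x | ∃ v ∈ s, inner ℝ m (v - c) = 1 ∧ v - c = x} with hW
  by_contra hne
  have hperp : Wᗮ ≠ ⊥ := fun h => hne ((Submodule.orthogonal_eq_bot_iff).1 h)
  obtain ⟨w, hw, hw0⟩ := Submodule.exists_mem_ne_zero_of_ne_bot hperp
  have htight : ∀ v ∈ s, inner ℝ m (v - c) = 1 → inner ℝ w (v - c) = 0 := fun v hv h =>
    (Submodule.mem_orthogonal' _ _).1 hw _ (Submodule.subset_span ⟨v, hv, h, rfl⟩)
  -- If `w` is orthogonal to the tight constraints, the slack of the others allows a move by `ε` in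
  -- both directions `w` and `-w`, against extremality of `m`.
  obtain ⟨ε, hε, hεs⟩ : ∃ ε : ℝ, 0 < ε ∧ ∀ v ∈ s, ε * |inner ℝ w (v - c)| ≤
      1 - inner ℝ m (v - c) := by
    have hev : ∀ v ∈ s, ∀ᶠ ε : ℝ in nhdsWithin 0 (Set.Ioi 0),
        ε * |inner ℝ w (v - c)| ≤ 1 - inner ℝ m (v - c) := by
      intro v hv
      rcases (hm.1 v hv).eq_or_lt with h | h
      · rw [htight v hv h, h]
        simp
      · have : Filter.Tendsto (fun ε : ℝ => ε * |inner ℝ w (v - c)|) (nhdsWithin 0 (Set.Ioi 0))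
            (nhds (0 * |inner ℝ w (v - c)|)) :=
          ((continuous_id.mul continuous_const).tendsto 0).mono_left nhdsWithin_le_nhds
        rw [zero_mul] at this
        exact (this.eventually_lt_const (sub_pos.2 h)).mono fun _ => le_of_lt
    obtain ⟨ε, hε, h⟩ := (((Finset.eventually_all s).2 hev).and self_mem_nhdsWithin).exists.imp
      fun _ h => And.symm h
    exact ⟨ε, hε, h⟩
  have hmem : ∀ σ : ℝ, |σ| = ε → m + σ • w ∈ polar s c := by
    intro σ hσ v hv
    rw [inner_add_left, real_inner_smul_left]
    have h1 := le_abs_self (σ * inner ℝ w (v - c))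
    rw [abs_mul, hσ] at h1
    linarith [hεs v hv]
  have h1 := hmem ε (abs_of_pos hε)
  have h2 := hmem (-ε) (by rw [abs_neg, abs_of_pos hε])
  have h3 := hm.2 h1 h2 ⟨1 / 2, 1 / 2, by norm_num, by norm_num, by norm_num, by module⟩
  have h4 : ε • w = 0 := by simpa using h3
  exact hw0 ((smul_eq_zero.1 h4).resolve_left hε.ne')

/-- The ray through `x` meets the boundary of the polytope in a face with spanning vertices. -/
theorem exists_spanning_face {s : Finset E} (hc : c ∈ interior (convexHull ℝ (s : Set E)))
    {x : E} (hx : x ≠ 0) : ∃ m ∈ (polar s c).extremePoints ℝ, ∃ μ : ℝ, 0 < μ ∧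
      ∃ y ∈ convexHull ℝ (s : Set E), inner ℝ m (y - c) = 1 ∧ μ • (y - c) = x := by
  obtain ⟨m, hm, hmax⟩ := exists_extremePoint_polar hc x
  have hcP : c ∈ convexHull ℝ (s : Set E) := interior_subset hc
  have hμ : 0 < inner ℝ m x := by
    have hev : ∀ v ∈ s, ∀ᶠ ε : ℝ in nhdsWithin 0 (Set.Ioi 0), inner ℝ (ε • x) (v - c) ≤ 1 := by
      intro v hv
      have : Filter.Tendsto (fun ε : ℝ => (inner ℝ (ε • x) (v - c) : ℝ))
          (nhdsWithin 0 (Set.Ioi 0)) (nhds (inner ℝ ((0 : ℝ) • x) (v - c))) :=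
        (Continuous.tendsto (by fun_prop) 0).mono_left nhdsWithin_le_nhds
      rw [zero_smul, inner_zero_left] at this
      exact (this.eventually_lt_const one_pos).mono fun _ => le_of_lt
    obtain ⟨ε, h, hε⟩ := (((Finset.eventually_all s).2 hev).and self_mem_nhdsWithin).exists
    have h1 := hmax (ε • x) h
    rw [real_inner_smul_left, real_inner_self_eq_norm_sq] at h1
    have : 0 < ε * ‖x‖ ^ 2 := mul_pos hε (pow_pos (norm_pos_iff.2 hx) 2)
    linarith
  set μ : ℝ := inner ℝ m x with hμdef
  refine ⟨m, hm, μ, hμ, c + μ⁻¹ • x, ?_, ?_, ?_⟩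
  -- Bipolar argument: a functional separating `y` from the polytope, normalised at `c`, lies in the
  -- polar and has a value at `x` above the maximum `μ`.
  · by_contra hy
    obtain ⟨f, u, hfu, huy⟩ := geometric_hahn_banach_closed_point (convex_convexHull ℝ (s : Set E))
      (s.finite_toSet.isClosed_convexHull ℝ) hy
    have hu : 0 < u - f c := sub_pos.2 (hfu c hcP)
    set w := (InnerProductSpace.toDual ℝ E).symm f with hw
    have hwf : ∀ z, inner ℝ w z = f z := fun z => by
      rw [hw, InnerProductSpace.toDual_symm_apply]
    have h1 := hmax ((u - f c)⁻¹ • w) fun v hv => by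
      rw [real_inner_smul_left, hwf, map_sub, inv_mul_le_iff₀ hu, mul_one]
      linarith [hfu v (subset_convexHull ℝ _ hv)]
    rw [real_inner_smul_left, hwf, inv_mul_le_iff₀ hu] at h1
    rw [map_add, map_smul, smul_eq_mul] at huy
    have h2 : u - f c < μ⁻¹ * f x := by linarith
    rw [lt_inv_mul_iff₀ hμ] at h2
    linarith
  · rw [add_sub_cancel_left, inner_smul_right, ← hμdef, inv_mul_cancel₀ hμ.ne']
  · rw [add_sub_cancel_left, smul_inv_smul₀ hμ.ne']

end Polar

/-! ### Realizations from polytopes, and the bound in dimension three -/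

section Realization

variable {E : Type*} [NormedAddCommGroup E] [InnerProductSpace ℝ E] [FiniteDimensional ℝ E]
  [Nontrivial E] {P : Set E}

/-- The vertex sets of the facets of `P`. -/
def facetVertexSets (P : Set E) : Set (Finset E) :=
  {e | ∃ G, IsPolytopeFacet P G ∧ (e : Set E) = G.extremePoints ℝ}

/-- The origin is moved to an interior point `c`. Support comes from the exposing functionals.
Covering is the substantial part: a ray from `c` leaves through the face exposed by an extreme point
of the polar, and this face is a facet since its tight vertices span. -/
theorem IsSimplicialPolytope.exists_isRealization
    (hP : IsSimplicialPolytope (Module.finrank ℝ E) P) :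
    ∃ c : E, IsRealization (facetVertexSets P) (fun v => v - c) := by
  classical
  obtain ⟨s, rfl⟩ := hP.exists_convexHull
  set P := convexHull ℝ (s : Set E) with hPdef
  have hspan : vectorSpan ℝ P = ⊤ := Submodule.eq_top_of_finrank_eq hP.dim_eq
  have hint : (interior P).Nonempty := by
    rw [(convex_convexHull ℝ _).interior_nonempty_iff_affineSpan_eq_top,
      ← AffineSubspace.direction_eq_top_iff_of_nonempty
        ((affineSpan_nonempty ℝ).2 hP.nonempty), direction_affineSpan, hspan]
  obtain ⟨c, hc⟩ := hint
  have hcray : ∀ w, ∃ ε : ℝ, 0 < ε ∧ c + ε • w ∈ P := by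
    intro w
    have h : Filter.Tendsto (fun ε : ℝ => c + ε • w) (nhdsWithin 0 (Set.Ioi 0))
        (nhds (c + (0 : ℝ) • w)) :=
      (Continuous.tendsto (by fun_prop) 0).mono_left nhdsWithin_le_nhds
    rw [zero_smul, add_zero] at h
    obtain ⟨ε, h, hε⟩ := ((h.eventually (mem_interior_iff_mem_nhds.1 hc)).and
      self_mem_nhdsWithin).exists
    exact ⟨ε, hε, h⟩
  have hfin : (P.extremePoints ℝ).Finite :=
    s.finite_toSet.subset extremePoints_convexHull_subset
  have hext : ∀ v ∈ verts (facetVertexSets P), v ∈ P.extremePoints ℝ := by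
    rintro v ⟨f, ⟨G, hG, hfG⟩, hv⟩
    exact hG.1.isExtreme.extremePoints_subset_extremePoints (hfG ▸ Finset.mem_coe.2 hv)
  have hfacet : ∀ f ∈ facetVertexSets P, f.card = Module.finrank ℝ E ∧
      LinearIndepOn ℝ (fun v => v - c) (f : Set E) ∧ ∃ l : E →ₗ[ℝ] ℝ, (∀ v ∈ f, l (v - c) = 1) ∧
        ∀ v ∈ verts (facetVertexSets P), v ∉ f → l (v - c) < 1 := by
    rintro f ⟨G, ⟨hexp, hne, hdim⟩, hfG⟩
    have hGP : G ≠ P := fun h => by rw [h] at hdim; omega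
    obtain ⟨t, ht, rfl⟩ := hP.simplicial G hexp hGP
    rw [extremePoints_convexHull_of_affineIndependent ht, Finset.coe_inj] at hfG
    subst hfG
    obtain ⟨l, hl, hlG⟩ := exists_functional_of_isExposed hcray hexp hne hGP
    have hl1 : ∀ v ∈ f, l (v - c) = 1 := fun v hv =>
      ((hlG v).1 (subset_convexHull ℝ _ hv)).2
    rw [finrank_vectorSpan_convexHull ht (by simpa using hne), hP.dim_eq] at hdim
    refine ⟨hdim, linearIndepOn_sub_of_affineIndependent ht l hl1, l, hl1, fun v hv hvf => ?_⟩
    have hvP := hext v hv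
    refine lt_of_le_of_ne (hl v hvP.1) fun h => hvf ?_
    have := inter_extremePoints_subset_extremePoints_of_subset (𝕜 := ℝ)
      (fun x hx => ((hlG x).1 hx).1) ⟨(hlG v).2 ⟨hvP.1, h⟩, hvP⟩
    rw [extremePoints_convexHull_of_affineIndependent ht] at this
    exact this
  have hcover : ∀ x : E, x ≠ 0 → ∃ f ∈ facetVertexSets P, ∃ a : E → ℝ, (∀ v, 0 ≤ a v) ∧
      ∑ v ∈ f, a v • (v - c) = x := by
    intro x hx
    obtain ⟨m, hm, μ, hμ, y, hy, hmy, hyx⟩ := exists_spanning_face hc hx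
    set G : Set E := {z ∈ P | inner ℝ m (z - c) = 1} with hGdef
    have hle : ∀ z ∈ P, inner ℝ m (z - c) ≤ 1 := fun z hz => inner_le_of_mem_polar hm.1 hz
    have hexp : IsExposed ℝ P G := by
      intro _
      refine ⟨innerSL ℝ m, ?_⟩
      ext z
      simp only [hGdef, Set.mem_ofPred_eq, innerSL_apply_apply]
      rw [inner_sub_right] at hmy
      refine and_congr_right fun hz => ⟨fun h w hw => ?_, fun h => ?_⟩
      · have := hle w hw
        rw [inner_sub_right] at this h
        linarith
      · have h1 := hle z hz
        have h2 := h y hy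
        rw [inner_sub_right] at h1 ⊢
        linarith
    have hne : G.Nonempty := ⟨y, hy, hmy⟩
    have hGP : G ≠ P := fun h => by
      have hcG : c ∈ G := by rw [h]; exact interior_subset hc
      have := hcG.2
      simp at this
    obtain ⟨t, ht, hGt⟩ := hP.simplicial G hexp hGP
    have ht1 : ∀ v ∈ t, (innerₛₗ ℝ m : E →ₗ[ℝ] ℝ) (v - c) = 1 := fun v hv => by
      have : v ∈ G := hGt ▸ subset_convexHull ℝ _ hv
      exact this.2
    have hind := linearIndepOn_sub_of_affineIndependent ht _ ht1
    have hcomb : ∀ z ∈ G, ∃ a : E → ℝ, (∀ v, 0 ≤ a v) ∧ ∑ v ∈ t, a v • (v - c) = z - c := by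
      intro z hz
      rw [hGt, Finset.mem_convexHull'] at hz
      obtain ⟨a, ha0, ha1, ha⟩ := hz
      refine ⟨fun v => if v ∈ t then a v else 0, fun v => ?_, ?_⟩
      · simp only
        split_ifs with h
        · exact ha0 v h
        · exact le_rfl
      · have : ∀ v ∈ t, (if v ∈ t then a v else 0) • (v - c) = a v • (v - c) := fun v hv => by
          rw [if_pos hv]
        rw [Finset.sum_congr rfl this]
        simp only [smul_sub, Finset.sum_sub_distrib, ← Finset.sum_smul, ha1, ha, one_smul]
    -- The tight points of `s` may include points that are not vertices of the simplex; each is a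
    -- combination of the simplex vertices, which therefore span too.
    have hspan_t : Submodule.span ℝ ((fun v => v - c) '' (t : Set E)) = ⊤ := by
      rw [eq_top_iff, ← span_tight_eq_top hm, Submodule.span_le]
      rintro _ ⟨v, hv, hv1, rfl⟩
      obtain ⟨a, -, ha⟩ := hcomb v ⟨subset_convexHull ℝ _ hv, hv1⟩
      rw [← ha]
      exact Submodule.sum_mem _ fun w hw =>
        Submodule.smul_mem _ _ (Submodule.subset_span ⟨w, hw, rfl⟩)
    have hcard : t.card = Module.finrank ℝ E := by
      rw [← finrank_top ℝ E, ← hspan_t, Set.image_eq_range, finrank_span_eq_card hind]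
      simp
    have htne : t.Nonempty := by
      rw [hGt] at hne
      simpa using hne
    obtain ⟨a, ha0, ha⟩ := hcomb y ⟨hy, hmy⟩
    refine ⟨t, ⟨G, ⟨hexp, hne, ?_⟩, ?_⟩, fun v => μ * a v, fun v => mul_nonneg hμ.le (ha0 v), ?_⟩
    · rw [hGt, finrank_vectorSpan_convexHull ht htne, hcard, hP.dim_eq]
    · rw [hGt, extremePoints_convexHull_of_affineIndependent ht]
    · simp only [mul_smul, ← Finset.smul_sum]
      rw [ha, hyx]
  refine ⟨c, ?_, fun f hf => (hfacet f hf).1, fun f hf => (hfacet f hf).2.1,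
    fun f hf => (hfacet f hf).2.2, fun x => ?_⟩
  · refine (hfin.toFinset.powerset.finite_toSet).subset fun f hf => ?_
    rw [Finset.mem_coe, Finset.mem_powerset]
    exact fun v hv => hfin.mem_toFinset.2 (hext v ⟨f, hf, hv⟩)
  · rcases eq_or_ne x 0 with rfl | hx
    · obtain ⟨x, hx⟩ := exists_ne (0 : E)
      obtain ⟨f, hf, -⟩ := hcover x hx
      exact ⟨f, hf, 0, fun _ => le_rfl, by simp⟩
    · exact hcover x hx

/-- The transversal number of a three-dimensional simplicial polytope is at most half the number
of its vertices. -/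
theorem IsSimplicialPolytope.two_mul_transversalNumber_le (hE : Module.finrank ℝ E = 3)
    (hP : IsSimplicialPolytope 3 P) :
    2 * transversalNumber (polytopeFacetHypergraph P) ≤
      (polytopeFacetHypergraph P).vertexSet.ncard := by
  classical
  obtain ⟨c, R⟩ := (hE.symm ▸ hP : IsSimplicialPolytope (Module.finrank ℝ E) P).exists_isRealization
  obtain ⟨g, hg⟩ := R.exists_two_coloring hE
  obtain ⟨s, rfl⟩ := hP.exists_convexHull
  set P := convexHull ℝ (s : Set E) with hPdef
  have hfin : (P.extremePoints ℝ).Finite :=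
    s.finite_toSet.subset extremePoints_convexHull_subset
  have htwo : ∀ a b : ZMod 2, a ≠ b → a = 0 ∧ b ≠ 0 ∨ a ≠ 0 ∧ b = 0 := by decide
  have hedge : ∀ e ∈ (polytopeFacetHypergraph P).edgeSet,
      (∃ x ∈ e, g x = 0) ∧ ∃ x ∈ e, g x ≠ 0 := by
    rintro e ⟨G, hG, rfl⟩
    have hGfin : (G.extremePoints ℝ).Finite :=
      hfin.subset hG.1.isExtreme.extremePoints_subset_extremePoints
    obtain ⟨x, hx, y, hy, hxy⟩ := hg hGfin.toFinset ⟨G, hG, by simp⟩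
    rw [hGfin.mem_toFinset] at hx hy
    rcases htwo _ _ hxy with ⟨h1, h2⟩ | ⟨h1, h2⟩
    · exact ⟨⟨x, hx, h1⟩, y, hy, h2⟩
    · exact ⟨⟨y, hy, h2⟩, x, hx, h1⟩
  -- Applied to both colours: each class meets every facet, and the two sizes add up to the number
  -- of vertices.
  have hsub : ∀ q : E → Prop, [DecidablePred q] →
      (∀ e ∈ (polytopeFacetHypergraph P).edgeSet, ∃ x ∈ e, q x) →
      transversalNumber (polytopeFacetHypergraph P) ≤ (hfin.toFinset.filter q).card := by
    intro q _ hq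
    refine Nat.sInf_le ⟨_, ⟨fun x hx => ?_, fun e he => ?_⟩, rfl⟩
    · exact hfin.mem_toFinset.1 (Finset.mem_filter.1 hx).1
    · obtain ⟨x, hx, hqx⟩ := hq e he
      refine ⟨x, Finset.mem_filter.2 ⟨hfin.mem_toFinset.2 ?_, hqx⟩, hx⟩
      exact (polytopeFacetHypergraph P).subset_vertexSet_of_mem_edgeSet' he hx
  have h1 := hsub (fun x => g x = 0) fun e he => (hedge e he).1
  have h2 := hsub (fun x => ¬g x = 0) fun e he => (hedge e he).2
  have h3 := Finset.card_filter_add_card_filter_not (s := hfin.toFinset) fun x => g x = 0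
  have h4 : (polytopeFacetHypergraph P).vertexSet.ncard = hfin.toFinset.card :=
    Set.ncard_eq_toFinset_card _ hfin
  rw [h4]
  omega

end Realization

end FacetTransversal

/-! ### Assembly of the theorem -/

theorem mainTheorem1 :
    (∀ d : ℕ, 2 ≤ d →
      -- infinitely many pairwise non-isomorphic simplicial `(d+1)`-polytopes with ratio `2/(d+2)`,
      -- the boundary complex of the `i`-th one being some `X^d_{i+1}`
      (∃ P : ℕ → Set (EuclideanSpace ℝ (Fin (d + 1))),
        (∀ i j, i ≠ j → ¬ Isomorphic (boundaryComplex (P i)) (boundaryComplex (P j))) ∧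
        ∀ i, IsSimplicialPolytope (d + 1) (P i) ∧
          transversalRatio (polytopeFacetHypergraph (P i)) = 2 / ((d : ℚ) + 2) ∧
          ∃ (V : Type) (X : PreAbstractSimplicialComplex V) (a : V),
            IsX d (i + 1) V X a ∧ Isomorphic X (boundaryComplex (P i))) ∧
      -- whatever the choices in its construction, `X^d_k` has these properties
      (∀ (k : ℕ) (V : Type) (X : PreAbstractSimplicialComplex V) (a : V), IsX d k V X a →
        (vertices X).ncard = k * (d + 2) ∧
        transversalNumber (facetHypergraph X) = 2 * k ∧
        ∃ P : Set (EuclideanSpace ℝ (Fin (d + 1))),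
          IsSimplicialPolytope (d + 1) P ∧ Isomorphic X (boundaryComplex P))) ∧
    -- for `d = 2` the ratio is the largest possible one
    IsGreatest {r : ℚ | ∃ P : Set (EuclideanSpace ℝ (Fin 3)),
      IsSimplicialPolytope 3 P ∧ r = transversalRatio (polytopeFacetHypergraph P)} (1 / 2) := by
  refine ⟨fun d hd => ⟨?_, fun k V X a hX => ?_⟩, ?_, ?_⟩
  · choose V X a hX using exists_isX hd
    choose P hP hiso hτ hV using fun k => (IsX.properties hd (hX k)).2.2
    -- The number of vertices, `(i + 1) * (d + 2)`, is an isomorphism invariant that separates the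
    -- polytopes.
    refine ⟨P, fun i j hij h => hij ?_, fun i => ⟨hP i, ?_, V i, X i, a i, hX i, hiso i⟩⟩
    · have h1 := ncard_vertices_eq_of_isomorphic (hiso i)
      have h2 := ncard_vertices_eq_of_isomorphic (hiso j)
      have h3 := ncard_vertices_eq_of_isomorphic h
      rw [(IsX.properties hd (hX i)).1] at h1
      rw [(IsX.properties hd (hX j)).1] at h2
      have h4 : (i + 1) * (d + 2) = (j + 1) * (d + 2) := by omega
      have := Nat.eq_of_mul_eq_mul_right (by omega) h4
      omega
    · rw [transversalRatio, hτ, hV]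
      push_cast
      field_simp
  · obtain ⟨h1, h2, P, hP, hiso, -⟩ := IsX.properties hd hX
    exact ⟨h1, h2, P, hP, hiso⟩
  -- The tetrahedron already attains the bound, with two of its four vertices.
  · obtain ⟨V, X, a, hX⟩ := exists_isX le_rfl 0
    obtain ⟨-, -, P, hP, -, hτ, hV⟩ := IsX.properties le_rfl hX
    refine ⟨P, hP, ?_⟩
    rw [transversalRatio, hτ, hV]
    norm_num
  · rintro r ⟨P, hP, rfl⟩
    have h : (2 : ℚ) * transversalNumber (polytopeFacetHypergraph P) ≤
        (polytopeFacetHypergraph P).vertexSet.ncard := by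
      exact_mod_cast hP.two_mul_transversalNumber_le (by simp)
    exact div_le_of_le_mul₀ (by positivity) (by norm_num) (by linarith)
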